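/- **Setting.** Let $N_T,N_R,N_S,N,\kappa,K_T,K_R\ge 1$ be integers and $K=\min(K_T,K_R)$. There are $2M$ subcarriers with frequencies $\omega_k=2\pi(k-1)/(2M)$, $1\le k\le 2M$; $\mathrm j$ is the imaginary unit and $X^{(r)}$ is the $r$-th derivative. *(As1)* $p,q:[-T_s\kappa/2,T_s\kappa/2]\to\mathbb R$ ($T_s>0$) are $\mathcal C^{R+1}$ with $R\ge K_T+K_R$, and their derivatives of orders $0,\dots,R+1$ vanish at $\pm T_s\kappa/2$. Put $p^{(r)}[n]=T_s^r\,p^{(r)}\big((n-\tfrac{2M\kappa+1}{2})\tfrac{T_s}{2M}\big)$ for $1\le n\le 2M\kappa$ and $p^{(r)}[n]=0$ otherwise; likewise $q^{(r)}[n]$. *(As2)* $\mathbf A(\omega)\in\mathbb C^{N_T\times N_S}$, $\mathbf B(\omega)\in\mathbb C^{N_R\times N_S}$, $\mathbf H(\omega)\in\mathbb C^{N_R\times N_T}$ are $2\pi$-periodic and $\mathcal C^{R'+1}$ with $R'>(2R+1)(R+1)$, and $\mathbf B^H(\omega)\mathbf H(\omega)\mathbf A(\omega)=\mathbf I_{N_S}$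 for all $\omega$. *(As3), (As4)* For each $M$, $\{\mathbf s_n(\ell)\}_k$ ($1\le n\le N_S$, $1\le k\le 2M$, $1\le \ell\le N$) are random complex symbols, all lying in a bounded set that does not depend on $M$; the real and imaginary parts of all of them are independent and identically distributed with zero mean and power $P_s/2$. *Modem.* Let $\mathbf S_n$ be the $2M\times 2N$ staggered matrix with columns $2\ell-1$ and $2\ell$ equal to $\mathrm{Re}\,\mathbf s_n(\ell)$ and $\mathrm j\,\mathrm{Im}\,\mathbf s_n(\ell)$, and $\phi_k=e^{-\mathrm j\pi(M+1)(k-1)/(2M)}$. For sequences $g,h$ supported on $\{1,\dots,2M\kappa\}$, a $2\pi$-periodic $F$ with $f[i]=\frac1{2\pi}\int_0^{2\pi}F(\omega)e^{\mathrm j\omega i}d\omega$, and a $2M\times2N$ matrix $\mathbf S$, let $$x[t]=\tfrac1{\sqrt{2M}}\sum_{k=1}^{2M}\sum_{i=1}^{2N}\phi_k^*\,\mathbf S_{k,i}\;g[t-M(i-1)]\,e^{\mathrm j\omega_k(t-M(i-1)-1)},\qquad r[t]=\sum_{i\in\mathbb Z}f[i]\,x[t-i],$$ $$\{\mathcal Z^F_{g,h}(\mathbf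 S)\}_{k,i}=\tfrac{2\phi_k}{\sqrt{2M}}\sum_{m=1}^{2M\kappa}h[m]\,e^{\mathrm j\omega_k m}\,r[Mi+1-m].$$ With $\Lambda(X)=\mathrm{diag}(X(\omega_1),\dots,X(\omega_{2M}))$, the noiseless multi-stage receiver output is $$\mathcal Z_n=\sum_{\ell_1=0}^{K_T-1}\sum_{\ell_2=0}^{K_R-1}\frac{(-\mathrm j)^{\ell_1+\ell_2}}{\ell_1!\,\ell_2!\,(2M)^{\ell_1+\ell_2}}\sum_{n_S,n_R,n_T}\Lambda\big(B^{(\ell_2)*}_{n_R,n}\big)\,\mathcal Z^{H_{n_R,n_T}}_{p^{(\ell_1)},q^{(\ell_2)}}\big(\Lambda(A^{(\ell_1)}_{n_T,n_S})\mathbf S_{n_S}\big),$$ and the symbol estimate is $\hat{\mathbf s}_n(\ell)=\mathrm{Re}\{\mathcal Z_n\}_{:,2(\ell+\kappa-1)}+\mathrm j\,\mathrm{Im}\{\mathcal Z_n\}_{:,2(\ell+\kappa)-1}$. *Pulse quantities.* For a pulse $g$ let $\mathbf P_g$ be the $2M\times\kappa$ matrix with $(i,u)$ entry $g[2M(u-1)+i]$.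 Let $\mathbf J_a$ be the $a\times a$ anti-identity, $\circledast$ row-wise convolution, $\mathcal R(g,h)=\mathbf P_g\circledast\mathbf J_{2M}\mathbf P_h$, $\mathcal S(g,h)=(\mathbf J_2\otimes\mathbf I_M)\mathbf P_g\circledast\mathbf J_{2M}\mathbf P_h$, $\mathbf U^{\pm}=\mathbf I_2\otimes(\mathbf I_M\pm\mathbf J_M)$, $\mathcal I$ the $2M\times(2\kappa-1)$ matrix with ones in its central column and zeros elsewhere. Write $\mathcal R_{m,n}=\mathcal R(p^{(m)},q^{(n)})$, $\mathcal S_{m,n}=\mathcal S(p^{(m)},q^{(n)})$, $\bar{\mathcal R}=\mathcal R_{0,0}-\frac12\mathcal I$, and $$\eta^{(\pm,\mp)}_{(m,n,m',n')}=\tfrac{P_s}{2M}\mathrm{tr}\big[\mathcal R_{m,n}\mathcal R_{m',n'}^T\mathbf U^{\pm}+\mathcal S_{m,n}\mathcal S_{m',n'}^T\mathbf U^{\mp}\big],$$ $$\delta=\tfrac{P_s}{2M}\mathrm{tr}\big[\bar{\mathcal R}\bar{\mathcal R}^T\mathbf U^++\mathcal S_{0,0}\mathcal S_{0,0}^T\mathbf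 U^-\big],\qquad \mu_{(m,n)}=\tfrac{P_s}{2M}\mathrm{tr}\big[\bar{\mathcal R}\mathcal R_{m,n}^T\mathbf U^++\mathcal S_{0,0}\mathcal S_{m,n}^T\mathbf U^-\big],$$ $$\tilde\mu^{(K')}_{(\ell,m)}=\sum_{j=K'}^{\ell}(-1)^{j+K'}\binom{\ell}{j}\binom{j-1}{K'-1}\mu_{(j,m-j)},$$ $$\Psi_K^{(\pm,\mp)}=\begin{bmatrix}\eta^{(\pm,\mp)}_{(K,0,K,0)}\mathbb I_{\{K_T=K\}}&\eta^{(\pm,\mp)}_{(K,0,0,K)}\mathbb I_{\{K_R=K_T\}}\\ \eta^{(\pm,\mp)}_{(K,0,0,K)}\mathbb I_{\{K_R=K_T\}}&\eta^{(\pm,\mp)}_{(0,K,0,K)}\mathbb I_{\{K_R=K\}}\end{bmatrix}.$$ *Channel quantities* (functions of $\omega$, for $\ell\le m$): $$\alpha^{(m,\ell)}_{n,n_S}=\tfrac{\sqrt2(-\mathrm j)^m}{m!}\tbinom m\ell\{(\mathbf B^H\mathbf H)^{(m-\ell)}\mathbf A^{(\ell)}\}_{n,n_S},\qquad \beta^{(m,\ell)}_{n,n_S}=\tfrac{\sqrt2(-\mathrm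 j)^m}{m!}\tbinom m\ell\{\mathbf B^{(\ell)H}(\mathbf H\mathbf A)^{(m-\ell)}\}_{n,n_S},$$ $$\gamma_{n,n_S}=\tfrac{\sqrt2(-\mathrm j)^{K_R+K_T}}{K_T!K_R!}\{\mathbf B^{(K_R)H}\mathbf H\mathbf A^{(K_T)}\}_{n,n_S},\qquad \xi^{(m,\ell)}_{n,n_S}=[\alpha^{(m,\ell)}_{n,n_S},\beta^{(m,\ell)}_{n,n_S}]^T.$$ **Theorem.** Under (As1)–(As4), for every stream $1\le n\le N_S$ and every $\ell\in\{\kappa+1,\dots,N-\kappa\}$, $$\mathbb E\big[|\{\hat{\mathbf s}_n(\ell)\}_k-\{\mathbf s_n(\ell)\}_k|^2\big]=P_e(k,n)+o(M^{-2K})\qquad(M\to\infty),$$ uniformly in $1\le k\le 2M$, where $P_e=P_{e,1}+P_{e,2}$ with $$P_{e,1}(k,n)=2\delta-\sum_{m=K_R}^{2K}\frac{2\sqrt2}{(2M)^m}\sum_{\ell=K_R}^m\mu_{(0,m)}\mathrm{Re}\,\beta^{(m,\ell)}_{n,n}-\sum_{m=K_T}^{2K}\frac{2\sqrt2}{(2M)^m}\sum_{\ell=K_T}^m\tilde\mu^{(K_T)}_{(\ell,m)}\mathrm{Re}\,\alpha^{(m,\ell)}_{n,n}+\frac{2\sqrt2}{(2M)^{2K}}\mathrm{Re}(\gamma_{n,n})\,\mu_{(K,K)}\mathbb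 I_{\{K_R=K_T\}},$$ $$P_{e,2}(k,n)=\frac1{(2M)^{2K}}\sum_{n_S=1}^{N_S}\Big(\mathrm{Re}^T[\xi^{(K,K)}_{n,n_S}]\Psi_K^{(+,-)}\mathrm{Re}[\xi^{(K,K)}_{n,n_S}]+\mathrm{Im}^T[\xi^{(K,K)}_{n,n_S}]\Psi_K^{(-,+)}\mathrm{Im}[\xi^{(K,K)}_{n,n_S}]\Big),$$ all frequency-dependent quantities being evaluated at $\omega=\omega_k$. Moreover $P_{e,2}(k,n)=O(M^{-2K})$ as $M\to\infty$, uniformly in $k$. -/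

import Mathlib

noncomputable section

namespace FBMC

open Complex Matrix MeasureTheory ProbabilityTheory
open scoped Kronecker

/-! ### Prototype pulses and the FBMC/OQAM modem for a single antenna pair

There are `2 * M` subcarriers. A subcarrier is an element `k : Fin (2 * M)`, the value `k`
standing for the `(k + 1)`-st subcarrier. Discrete time runs over `ℤ`. -/

/-- The closed interval `[-Ts κ / 2, Ts κ / 2]` on which the analog pulses live. -/
def pulseSupport (Ts : ℝ) (κ : ℕ) : Set ℝ := Set.Icc (-(Ts * κ / 2)) (Ts * κ / 2)

/-- The samples `g^(r)[n] = Ts ^ r * g^(r) ((n - (2Mκ + 1) / 2) * Ts / (2M))`, `1 ≤ n ≤ 2Mκ`, of the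
`r`-th derivative of the analog waveform `g`; the sequence is zero at all other times. -/
def pulseSample (Ts : ℝ) (κ M : ℕ) (g : ℝ → ℝ) (r : ℕ) (n : ℤ) : ℝ :=
  if 1 ≤ n ∧ n ≤ 2 * (M : ℤ) * κ then
    Ts ^ r * iteratedDerivWithin r g (pulseSupport Ts κ)
      (((n : ℝ) - (2 * (M : ℝ) * κ + 1) / 2) * (Ts / (2 * (M : ℝ))))
  else 0

/-- Subcarrier frequency `2π (k' - 1) / (2M)`, where `k' = k + 1` is the subcarrier number. -/
def freq (M : ℕ) (k : Fin (2 * M)) : ℝ := 2 * Real.pi * ((k : ℕ) : ℝ) / (2 * (M : ℝ))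

/-- The phase `exp (-j π (M + 1) (k' - 1) / (2M))` of the subcarrier number `k' = k + 1`. -/
def phase (M : ℕ) (k : Fin (2 * M)) : ℂ :=
  exp (-(I * Real.pi * ((M : ℂ) + 1) * ((k : ℕ) : ℂ) / (2 * (M : ℂ))))

/-- The diagonal matrix `Λ(X) = diag (X (ω_1), …, X (ω_{2M}))`. -/
def Lam (M : ℕ) (X : ℝ → ℂ) : Matrix (Fin (2 * M)) (Fin (2 * M)) ℂ :=
  Matrix.diagonal fun k => X (freq M k)

/-- OQAM staggering of a `2M × N` matrix of complex symbols. The column `(ℓ, 0)` holds the real parts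
and the column `(ℓ, 1)` holds `j` times the imaginary parts of the `ℓ`-th multicarrier symbol.
The column `(ℓ, e)` is transmitted at position `2 ℓ + e`, one position being `M` samples. -/
def stagger {M N : ℕ} (s : Matrix (Fin (2 * M)) (Fin N) ℂ) :
    Matrix (Fin (2 * M)) (Fin N × Fin 2) ℂ :=
  Matrix.of fun k c => if c.2 = 0 then ((s k c.1).re : ℂ) else I * ((s k c.1).im : ℂ)

/-- FBMC synthesis filterbank: each subcarrier stream is interpolated by `M`, filtered with the
prototype pulse `p` shifted to the frequency of the subcarrier, and the results are summed. -/
def modulate {M N : ℕ} (p : ℤ → ℝ) (S : Matrix (Fin (2 * M)) (Fin N × Fin 2) ℂ) (n : ℤ) : ℂ :=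
  (1 / (Real.sqrt (2 * (M : ℝ)) : ℂ)) *
    ∑ k : Fin (2 * M), ∑ c : Fin N × Fin 2,
      star (phase M k) * S k c *
        (p (n - (M : ℤ) * (2 * ((c.1 : ℕ) : ℤ) + ((c.2 : ℕ) : ℤ))) : ℂ) *
        exp (I * freq M k *
          ((n - (M : ℤ) * (2 * ((c.1 : ℕ) : ℤ) + ((c.2 : ℕ) : ℤ)) - 1 : ℤ) : ℂ))

/-- Impulse response `f[i] = (1 / 2π) ∫₀^{2π} F(ω) e^{jωi} dω` of the frequency response `F`. -/
def impulseResponse (F : ℝ → ℂ) (i : ℤ) : ℂ :=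
  (1 / (2 * (Real.pi : ℂ))) * ∫ ω in (0 : ℝ)..(2 * Real.pi), F ω * exp (I * ω * (i : ℂ))

/-- Output of the channel with frequency response `F`. It is applied to finitely supported signals,
for which the sum is finite. -/
def channel (F : ℝ → ℂ) (x : ℤ → ℂ) (n : ℤ) : ℂ := ∑' i : ℤ, impulseResponse F i * x (n - i)

/-- FBMC analysis filterbank: filtering with the receive pulse `q` shifted to the frequency of the
subcarrier, and decimation by `M`. The integer `j` is the number of the output column. -/
def demodulate (κ : ℕ) {M : ℕ} (q : ℤ → ℝ) (r : ℤ → ℂ) (k : Fin (2 * M)) (j : ℤ) : ℂ :=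
  2 * phase M k * (1 / (Real.sqrt (2 * (M : ℝ)) : ℂ)) *
    ∑ m ∈ Finset.Icc (1 : ℤ) (2 * (M : ℤ) * κ),
      (q m : ℂ) * exp (I * freq M k * (m : ℂ)) * r ((M : ℤ) * j + 1 - m)

/-- The received samples `𝒵_{p,q}^F(S)`. -/
def receivedSISO (κ : ℕ) {M N : ℕ} (p q : ℤ → ℝ) (F : ℝ → ℂ)
    (S : Matrix (Fin (2 * M)) (Fin N × Fin 2) ℂ) (k : Fin (2 * M)) (j : ℤ) : ℂ :=
  demodulate κ q (channel F (modulate p S)) k j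

/-! ### The parallel multi-stage MIMO transceiver -/

/-- Entrywise `r`-th derivative of a matrix-valued function of the frequency. -/
def matDeriv {a b : ℕ} (r : ℕ) (X : ℝ → Matrix (Fin a) (Fin b) ℂ) (ω : ℝ) :
    Matrix (Fin a) (Fin b) ℂ :=
  Matrix.of fun i j => iteratedDeriv r (fun w => X w i j) ω

/-- The data of the system: symbol period, overlapping factor, analog transmit and receive pulses,
precoder, linear receiver, channel, and the numbers of parallel stages. -/
structure Transceiver (NT NR NS : ℕ) where
  Ts : ℝ
  κ : ℕ
  p : ℝ → ℝ
  q : ℝ → ℝ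
  A : ℝ → Matrix (Fin NT) (Fin NS) ℂ
  B : ℝ → Matrix (Fin NR) (Fin NS) ℂ
  H : ℝ → Matrix (Fin NR) (Fin NT) ℂ
  KT : ℕ
  KR : ℕ

namespace Transceiver

variable {NT NR NS : ℕ} (T : Transceiver NT NR NS)

/-- `K = min (K_T, K_R)`. -/
def K : ℕ := min T.KT T.KR

/-- The sampled derivative `p^(r)[n]`. -/
def pS (M r : ℕ) : ℤ → ℝ := pulseSample T.Ts T.κ M T.p r

/-- The sampled derivative `q^(r)[n]`. -/
def qS (M r : ℕ) : ℤ → ℝ := pulseSample T.Ts T.κ M T.q r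

/-- The samples `𝒵_n^{(l₁,l₂)}` when the transmitter uses its stage `l₁` and the receiver its
stage `l₂`. -/
def receivedStage {M N : ℕ} (l₁ l₂ : ℕ)
    (S : Fin NS → Matrix (Fin (2 * M)) (Fin N × Fin 2) ℂ) (n : Fin NS)
    (k : Fin (2 * M)) (j : ℤ) : ℂ :=
  ∑ nS : Fin NS, ∑ nR : Fin NR, ∑ nT : Fin NT,
    star (matDeriv l₂ T.B (freq M k) nR n) *
      receivedSISO T.κ (T.pS M l₁) (T.qS M l₂) (fun ω => T.H ω nR nT)
        (Lam M (fun ω => matDeriv l₁ T.A ω nT nS) * S nS) k j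

/-- The total received samples `𝒵_n` of the multi-stage architecture (without noise). -/
def received {M N : ℕ} (S : Fin NS → Matrix (Fin (2 * M)) (Fin N × Fin 2) ℂ) (n : Fin NS)
    (k : Fin (2 * M)) (j : ℤ) : ℂ :=
  ∑ l₁ ∈ Finset.range T.KT, ∑ l₂ ∈ Finset.range T.KR,
    (-I) ^ (l₁ + l₂) / ((l₁.factorial : ℂ) * (l₂.factorial : ℂ) * (2 * (M : ℂ)) ^ (l₁ + l₂)) *
      T.receivedStage l₁ l₂ S n k j

/-- The `i`-th odd column of `𝒵_n`: in each pair of columns, the even one comes first. -/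
def receivedOdd {M N : ℕ} (S : Fin NS → Matrix (Fin (2 * M)) (Fin N × Fin 2) ℂ) (n : Fin NS)
    (k : Fin (2 * M)) (i : ℤ) : ℂ := T.received S n k (2 * i)

/-- The `i`-th even column of `𝒵_n`. -/
def receivedEven {M N : ℕ} (S : Fin NS → Matrix (Fin (2 * M)) (Fin N × Fin 2) ℂ) (n : Fin NS)
    (k : Fin (2 * M)) (i : ℤ) : ℂ := T.received S n k (2 * i - 1)

/-- The estimate of the symbol on stream `n` and subcarrier `k` of the multicarrier symbol number
`ℓ' = ℓ + 1`, by destaggering: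
`Re {𝒵_n^odd}_{k, ℓ' + κ - 1} + j Im {𝒵_n^even}_{k, ℓ' + κ}`. -/
def estimate {M N : ℕ} (s : Fin NS → Matrix (Fin (2 * M)) (Fin N) ℂ) (n : Fin NS)
    (k : Fin (2 * M)) (ℓ : Fin N) : ℂ :=
  ((T.receivedOdd (fun m => stagger (s m)) n k ((((ℓ : ℕ) : ℤ) + 1) + T.κ - 1)).re : ℂ) +
    I * ((T.receivedEven (fun m => stagger (s m)) n k ((((ℓ : ℕ) : ℤ) + 1) + T.κ)).im : ℂ)

/-! ### Assumptions -/

/-- Regularity of the pulses, with smoothness parameter `R`. -/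
structure PulseAssumption (R : ℕ) : Prop where
  Ts_pos : 0 < T.Ts
  κ_pos : 1 ≤ T.κ
  stages_le : T.KT + T.KR ≤ R
  p_smooth : ContDiffOn ℝ ((R + 1 : ℕ) : WithTop ℕ∞) T.p (pulseSupport T.Ts T.κ)
  q_smooth : ContDiffOn ℝ ((R + 1 : ℕ) : WithTop ℕ∞) T.q (pulseSupport T.Ts T.κ)
  p_end : ∀ r ≤ R + 1,
    iteratedDerivWithin r T.p (pulseSupport T.Ts T.κ) (-(T.Ts * T.κ / 2)) = 0 ∧
    iteratedDerivWithin r T.p (pulseSupport T.Ts T.κ) (T.Ts * T.κ / 2) = 0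
  q_end : ∀ r ≤ R + 1,
    iteratedDerivWithin r T.q (pulseSupport T.Ts T.κ) (-(T.Ts * T.κ / 2)) = 0 ∧
    iteratedDerivWithin r T.q (pulseSupport T.Ts T.κ) (T.Ts * T.κ / 2) = 0

/-- Entrywise membership in `𝒞^r(ℝ / 2πℤ)`. -/
def SmoothPeriodic {a b : ℕ} (r : ℕ) (X : ℝ → Matrix (Fin a) (Fin b) ℂ) : Prop :=
  ∀ i j, ContDiff ℝ ((r : ℕ) : WithTop ℕ∞) (fun ω => X ω i j) ∧
    Function.Periodic (fun ω => X ω i j) (2 * Real.pi)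

/-- Regularity of precoder, receiver and channel, and `Bᴴ H A = I`. -/
structure ChannelAssumption (R R' : ℕ) : Prop where
  lt : (2 * R + 1) * (R + 1) < R'
  A_smooth : SmoothPeriodic (R' + 1) T.A
  B_smooth : SmoothPeriodic (R' + 1) T.B
  H_smooth : SmoothPeriodic (R' + 1) T.H
  inverse : ∀ ω, (T.B ω)ᴴ * T.H ω * T.A ω = 1

end Transceiver

/-- The real (`i.2.2.2 = 0`) and imaginary (`i.2.2.2 = 1`) parts of all the symbols. -/
def symbolPart {NS M N : ℕ} {Ω : Type*} (s : Ω → Fin NS → Matrix (Fin (2 * M)) (Fin N) ℂ)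
    (i : Fin NS × Fin (2 * M) × Fin N × Fin 2) (x : Ω) : ℝ :=
  if i.2.2.2 = 0 then (s x i.1 i.2.1 i.2.2.1).re else (s x i.1 i.2.1 i.2.2.1).im

/-- For every `M`, the symbols lie in one bounded constellation, not depending on `M`. -/
def BoundedConstellation {NS N : ℕ} {Ω : Type*} [MeasurableSpace Ω] (μ : Measure Ω)
    (s : (M : ℕ) → Ω → Fin NS → Matrix (Fin (2 * M)) (Fin N) ℂ) : Prop :=
  ∃ C : Set ℂ, Bornology.IsBounded C ∧ ∀ M n k ℓ, ∀ᵐ x ∂μ, s M x n k ℓ ∈ C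

/-- For every `M`, the real and imaginary parts of all symbols (over streams, subcarriers and time)
are i.i.d. with zero mean and power `Ps / 2`. -/
structure IIDSymbols {NS N : ℕ} {Ω : Type*} [MeasurableSpace Ω] (μ : Measure Ω) (Ps : ℝ)
    (s : (M : ℕ) → Ω → Fin NS → Matrix (Fin (2 * M)) (Fin N) ℂ) : Prop where
  indep : ∀ M, iIndepFun (symbolPart (s M)) μ
  ident : ∀ M i i', IdentDistrib (symbolPart (s M) i) (symbolPart (s M) i') μ μ
  mean : ∀ M i, ∫ x, symbolPart (s M) i x ∂μ = 0
  power : ∀ M i, ∫ x, symbolPart (s M) i x ^ 2 ∂μ = Ps / 2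

/-! ### Pulse-specific quantities -/

/-- The `2M × κ` matrix whose `i`-th row is the `i`-th polyphase component of the pulse. -/
def polyphase (M κ : ℕ) (g : ℤ → ℝ) : Matrix (Fin (2 * M)) (Fin κ) ℝ :=
  Matrix.of fun i u => g (2 * (M : ℤ) * ((u : ℕ) : ℤ) + ((i : ℕ) : ℤ) + 1)

/-- Row-wise convolution. -/
def rowConv {a κ : ℕ} (X Y : Matrix (Fin a) (Fin κ) ℝ) : Matrix (Fin a) (Fin (2 * κ - 1)) ℝ :=
  Matrix.of fun i c => ∑ u : Fin κ, ∑ v : Fin κ,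
    if (u : ℕ) + (v : ℕ) = (c : ℕ) then X i u * Y i v else 0

/-- The anti-identity matrix `J_a`. -/
def antiId (a : ℕ) : Matrix (Fin a) (Fin a) ℝ :=
  Matrix.of fun i j => if (i : ℕ) + (j : ℕ) + 1 = a then 1 else 0

/-- The Kronecker product of a `2 × 2` and an `M × M` matrix as a `2M × 2M` matrix. -/
def kron (M : ℕ) (X : Matrix (Fin 2) (Fin 2) ℝ) (Y : Matrix (Fin M) (Fin M) ℝ) :
    Matrix (Fin (2 * M)) (Fin (2 * M)) ℝ :=
  Matrix.reindex finProdFinEquiv finProdFinEquiv (X ⊗ₖ Y)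

/-- `U⁺ = I₂ ⊗ (I_M + J_M)`. -/
def Uplus (M : ℕ) : Matrix (Fin (2 * M)) (Fin (2 * M)) ℝ := kron M 1 (1 + antiId M)

/-- `U⁻ = I₂ ⊗ (I_M - J_M)`. -/
def Uminus (M : ℕ) : Matrix (Fin (2 * M)) (Fin (2 * M)) ℝ := kron M 1 (1 - antiId M)

/-- `ℛ(p, q) = P ⊛ J_{2M} Q`. -/
def Rmat (M κ : ℕ) (p q : ℤ → ℝ) : Matrix (Fin (2 * M)) (Fin (2 * κ - 1)) ℝ :=
  rowConv (polyphase M κ p) (antiId (2 * M) * polyphase M κ q)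

/-- `𝒮(p, q) = (J₂ ⊗ I_M) P ⊛ J_{2M} Q`. -/
def Smat (M κ : ℕ) (p q : ℤ → ℝ) : Matrix (Fin (2 * M)) (Fin (2 * κ - 1)) ℝ :=
  rowConv (kron M (antiId 2) 1 * polyphase M κ p) (antiId (2 * M) * polyphase M κ q)

/-- The matrix `ℐ` with ones in its central column and zeros elsewhere. -/
def centralOnes (M κ : ℕ) : Matrix (Fin (2 * M)) (Fin (2 * κ - 1)) ℝ :=
  Matrix.of fun _ c => if (c : ℕ) + 1 = κ then 1 else 0

namespace Transceiver

variable {NT NR NS : ℕ} (T : Transceiver NT NR NS)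

/-- `ℛ(p^(m), q^(n))`. -/
def RR (M m n : ℕ) : Matrix (Fin (2 * M)) (Fin (2 * T.κ - 1)) ℝ :=
  Rmat M T.κ (T.pS M m) (T.qS M n)

/-- `𝒮(p^(m), q^(n))`. -/
def SS (M m n : ℕ) : Matrix (Fin (2 * M)) (Fin (2 * T.κ - 1)) ℝ :=
  Smat M T.κ (T.pS M m) (T.qS M n)

/-- `ℛ(p, q) - ℐ / 2`. -/
def RR0 (M : ℕ) : Matrix (Fin (2 * M)) (Fin (2 * T.κ - 1)) ℝ :=
  T.RR M 0 0 - (1 / 2 : ℝ) • centralOnes M T.κ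

/-- `(Ps / 2M) tr [ℛ(p^(m), q^(n)) ℛ(p^(m'), q^(n'))ᵀ U + 𝒮(p^(m), q^(n)) 𝒮(p^(m'), q^(n'))ᵀ V]`. -/
def eta (Ps : ℝ) (M : ℕ) (U V : Matrix (Fin (2 * M)) (Fin (2 * M)) ℝ) (m n m' n' : ℕ) : ℝ :=
  Ps / (2 * (M : ℝ)) *
    Matrix.trace (T.RR M m n * (T.RR M m' n')ᵀ * U + T.SS M m n * (T.SS M m' n')ᵀ * V)

/-- `η^{(+,-)}`. -/
def etaPM (Ps : ℝ) (M m n m' n' : ℕ) : ℝ := T.eta Ps M (Uplus M) (Uminus M) m n m' n'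

/-- `η^{(-,+)}`. -/
def etaMP (Ps : ℝ) (M m n m' n' : ℕ) : ℝ := T.eta Ps M (Uminus M) (Uplus M) m n m' n'

/-- The pattern of the matrices `Ψ_K`, built from a function `η`. -/
def psi (η : ℕ → ℕ → ℕ → ℕ → ℝ) : Matrix (Fin 2) (Fin 2) ℝ :=
  !![if T.KT = T.K then η T.K 0 T.K 0 else 0, if T.KR = T.KT then η T.K 0 0 T.K else 0;
     if T.KR = T.KT then η T.K 0 0 T.K else 0, if T.KR = T.K then η 0 T.K 0 T.K else 0]

/-- `Ψ_K^{(+,-)}`. -/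
def psiPM (Ps : ℝ) (M : ℕ) : Matrix (Fin 2) (Fin 2) ℝ := T.psi (T.etaPM Ps M)

/-- `Ψ_K^{(-,+)}`. -/
def psiMP (Ps : ℝ) (M : ℕ) : Matrix (Fin 2) (Fin 2) ℝ := T.psi (T.etaMP Ps M)

/-- `δ`. -/
def delta (Ps : ℝ) (M : ℕ) : ℝ :=
  Ps / (2 * (M : ℝ)) *
    Matrix.trace (T.RR0 M * (T.RR0 M)ᵀ * Uplus M + T.SS M 0 0 * (T.SS M 0 0)ᵀ * Uminus M)

/-- `μ_{(m,n)}`. -/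
def mu (Ps : ℝ) (M m n : ℕ) : ℝ :=
  Ps / (2 * (M : ℝ)) *
    Matrix.trace (T.RR0 M * (T.RR M m n)ᵀ * Uplus M + T.SS M 0 0 * (T.SS M m n)ᵀ * Uminus M)

/-- `μ̃_{(ℓ,m)}^{(K')}`, for `1 ≤ K'` and `ℓ ≤ m`. -/
def muTilde (Ps : ℝ) (M K' ℓ m : ℕ) : ℝ :=
  ∑ j ∈ Finset.Icc K' ℓ,
    (-1 : ℝ) ^ (j + K') * (ℓ.choose j : ℝ) * ((j - 1).choose (K' - 1) : ℝ) * T.mu Ps M j (m - j)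

/-! ### Channel-specific quantities -/

/-- `α_{n,nS}^{(m,ℓ)}(ω)`, for `ℓ ≤ m`. -/
def alpha (m ℓ : ℕ) (n nS : Fin NS) (ω : ℝ) : ℂ :=
  (Real.sqrt 2 : ℂ) * (-I) ^ m / (m.factorial : ℂ) * (m.choose ℓ : ℂ) *
    (matDeriv (m - ℓ) (fun w => (T.B w)ᴴ * T.H w) ω * matDeriv ℓ T.A ω) n nS

/-- `β_{n,nS}^{(m,ℓ)}(ω)`, for `ℓ ≤ m`. -/
def beta (m ℓ : ℕ) (n nS : Fin NS) (ω : ℝ) : ℂ :=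
  (Real.sqrt 2 : ℂ) * (-I) ^ m / (m.factorial : ℂ) * (m.choose ℓ : ℂ) *
    ((matDeriv ℓ T.B ω)ᴴ * matDeriv (m - ℓ) (fun w => T.H w * T.A w) ω) n nS

/-- `γ_{n,nS}(ω)`. -/
def gamma (n nS : Fin NS) (ω : ℝ) : ℂ :=
  (Real.sqrt 2 : ℂ) * (-I) ^ (T.KR + T.KT) / ((T.KT.factorial : ℂ) * (T.KR.factorial : ℂ)) *
    ((matDeriv T.KR T.B ω)ᴴ * T.H ω * matDeriv T.KT T.A ω) n nS

/-- `ξ_{n,nS}^{(m,ℓ)}(ω) = [α, β]ᵀ`. -/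
def xi (m ℓ : ℕ) (n nS : Fin NS) (ω : ℝ) : Fin 2 → ℂ :=
  ![T.alpha m ℓ n nS ω, T.beta m ℓ n nS ω]

/-! ### The asymptotic distortion power -/

/-- `P_{e,1}(k,n)`. -/
def Pe1 (Ps : ℝ) (M : ℕ) (k : Fin (2 * M)) (n : Fin NS) : ℝ :=
  2 * T.delta Ps M
    - ∑ m ∈ Finset.Icc T.KR (2 * T.K), 2 * Real.sqrt 2 / (2 * (M : ℝ)) ^ m *
        ∑ ℓ ∈ Finset.Icc T.KR m, T.mu Ps M 0 m * (T.beta m ℓ n n (freq M k)).re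
    - ∑ m ∈ Finset.Icc T.KT (2 * T.K), 2 * Real.sqrt 2 / (2 * (M : ℝ)) ^ m *
        ∑ ℓ ∈ Finset.Icc T.KT m,
          T.muTilde Ps M T.KT ℓ m * (T.alpha m ℓ n n (freq M k)).re
    + 2 * Real.sqrt 2 / (2 * (M : ℝ)) ^ (2 * T.K) * (T.gamma n n (freq M k)).re *
        T.mu Ps M T.K T.K * (if T.KR = T.KT then 1 else 0)

/-- `P_{e,2}(k,n)`. -/
def Pe2 (Ps : ℝ) (M : ℕ) (k : Fin (2 * M)) (n : Fin NS) : ℝ :=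
  1 / (2 * (M : ℝ)) ^ (2 * T.K) *
      ∑ nS : Fin NS, (fun i => (T.xi T.K T.K n nS (freq M k) i).re) ⬝ᵥ
        (T.psiPM Ps M *ᵥ fun i => (T.xi T.K T.K n nS (freq M k) i).re)
    + 1 / (2 * (M : ℝ)) ^ (2 * T.K) *
      ∑ nS : Fin NS, (fun i => (T.xi T.K T.K n nS (freq M k) i).im) ⬝ᵥ
        (T.psiMP Ps M *ᵥ fun i => (T.xi T.K T.K n nS (freq M k) i).im)

/-- `P_e(k,n) = P_{e,1}(k,n) + P_{e,2}(k,n)`. -/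
def Pe (Ps : ℝ) (M : ℕ) (k : Fin (2 * M)) (n : Fin NS) : ℝ := T.Pe1 Ps M k n + T.Pe2 Ps M k n

end Transceiver

end FBMC

end

noncomputable section

namespace FBMC

open Complex Matrix MeasureTheory ProbabilityTheory
open scoped Kronecker

/-! The error on a symbol is a real linear form in the i.i.d. real and imaginary symbol parts, so
its power is `Ps / 2` times the sum of the squared coefficients (`integral_norm_estimate_sub_sq`).
Everything reduces to expanding these coefficients in powers of `ε = 1/(2M)`.

Write `Bᴴ`, `H`, `A` as Fourier series with taps at delays `v`, `i`, `u`. Differentiating a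
frequency response multiplies its taps by the delay, so for fixed delays the parallel stages are
truncated Taylor polynomials of the pulses shifted by `-uε` (transmitter) and `-vε` (receiver). A
translation in time refers all phases to the receiving subcarrier and leaves the shifts `uε` and
`-(i+u)ε` in the arguments (`sum_stageSum_shift`). Taylor's formula in `ε`, summed against the taps,
gives the coefficient of each pair `(p^(a), q^(b))` as a combination of derivatives of `B`, `H`, `A`
at the receiving frequency. The remainder is uniform because smooth responses have rapidly decaying
taps (`exists_bound_transferCoeff_sub`).

If no receive stage were missing, this coefficient would be proportional to the `b`-th derivative of
`Bᴴ H A^(a)`. For `a = 0` and `b ≥ 1` that is zero, since `Bᴴ H A = 1`, and the missing receive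
stages leave the `β` terms. For `a ≥ 1` the transmit stages cancel all orders `a < KT` and leave the
`α` terms. The stages missing on both sides enter the linear terms up to order `2K` only at `a = b =
K`, when `KT = KR`, which is the `γ` term (`expCoeff_zero`, `expCoeff_pos`, `expTail_K_K`).

For each pulse pair the coefficients over the subcarriers are chirp sums of the pulse product folded
modulo `2M`. Orthogonality of the chirps turns sums of products of real or imaginary parts into
bilinear forms of `U⁺` or `U⁻`, mixed products cancel, and the sum over the columns yields the
traces (`sum_foldCoeff`). The power of the truncated expansion is therefore `δ`, plus linear terms
in `μ`, plus quadratic terms in `η`. The linear terms up to order `2K` give `Pe1`; the quadratic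
terms start at order `2K`, and their leading part is `Pe2` (`exists_bound_mainPower_sub`).

The truncation costs `O(ε^(2K+1))` per coefficient over `O(M)` coefficients, hence `O(M^(-2K-1/2))`
in the `ℓ²` norm. The main part is only bounded, but by Cauchy–Schwarz this already changes the
power by `o(M^(-2K))` (`exists_bound_sum_errorCoeff_sq`). -/

/-! ### Pulses extended by zero -/

/-- The `r`-th derivative of `y ↦ g (Ts * y)`, extended by zero outside the support of the pulse. -/
def pulseDeriv (Ts : ℝ) (κ : ℕ) (g : ℝ → ℝ) (r : ℕ) (y : ℝ) : ℝ :=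
  Ts ^ r * (pulseSupport Ts κ).indicator (iteratedDerivWithin r g (pulseSupport Ts κ)) (Ts * y)

/-- The normalized sampling instant of the sample number `n`. -/
def samplePoint (κ M : ℕ) (n : ℤ) : ℝ := ((n : ℝ) - (2 * (M : ℝ) * κ + 1) / 2) * (2 * (M : ℝ))⁻¹

lemma samplePoint_add (κ M : ℕ) (n i : ℤ) :
    samplePoint κ M (n + i) = samplePoint κ M n + i * (2 * (M : ℝ))⁻¹ := by
  simp only [samplePoint]; push_cast; ring

/-- The half-sample offset keeps the sampling instants off the end points of the support, so an
instant lies in the support exactly for the sample numbers `1, …, 2Mκ`. -/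
lemma pulseSample_eq_pulseDeriv {Ts : ℝ} (hTs : 0 < Ts) (κ : ℕ) {M : ℕ} (hM : 1 ≤ M) (g : ℝ → ℝ)
    (r : ℕ) (n : ℤ) :
    pulseSample Ts κ M g r n = pulseDeriv Ts κ g r (samplePoint κ M n) := by
  have hM' : (0 : ℝ) < 2 * M := by positivity
  have harg : ((n : ℝ) - (2 * (M : ℝ) * κ + 1) / 2) * (Ts / (2 * (M : ℝ))) =
      Ts * samplePoint κ M n := by
    simp only [samplePoint]; ring
  have hmem : Ts * samplePoint κ M n ∈ pulseSupport Ts κ ↔ 1 ≤ n ∧ n ≤ 2 * (M : ℤ) * κ := by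
    have h2 : Ts * samplePoint κ M n = Ts / (2 * M) * ((n : ℝ) - (2 * (M : ℝ) * κ + 1) / 2) := by
      rw [← harg]; ring
    have h3 : Ts * κ / 2 = Ts / (2 * M) * (M * κ) := by field_simp
    have h4 : 0 < Ts / (2 * M) := by positivity
    rw [pulseSupport, Set.mem_Icc, h2, h3, ← mul_neg, mul_le_mul_iff_right₀ h4,
      mul_le_mul_iff_right₀ h4]
    constructor
    -- After division by `Ts / (2M)` the support condition reads `1/2 ≤ n ≤ 2Mκ + 1/2`; integrality
    -- of `n` does the rest.
    · rintro ⟨h5, h6⟩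
      constructor
      · by_contra h
        have : (n : ℝ) ≤ 0 := by exact_mod_cast (by omega : n ≤ 0)
        linarith
      · by_contra h
        have : (2 * (M : ℝ) * κ + 1) ≤ n := by exact_mod_cast (by omega : 2 * (M : ℤ) * κ + 1 ≤ n)
        linarith
    · rintro ⟨h5, h6⟩
      have h5' : (1 : ℝ) ≤ n := by exact_mod_cast h5
      have h6' : (n : ℝ) ≤ 2 * M * κ := by exact_mod_cast h6
      constructor <;> linarith
  rw [pulseSample, pulseDeriv, harg]
  by_cases h : 1 ≤ n ∧ n ≤ 2 * (M : ℤ) * κ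
  · rw [if_pos h, Set.indicator_of_mem (hmem.2 h)]
  · rw [if_neg h, Set.indicator_of_notMem (fun h' => h (hmem.1 h')), mul_zero]

/-- At an end point the one-sided derivative of the zero function and that of `f` are both `0`, so
they glue to a two-sided derivative. -/
lemma hasDerivAt_indicator_Icc {a b : ℝ} (hab : a < b) {f : ℝ → ℝ} {y : ℝ}
    (hf : DifferentiableOn ℝ f (Set.Icc a b)) (ha : f a = 0) (hb : f b = 0)
    (ha' : derivWithin f (Set.Icc a b) a = 0) (hb' : derivWithin f (Set.Icc a b) b = 0) :
    HasDerivAt ((Set.Icc a b).indicator f)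
      ((Set.Icc a b).indicator (derivWithin f (Set.Icc a b)) y) y := by
  have hIic : ∀ y ≤ a, HasDerivWithinAt ((Set.Icc a b).indicator f) 0 (Set.Iic a) y := by
    intro y hy
    refine (hasDerivWithinAt_const y (Set.Iic a) (0 : ℝ)).congr ?_ ?_
    · intro z hz
      rcases eq_or_lt_of_le (show z ≤ a from hz) with rfl | h
      · rw [Set.indicator_of_mem (Set.left_mem_Icc.2 hab.le), ha]
      · exact Set.indicator_of_notMem (fun h' => absurd h'.1 (not_le.2 h)) _
    · rcases eq_or_lt_of_le hy with rfl | h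
      · rw [Set.indicator_of_mem (Set.left_mem_Icc.2 hab.le), ha]
      · exact Set.indicator_of_notMem (fun h' => absurd h'.1 (not_le.2 h)) _
  have hIci : ∀ y, b ≤ y → HasDerivWithinAt ((Set.Icc a b).indicator f) 0 (Set.Ici b) y := by
    intro y hy
    refine (hasDerivWithinAt_const y (Set.Ici b) (0 : ℝ)).congr ?_ ?_
    · intro z hz
      rcases eq_or_lt_of_le (show b ≤ z from hz) with rfl | h
      · rw [Set.indicator_of_mem (Set.right_mem_Icc.2 hab.le), hb]
      · exact Set.indicator_of_notMem (fun h' => absurd h'.2 (not_le.2 h)) _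
    · rcases eq_or_lt_of_le hy with rfl | h
      · rw [Set.indicator_of_mem (Set.right_mem_Icc.2 hab.le), hb]
      · exact Set.indicator_of_notMem (fun h' => absurd h'.2 (not_le.2 h)) _
  have hmid : ∀ y ∈ Set.Icc a b, HasDerivWithinAt ((Set.Icc a b).indicator f)
      (derivWithin f (Set.Icc a b) y) (Set.Icc a b) y := by
    intro y hy
    exact (hf y hy).hasDerivWithinAt.congr (fun z hz => Set.indicator_of_mem hz _)
      (Set.indicator_of_mem hy _)
  rcases lt_trichotomy y a with h | rfl | h
  · rw [Set.indicator_of_notMem (fun h' => absurd h'.1 (not_le.2 h))]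
    exact (hIic y h.le).hasDerivAt (Iic_mem_nhds h)
  · rw [Set.indicator_of_mem (Set.left_mem_Icc.2 hab.le), ha']
    have h1 := hmid y (Set.left_mem_Icc.2 hab.le)
    rw [ha'] at h1
    refine ((hIic y le_rfl).union h1).hasDerivAt ?_
    rw [Set.Iic_union_Icc_eq_Iic hab.le]
    exact Iic_mem_nhds hab
  · rcases lt_trichotomy y b with h' | rfl | h'
    · have hy : y ∈ Set.Icc a b := ⟨h.le, h'.le⟩
      rw [Set.indicator_of_mem hy]
      exact (hmid y hy).hasDerivAt (Icc_mem_nhds h h')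
    · rw [Set.indicator_of_mem (Set.right_mem_Icc.2 hab.le), hb']
      have h1 := hmid y (Set.right_mem_Icc.2 hab.le)
      rw [hb'] at h1
      refine (h1.union (hIci y le_rfl)).hasDerivAt ?_
      rw [Set.Icc_union_Ici_eq_Ici hab.le]
      exact Ici_mem_nhds hab
    · rw [Set.indicator_of_notMem (fun h'' => absurd h''.2 (not_le.2 h'))]
      exact (hIci y h'.le).hasDerivAt (Ici_mem_nhds h')

lemma pulseSupport_nondegenerate {Ts : ℝ} (hTs : 0 < Ts) {κ : ℕ} (hκ : 1 ≤ κ) :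
    -(Ts * κ / 2) < Ts * κ / 2 := by
  have : (0 : ℝ) < κ := by exact_mod_cast hκ
  have : 0 < Ts * κ / 2 := by positivity
  linarith

/-- The vanishing end-point derivatives make the zero extensions a chain of derivatives on the whole
line. Taylor's formula may then be used across the edges of the pulse; the factors `Ts ^ r` absorb
the chain rule. -/
lemma hasDerivAt_pulseDeriv {Ts : ℝ} (hTs : 0 < Ts) {κ : ℕ} (hκ : 1 ≤ κ) {g : ℝ → ℝ} {L : ℕ}
    (hg : ContDiffOn ℝ (L : WithTop ℕ∞) g (pulseSupport Ts κ))
    (hend : ∀ r ≤ L, iteratedDerivWithin r g (pulseSupport Ts κ) (-(Ts * κ / 2)) = 0 ∧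
      iteratedDerivWithin r g (pulseSupport Ts κ) (Ts * κ / 2) = 0)
    {r : ℕ} (hr : r < L) (y : ℝ) :
    HasDerivAt (pulseDeriv Ts κ g r) (pulseDeriv Ts κ g (r + 1) y) y := by
  have hlt := pulseSupport_nondegenerate hTs hκ
  have hu : UniqueDiffOn ℝ (pulseSupport Ts κ) := uniqueDiffOn_Icc hlt
  have h1 := hend (r + 1) hr
  rw [iteratedDerivWithin_succ] at h1
  have key := hasDerivAt_indicator_Icc hlt (f := iteratedDerivWithin r g (pulseSupport Ts κ))
    (y := Ts * y) (hg.differentiableOn_iteratedDerivWithin (by exact_mod_cast hr) hu)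
    (hend r hr.le).1 (hend r hr.le).2 h1.1 h1.2
  have h2 : HasDerivAt (fun y : ℝ => Ts * y) Ts y := by
    simpa using (hasDerivAt_id y).const_mul Ts
  have h3 := (key.comp y h2).const_mul (Ts ^ r)
  have h4 : Ts ^ r * ((Set.Icc (-(Ts * κ / 2)) (Ts * κ / 2)).indicator (derivWithin
      (iteratedDerivWithin r g (pulseSupport Ts κ)) (Set.Icc (-(Ts * κ / 2)) (Ts * κ / 2)))
      (Ts * y) * Ts) = pulseDeriv Ts κ g (r + 1) y := by
    rw [pulseDeriv, iteratedDerivWithin_succ, pow_succ]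
    simp only [pulseSupport]
    ring
  rw [h4] at h3
  exact h3

lemma exists_bound_pulseDeriv {Ts : ℝ} (hTs : 0 < Ts) {κ : ℕ} (hκ : 1 ≤ κ) {g : ℝ → ℝ} {L : ℕ}
    (hg : ContDiffOn ℝ (L : WithTop ℕ∞) g (pulseSupport Ts κ)) :
    ∃ C : ℝ, 0 ≤ C ∧ ∀ r ≤ L, ∀ y, |pulseDeriv Ts κ g r y| ≤ C := by
  have hlt := pulseSupport_nondegenerate hTs hκ
  have hu : UniqueDiffOn ℝ (pulseSupport Ts κ) := uniqueDiffOn_Icc hlt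
  have hc : IsCompact (pulseSupport Ts κ) := isCompact_Icc
  have h1 : ∀ r : ℕ, ∃ C : ℝ, 0 ≤ C ∧ (r ≤ L → ∀ y, |pulseDeriv Ts κ g r y| ≤ C) := by
    intro r
    by_cases hr : r ≤ L
    · obtain ⟨C, hC⟩ := hc.exists_bound_of_continuousOn
        (hg.continuousOn_iteratedDerivWithin (m := r) (by exact_mod_cast hr) hu)
      have hC0 : 0 ≤ C := (norm_nonneg _).trans (hC _ (Set.left_mem_Icc.2 hlt.le))
      refine ⟨Ts ^ r * C, by positivity, fun _ y => ?_⟩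
      rw [pulseDeriv, abs_mul, abs_of_nonneg (by positivity : 0 ≤ Ts ^ r)]
      gcongr
      by_cases hy : Ts * y ∈ pulseSupport Ts κ
      · rw [Set.indicator_of_mem hy]; exact hC _ hy
      · rw [Set.indicator_of_notMem hy]; simpa using hC0
    · exact ⟨0, le_rfl, fun h => absurd h hr⟩
  choose C hC0 hC using h1
  refine ⟨∑ r ∈ Finset.range (L + 1), C r, Finset.sum_nonneg fun r _ => hC0 r, fun r hr y => ?_⟩
  exact (hC r hr y).trans (Finset.single_le_sum (f := C) (fun i _ => hC0 i)
    (Finset.mem_range.2 (by omega)))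

/-! ### Taylor expansion of the stages -/

/-- Taylor's inequality for a chain `P 0, P 1, …` of successive derivatives. -/
lemma abs_sub_taylor_le {P : ℕ → ℝ → ℝ} {L : ℕ} {C : ℝ}
    (hP : ∀ r < L, ∀ y, HasDerivAt (P r) (P (r + 1) y) y) (hC : ∀ r ≤ L, ∀ y, |P r y| ≤ C)
    (s r : ℕ) (hrs : r + s ≤ L) (y x : ℝ) :
    |P r (y + x) - ∑ i ∈ Finset.range s, x ^ i / (i.factorial : ℝ) * P (r + i) y| ≤
      C * |x| ^ s := by
  induction s generalizing r x with
  | zero => simpa using hC r (by omega) (y + x)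
  | succ s ih =>
    have hC0 : 0 ≤ C := (abs_nonneg _).trans (hC 0 (by omega) 0)
    -- The Taylor remainder of `P r` of order `s + 1` vanishes at `0` and has as derivative the
    -- remainder of `P (r + 1)` of order `s`. The mean value inequality on the segment from `0` to
    -- `x` closes the induction; the factorial is given away.
    set f : ℝ → ℝ := fun t => P r (y + t) -
      ∑ i ∈ Finset.range (s + 1), t ^ i / (i.factorial : ℝ) * P (r + i) y with hf
    set f' : ℝ → ℝ := fun t => P (r + 1) (y + t) -
      ∑ i ∈ Finset.range s, t ^ i / (i.factorial : ℝ) * P (r + 1 + i) y with hf'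
    have hder : ∀ t, HasDerivAt f (f' t) t := by
      intro t
      have h1 : HasDerivAt (fun t => P r (y + t)) (P (r + 1) (y + t)) t := by
        simpa using (hP r (by omega) (y + t)).comp_const_add y t
      have h2 : HasDerivAt (fun t => ∑ i ∈ Finset.range (s + 1),
          t ^ i / (i.factorial : ℝ) * P (r + i) y)
          (∑ i ∈ Finset.range s, t ^ i / (i.factorial : ℝ) * P (r + 1 + i) y) t := by
        have h3 : HasDerivAt (fun t => ∑ i ∈ Finset.range (s + 1),
            t ^ i / (i.factorial : ℝ) * P (r + i) y)
            (∑ i ∈ Finset.range (s + 1),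
              ((i : ℝ) * t ^ (i - 1)) / (i.factorial : ℝ) * P (r + i) y) t := by
          refine HasDerivAt.fun_sum fun i _ => ?_
          exact ((hasDerivAt_pow i t).div_const _).mul_const _
        convert h3 using 1
        rw [Finset.sum_range_succ']
        simp only [CharP.cast_eq_zero, zero_mul, zero_div, add_zero]
        refine Finset.sum_congr rfl fun i _ => ?_
        rw [Nat.factorial_succ, show r + 1 + i = r + (i + 1) by ring]
        have : (i.factorial : ℝ) ≠ 0 := by positivity
        push_cast
        field_simp
      exact h1.sub h2
    have hb : ∀ t ∈ Set.uIcc 0 x, ‖f' t‖ ≤ C * |x| ^ s := by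
      intro t ht
      have htx : |t| ≤ |x| := by
        have := Set.abs_sub_left_of_mem_uIcc ht
        simpa using this
      refine (ih (r + 1) (by omega) t).trans ?_
      gcongr
    have h := Convex.norm_image_sub_le_of_norm_hasDerivWithin_le
      (f := f) (f' := f') (s := Set.uIcc 0 x) (x := 0) (y := x)
      (fun t _ => (hder t).hasDerivWithinAt) hb (convex_uIcc 0 x) Set.left_mem_uIcc
      Set.right_mem_uIcc
    have h0 : f 0 = 0 := by
      simp only [hf, Finset.sum_range_succ']
      simp
    rw [h0, sub_zero, sub_zero, mul_assoc, Real.norm_eq_abs, Real.norm_eq_abs, ← pow_succ] at h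
    exact h

/-- A `K`-stage combination `∑_{ℓ < K} w ^ ℓ / ℓ! P ℓ` of the derivatives of a pulse. -/
def stageSum (K : ℕ) (P : ℕ → ℝ → ℝ) (w y : ℝ) : ℝ :=
  ∑ ℓ ∈ Finset.range K, w ^ ℓ / (ℓ.factorial : ℝ) * P ℓ y

/-- The coefficient of `P b y` in the Taylor expansion of `stageSum K P w (y + x)`. -/
def stagePoly (K b : ℕ) (w x : ℝ) : ℝ :=
  (∑ ℓ ∈ Finset.range K, (b.choose ℓ : ℝ) * w ^ ℓ * x ^ (b - ℓ)) / (b.factorial : ℝ)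

/-- Terms are regrouped by total order `b = ℓ + i`, using `1 / (ℓ! i!) = C(b, ℓ) / b!`. Stage `ℓ`
already has order `ℓ`, so it is expanded only to order `D - ℓ`; for `ℓ ≥ D` the natural subtraction
leaves nothing. -/
lemma sum_stagePoly_mul (K D : ℕ) (P : ℕ → ℝ) (w x : ℝ) :
    ∑ b ∈ Finset.range D, stagePoly K b w x * P b =
      ∑ ℓ ∈ Finset.range K, w ^ ℓ / (ℓ.factorial : ℝ) *
        ∑ i ∈ Finset.range (D - ℓ), x ^ i / (i.factorial : ℝ) * P (ℓ + i) := by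
  simp only [stagePoly, Finset.sum_div, Finset.sum_mul]
  rw [Finset.sum_comm]
  refine Finset.sum_congr rfl fun ℓ _ => ?_
  have hz : ∀ b < ℓ, (b.choose ℓ : ℝ) * w ^ ℓ * x ^ (b - ℓ) / (b.factorial : ℝ) * P b = 0 := by
    intro b hb
    rw [Nat.choose_eq_zero_of_lt hb]; simp
  rcases le_or_gt ℓ D with h | h
  · conv_lhs => rw [show D = ℓ + (D - ℓ) by omega]
    rw [Finset.sum_range_add, Finset.sum_eq_zero fun b hb => hz b (Finset.mem_range.1 hb),
      zero_add, Finset.mul_sum]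
    refine Finset.sum_congr rfl fun i _ => ?_
    have h1 := Nat.add_choose_mul_factorial_mul_factorial ℓ i
    rw [← Nat.choose_symm_add] at h1
    have h2 : ((ℓ + i).choose ℓ : ℝ) * (ℓ.factorial : ℝ) * (i.factorial : ℝ) =
        ((ℓ + i).factorial : ℝ) := by exact_mod_cast h1
    rw [Nat.add_sub_cancel_left, ← h2]
    have h3 : ((ℓ + i).choose ℓ : ℝ) ≠ 0 := by
      have := Nat.choose_pos (Nat.le_add_right ℓ i)
      positivity
    field_simp
  · rw [show D - ℓ = 0 by omega, Finset.sum_eq_zero fun b hb => hz b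
      ((Finset.mem_range.1 hb).trans h)]
    simp

/-- Later `ε = 1/(2M)` and `τ` is a weight in the delays. The exponent of `ε` may be lowered and
that of `τ` raised; the decay of the taps pays for the latter. -/
lemma pow_mul_le_of_le_one {ε τ : ℝ} (hε : 0 ≤ ε) (hε1 : ε ≤ 1) (hτ : 1 ≤ τ) {D E ℓ : ℕ}
    (h1 : D ≤ ℓ) (h2 : ℓ ≤ E) : (ε * τ) ^ ℓ ≤ ε ^ D * τ ^ E := by
  rw [mul_pow]
  exact mul_le_mul (pow_le_pow_of_le_one hε hε1 h1) (pow_le_pow_right₀ hτ h2) (by positivity)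
    (by positivity)

/-- Stage `ℓ` carries `w ^ ℓ` and a Taylor remainder of order `D - ℓ`, hence in total at least `D`
factors of size `ε * τ`, and at most `K + D`. -/
lemma abs_stageSum_sub_le {P : ℕ → ℝ → ℝ} {L : ℕ} {C : ℝ}
    (hP : ∀ r < L, ∀ y, HasDerivAt (P r) (P (r + 1) y) y) (hC : ∀ r ≤ L, ∀ y, |P r y| ≤ C)
    {K D : ℕ} (hK : K ≤ L) (hD : D ≤ L) {ε τ w x : ℝ} (hε : 0 ≤ ε) (hε1 : ε ≤ 1) (hτ : 1 ≤ τ)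
    (hw : |w| ≤ ε * τ) (hx : |x| ≤ ε * τ) (y : ℝ) :
    |stageSum K P w (y + x) - ∑ b ∈ Finset.range D, stagePoly K b w x * P b y| ≤
      K * C * (ε ^ D * τ ^ (K + D)) := by
  have hC0 : 0 ≤ C := (abs_nonneg _).trans (hC 0 (by omega) 0)
  rw [sum_stagePoly_mul, stageSum, ← Finset.sum_sub_distrib]
  refine (Finset.abs_sum_le_sum_abs _ _).trans ?_
  have hterm : ∀ ℓ ∈ Finset.range K,
      |w ^ ℓ / (ℓ.factorial : ℝ) * P ℓ (y + x) - w ^ ℓ / (ℓ.factorial : ℝ) *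
        ∑ i ∈ Finset.range (D - ℓ), x ^ i / (i.factorial : ℝ) * P (ℓ + i) y| ≤
      C * (ε ^ D * τ ^ (K + D)) := by
    intro ℓ hℓ
    have hℓK := Finset.mem_range.1 hℓ
    rw [← mul_sub, abs_mul, abs_div, abs_pow, Nat.abs_cast]
    have h1 := abs_sub_taylor_le hP hC (D - ℓ) ℓ (by omega) y x
    have h2 : |w| ^ ℓ / (ℓ.factorial : ℝ) ≤ (ε * τ) ^ ℓ := by
      rw [div_le_iff₀ (by positivity)]
      calc |w| ^ ℓ ≤ (ε * τ) ^ ℓ := by gcongr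
        _ ≤ (ε * τ) ^ ℓ * (ℓ.factorial : ℝ) :=
          le_mul_of_one_le_right (by positivity) (by exact_mod_cast Nat.factorial_pos ℓ)
    calc |w| ^ ℓ / (ℓ.factorial : ℝ) * |P ℓ (y + x) -
          ∑ i ∈ Finset.range (D - ℓ), x ^ i / (i.factorial : ℝ) * P (ℓ + i) y|
        ≤ (ε * τ) ^ ℓ * (C * (ε * τ) ^ (D - ℓ)) := by
          refine mul_le_mul h2 (h1.trans ?_) (abs_nonneg _) (by positivity)
          gcongr
      _ = C * (ε * τ) ^ (ℓ + (D - ℓ)) := by rw [pow_add]; ring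
      _ ≤ C * (ε ^ D * τ ^ (K + D)) := by
          gcongr
          exact pow_mul_le_of_le_one hε hε1 hτ (by omega) (by omega)
  refine (Finset.sum_le_sum hterm).trans (le_of_eq ?_)
  rw [Finset.sum_const, Finset.card_range, nsmul_eq_mul]
  ring

lemma abs_stageSum_le {P : ℕ → ℝ → ℝ} {L : ℕ} {C : ℝ} (hC : ∀ r ≤ L, ∀ y, |P r y| ≤ C)
    {K : ℕ} (hK : K ≤ L) {ε τ w : ℝ} (hε : 0 ≤ ε) (hε1 : ε ≤ 1) (hτ : 1 ≤ τ)
    (hw : |w| ≤ ε * τ) (y : ℝ) : |stageSum K P w y| ≤ K * C * τ ^ K := by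
  have hC0 : 0 ≤ C := (abs_nonneg _).trans (hC 0 (by omega) 0)
  rw [stageSum]
  refine (Finset.abs_sum_le_sum_abs _ _).trans ?_
  have hterm : ∀ ℓ ∈ Finset.range K, |w ^ ℓ / (ℓ.factorial : ℝ) * P ℓ y| ≤ C * τ ^ K := by
    intro ℓ hℓ
    have hℓK := Finset.mem_range.1 hℓ
    rw [abs_mul, abs_div, abs_pow, Nat.abs_cast]
    have h2 : |w| ^ ℓ / (ℓ.factorial : ℝ) ≤ τ ^ K := by
      calc |w| ^ ℓ / (ℓ.factorial : ℝ) ≤ |w| ^ ℓ :=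
            div_le_self (by positivity) (by exact_mod_cast Nat.factorial_pos ℓ)
        _ ≤ (ε * τ) ^ ℓ := by gcongr
        _ ≤ ε ^ 0 * τ ^ K := pow_mul_le_of_le_one hε hε1 hτ (by omega) (by omega)
        _ = τ ^ K := by simp
    rw [mul_comm]
    exact mul_le_mul (hC ℓ (by omega) y) h2 (by positivity) hC0
  refine (Finset.sum_le_sum hterm).trans (le_of_eq ?_)
  rw [Finset.sum_const, Finset.card_range, nsmul_eq_mul]
  ring

lemma abs_stagePoly_le (K b : ℕ) {ε τ w x : ℝ} (hε : 0 ≤ ε) (hτ : 1 ≤ τ) (hw : |w| ≤ ε * τ)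
    (hx : |x| ≤ ε * τ) : |stagePoly K b w x| ≤ K * (ε * τ) ^ b := by
  rw [stagePoly, Finset.sum_div]
  refine (Finset.abs_sum_le_sum_abs _ _).trans ?_
  have hterm : ∀ ℓ ∈ Finset.range K,
      |(b.choose ℓ : ℝ) * w ^ ℓ * x ^ (b - ℓ) / (b.factorial : ℝ)| ≤ (ε * τ) ^ b := by
    intro ℓ _
    rcases lt_or_ge b ℓ with h | h
    · rw [Nat.choose_eq_zero_of_lt h]
      simp only [CharP.cast_eq_zero, zero_mul, zero_div, abs_zero]
      positivity
    · rw [abs_div, abs_mul, abs_mul, abs_pow, abs_pow, Nat.abs_cast, Nat.abs_cast,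
        div_le_iff₀ (by positivity)]
      have h1 : (b.choose ℓ : ℝ) ≤ (b.factorial : ℝ) := by
        have := Nat.choose_mul_factorial_mul_factorial h
        have h3 : b.choose ℓ ≤ b.choose ℓ * (ℓ.factorial * (b - ℓ).factorial) :=
          Nat.le_mul_of_pos_right _ (by positivity)
        exact_mod_cast h3.trans (by rw [← mul_assoc, this])
      calc (b.choose ℓ : ℝ) * |w| ^ ℓ * |x| ^ (b - ℓ)
          ≤ (b.factorial : ℝ) * (ε * τ) ^ ℓ * (ε * τ) ^ (b - ℓ) := by gcongr
        _ = (ε * τ) ^ b * (b.factorial : ℝ) := by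
          rw [mul_assoc, ← pow_add, Nat.add_sub_cancel' h]; ring
  refine (Finset.sum_le_sum hterm).trans (le_of_eq ?_)
  rw [Finset.sum_const, Finset.card_range, nsmul_eq_mul]

/-- Joint expansion of a transmit and a receive stage. -/
lemma exists_bound_stageSum_mul_stageSum {P Q : ℕ → ℝ → ℝ} {L : ℕ} {C : ℝ}
    (hP : ∀ r < L, ∀ y, HasDerivAt (P r) (P (r + 1) y) y) (hPC : ∀ r ≤ L, ∀ y, |P r y| ≤ C)
    (hQ : ∀ r < L, ∀ y, HasDerivAt (Q r) (Q (r + 1) y) y) (hQC : ∀ r ≤ L, ∀ y, |Q r y| ≤ C)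
    {K₁ K₂ D : ℕ} (hK₁ : K₁ ≤ L) (hK₂ : K₂ ≤ L) (hD : D ≤ L) :
    ∃ C' : ℝ, 0 ≤ C' ∧ ∀ ε τ w₁ x₁ w₂ x₂ : ℝ, 0 ≤ ε → ε ≤ 1 → 1 ≤ τ → |w₁| ≤ ε * τ →
      |x₁| ≤ ε * τ → |w₂| ≤ ε * τ → |x₂| ≤ ε * τ → ∀ y₁ y₂ : ℝ,
      |stageSum K₁ P w₁ (y₁ + x₁) * stageSum K₂ Q w₂ (y₂ + x₂) -
        ∑ a ∈ Finset.range D, ∑ b ∈ Finset.range D,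
          stagePoly K₁ a w₁ x₁ * stagePoly K₂ b w₂ x₂ * (P a y₁ * Q b y₂)| ≤
        C' * (ε ^ D * τ ^ (K₁ + K₂ + 2 * D)) := by
  have hC0 : 0 ≤ C := (abs_nonneg _).trans (hPC 0 (by omega) 0)
  refine ⟨K₁ * C * (K₂ * C) + (∑ _a ∈ Finset.range D, K₁ * C) * (K₂ * C), by positivity, ?_⟩
  intro ε τ w₁ x₁ w₂ x₂ hε hε1 hτ hw₁ hx₁ hw₂ hx₂ y₁ y₂
  set T₁ := ∑ a ∈ Finset.range D, stagePoly K₁ a w₁ x₁ * P a y₁ with hT₁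
  set T₂ := ∑ b ∈ Finset.range D, stagePoly K₂ b w₂ x₂ * Q b y₂ with hT₂
  have hprod : ∑ a ∈ Finset.range D, ∑ b ∈ Finset.range D,
      stagePoly K₁ a w₁ x₁ * stagePoly K₂ b w₂ x₂ * (P a y₁ * Q b y₂) = T₁ * T₂ := by
    rw [hT₁, hT₂, Finset.sum_mul_sum]
    exact Finset.sum_congr rfl fun a _ => Finset.sum_congr rfl fun b _ => by ring
  have h1 := abs_stageSum_sub_le hP hPC hK₁ hD hε hε1 hτ hw₁ hx₁ y₁
  have h2 := abs_stageSum_sub_le hQ hQC hK₂ hD hε hε1 hτ hw₂ hx₂ y₂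
  have h3 := abs_stageSum_le hQC hK₂ hε hε1 hτ hw₂ (y₂ + x₂)
  have h4 : |T₁| ≤ (∑ _a ∈ Finset.range D, K₁ * C) * τ ^ D := by
    rw [hT₁, Finset.sum_mul]
    refine (Finset.abs_sum_le_sum_abs _ _).trans (Finset.sum_le_sum fun a ha => ?_)
    have haD := Finset.mem_range.1 ha
    rw [abs_mul]
    have h5 : K₁ * (ε * τ) ^ a ≤ K₁ * τ ^ D := by
      have := pow_mul_le_of_le_one hε hε1 hτ (Nat.zero_le a) haD.le
      rw [pow_zero, one_mul] at this
      gcongr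
    calc |stagePoly K₁ a w₁ x₁| * |P a y₁| ≤ (K₁ * τ ^ D) * C :=
          mul_le_mul ((abs_stagePoly_le K₁ a hε hτ hw₁ hx₁).trans h5) (hPC a (by omega) y₁)
            (abs_nonneg _) (by positivity)
      _ = K₁ * C * τ ^ D := by ring
  rw [hprod]
  set S₁ := stageSum K₁ P w₁ (y₁ + x₁)
  set S₂ := stageSum K₂ Q w₂ (y₂ + x₂)
  -- Each difference supplies the factor `ε ^ D`; the other factor of each product is bounded by a
  -- power of `τ`.
  have hsplit : S₁ * S₂ - T₁ * T₂ = (S₁ - T₁) * S₂ + T₁ * (S₂ - T₂) := by ring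
  rw [hsplit]
  refine (abs_add_le _ _).trans ?_
  rw [abs_mul, abs_mul, add_mul]
  refine add_le_add ?_ ?_
  · calc |S₁ - T₁| * |S₂| ≤ (K₁ * C * (ε ^ D * τ ^ (K₁ + D))) * (K₂ * C * τ ^ K₂) :=
          mul_le_mul h1 h3 (abs_nonneg _) (by positivity)
      _ = K₁ * C * (K₂ * C) * (ε ^ D * τ ^ (K₁ + K₂ + D)) := by ring
      _ ≤ K₁ * C * (K₂ * C) * (ε ^ D * τ ^ (K₁ + K₂ + 2 * D)) := by
          gcongr
          omega
  · calc |T₁| * |S₂ - T₂| ≤ ((∑ _a ∈ Finset.range D, K₁ * C) * τ ^ D) *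
          (K₂ * C * (ε ^ D * τ ^ (K₂ + D))) :=
          mul_le_mul h4 h2 (abs_nonneg _) (by positivity)
      _ = (∑ _a ∈ Finset.range D, K₁ * C) * (K₂ * C) * (ε ^ D * τ ^ (K₂ + 2 * D)) := by
          rw [show K₂ + 2 * D = D + (K₂ + D) by ring, pow_add]; ring
      _ ≤ (∑ _a ∈ Finset.range D, K₁ * C) * (K₂ * C) * (ε ^ D * τ ^ (K₁ + K₂ + 2 * D)) := by
          gcongr
          omega

/-! ### Impulse responses of smooth periodic frequency responses -/

lemma iteratedDeriv_periodic {F : ℝ → ℂ} {c : ℝ} (hF : Function.Periodic F c) (r : ℕ) :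
    Function.Periodic (iteratedDeriv r F) c := by
  intro x
  have h := congrFun (iteratedDeriv_comp_add_const r F c) x
  rw [← h]
  congr 1
  exact funext hF

lemma contDiff_iteratedDeriv {F : ℝ → ℂ} {n m r : ℕ}
    (hF : ContDiff ℝ ((n : ℕ) : WithTop ℕ∞) F) (h : m + r ≤ n) :
    ContDiff ℝ ((m : ℕ) : WithTop ℕ∞) (iteratedDeriv r F) := by
  induction r generalizing F n with
  | zero => simpa using hF.of_le (by exact_mod_cast (by omega : m ≤ n))
  | succ r ih =>
    rw [iteratedDeriv_succ']
    have h1 : ContDiff ℝ (((m + r : ℕ) : WithTop ℕ∞) + 1) F :=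
      hF.of_le (by exact_mod_cast (by omega : m + r + 1 ≤ n))
    exact ih (n := m + r) (contDiff_succ_iff_deriv.1 h1).2.2 le_rfl

/-- Integration by parts over one period: `F` and the exponential at an integer index are both
`2π`-periodic, so the boundary terms cancel. -/
lemma impulseResponse_deriv {F : ℝ → ℂ} (hF : ContDiff ℝ 1 F)
    (hp : Function.Periodic F (2 * Real.pi)) (i : ℤ) :
    impulseResponse (deriv F) i = -(I * i) * impulseResponse F i := by
  have hd : ∀ x, HasDerivAt F (deriv F x) x := fun x =>
    (hF.differentiable one_ne_zero x).hasDerivAt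
  have he : ∀ x : ℝ, HasDerivAt (fun x : ℝ => exp (I * x * (i : ℂ)))
      (exp (I * x * (i : ℂ)) * (I * i)) x := by
    intro x
    have h1 : HasDerivAt (fun x : ℝ => I * (x : ℂ) * (i : ℂ)) (I * 1 * (i : ℂ)) x :=
      ((Complex.ofRealCLM.hasDerivAt (x := x)).const_mul I).mul_const (i : ℂ)
    simpa using h1.cexp
  have hc : Continuous (deriv F) := hF.continuous_deriv le_rfl
  have hparts := intervalIntegral.integral_mul_deriv_eq_deriv_mul (a := 0) (b := 2 * Real.pi)
    (u := F) (u' := deriv F) (v := fun x : ℝ => exp (I * x * (i : ℂ)))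
    (v' := fun x : ℝ => exp (I * x * (i : ℂ)) * (I * i))
    (fun x _ => hd x) (fun x _ => he x) (hc.intervalIntegrable _ _)
    ((by fun_prop : Continuous fun x : ℝ => exp (I * x * (i : ℂ)) * (I * i)).intervalIntegrable _ _)
  have hper : F (2 * Real.pi) = F 0 := by simpa using hp 0
  have hexp : exp (I * ((2 * Real.pi : ℝ) : ℂ) * (i : ℂ)) = 1 := by
    rw [Complex.exp_eq_one_iff]
    exact ⟨i, by push_cast; ring⟩
  have hl : ∫ x in (0 : ℝ)..(2 * Real.pi), F x * (exp (I * x * (i : ℂ)) * (I * i)) =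
      (∫ x in (0 : ℝ)..(2 * Real.pi), F x * exp (I * x * (i : ℂ))) * (I * i) := by
    rw [← intervalIntegral.integral_mul_const]
    congr 1
    ext x
    ring
  rw [hl] at hparts
  simp only [hexp, hper] at hparts
  simp only [ofReal_zero, mul_zero, zero_mul, exp_zero, mul_one, sub_self, zero_sub] at hparts
  rw [impulseResponse, impulseResponse, show ∫ x in (0 : ℝ)..(2 * Real.pi),
    deriv F x * exp (I * x * (i : ℂ)) = -((∫ x in (0 : ℝ)..(2 * Real.pi),
    F x * exp (I * x * (i : ℂ))) * (I * i)) by rw [hparts]; simp]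
  ring

lemma impulseResponse_iteratedDeriv {F : ℝ → ℂ} {n : ℕ}
    (hF : ContDiff ℝ ((n : ℕ) : WithTop ℕ∞) F) (hp : Function.Periodic F (2 * Real.pi)) {r : ℕ}
    (hr : r ≤ n) (i : ℤ) :
    impulseResponse (iteratedDeriv r F) i = (-(I * i)) ^ r * impulseResponse F i := by
  induction r with
  | zero => simp
  | succ r ih =>
    have h1 : ContDiff ℝ ((1 : ℕ) : WithTop ℕ∞) (iteratedDeriv r F) :=
      contDiff_iteratedDeriv hF (by omega)
    rw [iteratedDeriv_succ, impulseResponse_deriv (by exact_mod_cast h1)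
      (iteratedDeriv_periodic hp r), ih (by omega)]
    ring

lemma exists_bound_impulseResponse {F : ℝ → ℂ} (hF : Continuous F) :
    ∃ C : ℝ, ∀ i, ‖impulseResponse F i‖ ≤ C := by
  obtain ⟨C, hC⟩ := (isCompact_uIcc (a := (0 : ℝ)) (b := 2 * Real.pi)).exists_bound_of_continuousOn
    hF.continuousOn
  refine ⟨‖(1 / (2 * (Real.pi : ℂ)))‖ * (C * |2 * Real.pi - 0|), fun i => ?_⟩
  rw [impulseResponse, norm_mul]
  gcongr
  refine intervalIntegral.norm_integral_le_of_norm_le_const fun x hx => ?_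
  have h1 : ‖exp (I * x * (i : ℂ))‖ = 1 := by
    rw [show I * (x : ℂ) * (i : ℂ) = ((x * i : ℝ) : ℂ) * I by push_cast; ring]
    exact Complex.norm_exp_ofReal_mul_I _
  rw [norm_mul, h1, mul_one]
  exact hC x (Set.uIoc_subset_uIcc hx)

/-- `E + 2` derivatives bound `|i| ^ (E + 2) * ‖f i‖`; the weight uses `E` of these powers and the
remaining `1 / i ^ 2` is summable. -/
lemma summable_pow_mul_impulseResponse {F : ℝ → ℂ} {E : ℕ}
    (hF : ContDiff ℝ ((E + 2 : ℕ) : WithTop ℕ∞) F) (hp : Function.Periodic F (2 * Real.pi)) :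
    Summable fun i : ℤ => (1 + |(i : ℝ)|) ^ E * ‖impulseResponse F i‖ := by
  have h0 : ContDiff ℝ ((0 : ℕ) : WithTop ℕ∞) (iteratedDeriv (E + 2) F) :=
    contDiff_iteratedDeriv hF (by omega)
  obtain ⟨C, hC⟩ := exists_bound_impulseResponse h0.continuous
  have hs : Summable fun i : ℤ => 2 ^ E * C * (1 / (i : ℝ) ^ 2) :=
    (Real.summable_one_div_int_pow.2 one_lt_two).mul_left _
  refine Summable.of_norm_bounded_eventually hs ?_
  have hcof : ∀ᶠ i : ℤ in Filter.cofinite, i ≠ 0 :=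
    (Set.finite_singleton (0 : ℤ)).compl_mem_cofinite
  filter_upwards [hcof] with i hi
  have h1 : (1 : ℝ) ≤ |(i : ℝ)| := by exact_mod_cast Int.one_le_abs hi
  have h2 := hC i
  rw [impulseResponse_iteratedDeriv hF hp le_rfl, norm_mul, norm_pow, norm_neg, norm_mul, norm_I,
    one_mul, Complex.norm_intCast] at h2
  rw [Real.norm_of_nonneg (by positivity), mul_one_div, le_div_iff₀ (by positivity)]
  calc (1 + |(i : ℝ)|) ^ E * ‖impulseResponse F i‖ * (i : ℝ) ^ 2
      ≤ (2 * |(i : ℝ)|) ^ E * ‖impulseResponse F i‖ * |(i : ℝ)| ^ 2 := by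
        rw [sq_abs]; gcongr; linarith
    _ = 2 ^ E * (|(i : ℝ)| ^ (E + 2) * ‖impulseResponse F i‖) := by ring
    _ ≤ 2 ^ E * C := by gcongr

lemma summable_norm_pow_mul {F : ℝ → ℂ} {E r : ℕ} (hr : r ≤ E)
    (hs : Summable fun i : ℤ => (1 + |(i : ℝ)|) ^ E * ‖impulseResponse F i‖) :
    Summable fun i : ℤ => |(i : ℝ)| ^ r * ‖impulseResponse F i‖ := by
  refine Summable.of_nonneg_of_le (fun i => by positivity) (fun i => ?_) hs
  gcongr
  calc |(i : ℝ)| ^ r ≤ (1 + |(i : ℝ)|) ^ r := by gcongr; linarith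
    _ ≤ (1 + |(i : ℝ)|) ^ E := pow_le_pow_right₀ (by linarith [abs_nonneg (i : ℝ)]) hr

/-- Two derivatives make the Fourier coefficients summable, and then the Fourier series converges to
the function at every point. -/
lemma hasSum_impulseResponse {F : ℝ → ℂ} (hF : ContDiff ℝ 2 F)
    (hp : Function.Periodic F (2 * Real.pi)) (ω : ℝ) :
    HasSum (fun i : ℤ => impulseResponse F i * exp (-(I * ω * i))) (F ω) := by
  have : Fact (0 < 2 * Real.pi) := ⟨Real.two_pi_pos⟩
  let f : C(AddCircle (2 * Real.pi), ℂ) :=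
    ⟨hp.lift, continuous_coinduced_dom.mpr hF.continuous⟩
  have hcoe : ∀ x : ℝ, f (x : AddCircle (2 * Real.pi)) = F x := fun x => hp.lift_coe x
  -- The impulse response is taken with `e^{+jωi}`, the opposite sign to the usual Fourier
  -- coefficient, hence the reflection of the index.
  have hcoeff : ∀ i : ℤ, fourierCoeff f i = impulseResponse F (-i) := by
    intro i
    rw [fourierCoeff_eq_intervalIntegral f i 0, impulseResponse, zero_add]
    rw [Complex.real_smul]
    congr 1
    · push_cast; ring
    · refine intervalIntegral.integral_congr fun x _ => ?_
      simp only [hcoe, fourier_coe_apply, smul_eq_mul]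
      rw [mul_comm]
      congr 2
      have : (Real.pi : ℂ) ≠ 0 := by exact_mod_cast Real.pi_ne_zero
      push_cast
      field_simp
  have hsum : Summable fun i : ℤ => ‖impulseResponse F i‖ := by
    simpa using summable_pow_mul_impulseResponse (E := 0) (by exact_mod_cast hF) hp
  have hsum' : Summable (fourierCoeff f) := by
    have h1 : Summable (fun i : ℤ => impulseResponse F (-i)) :=
      (Equiv.neg ℤ).summable_iff.2 hsum.of_norm
    exact h1.congr fun i => (hcoeff i).symm
  have h := has_pointwise_sum_fourier_series_of_summable hsum' (ω : AddCircle (2 * Real.pi))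
  rw [hcoe] at h
  rw [← (Equiv.neg ℤ).hasSum_iff] at h
  convert h using 1
  ext i
  simp only [Function.comp_apply, Equiv.neg_apply, hcoeff, neg_neg, smul_eq_mul,
    fourier_coe_apply]
  congr 2
  have : (Real.pi : ℂ) ≠ 0 := by exact_mod_cast Real.pi_ne_zero
  push_cast
  field_simp

lemma hasSum_iteratedDeriv {F : ℝ → ℂ} {n : ℕ} (hF : ContDiff ℝ ((n : ℕ) : WithTop ℕ∞) F)
    (hp : Function.Periodic F (2 * Real.pi)) {r : ℕ} (hr : r + 2 ≤ n) (ω : ℝ) :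
    HasSum (fun i : ℤ => (-(I * i)) ^ r * impulseResponse F i * exp (-(I * ω * i)))
      (iteratedDeriv r F ω) := by
  have h1 : ContDiff ℝ ((2 : ℕ) : WithTop ℕ∞) (iteratedDeriv r F) :=
    contDiff_iteratedDeriv hF (by omega)
  have h := hasSum_impulseResponse (by exact_mod_cast h1) (iteratedDeriv_periodic hp r) ω
  simpa only [impulseResponse_iteratedDeriv hF hp (by omega : r ≤ n)] using h

/-- The moments of the impulse response are the derivatives of the frequency response. -/
lemma hasSum_moment {F : ℝ → ℂ} {n : ℕ} (hF : ContDiff ℝ ((n : ℕ) : WithTop ℕ∞) F)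
    (hp : Function.Periodic F (2 * Real.pi)) {r : ℕ} (hr : r + 2 ≤ n) (ω : ℝ) :
    HasSum (fun i : ℤ => (((-(i : ℝ)) ^ r : ℝ) : ℂ) * (impulseResponse F i * exp (-(I * ω * i))))
      ((-I) ^ r * iteratedDeriv r F ω) := by
  have h := (hasSum_iteratedDeriv hF hp hr ω).mul_left ((-I) ^ r)
  refine (congrArg (fun f => HasSum f _) (funext fun i => ?_)).mpr h
  rw [mul_assoc ((-(I * (i : ℂ))) ^ r), ← mul_assoc ((-I) ^ r), ← mul_pow]
  congr 1
  push_cast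
  congr 1
  rw [show -I * -(I * (i : ℂ)) = (I * I) * i by ring, I_mul_I]
  ring

/-! ### Expansion of the multi-stage transfer coefficients -/

lemma norm_exp_I_mul_ofReal (x : ℝ) : ‖exp (I * (x : ℂ))‖ = 1 := by
  rw [mul_comm]; exact norm_exp_ofReal_mul_I x

lemma hasSum_mul_mul {f g h : ℤ → ℂ} {a b c : ℂ} (hf : HasSum f a) (hg : HasSum g b)
    (hh : HasSum h c) (hf' : Summable fun i => ‖f i‖) (hg' : Summable fun i => ‖g i‖)
    (hh' : Summable fun i => ‖h i‖) :
    HasSum (fun t : ℤ × ℤ × ℤ => f t.1 * (g t.2.1 * h t.2.2)) (a * (b * c)) := by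
  have h1 : Summable fun t : ℤ × ℤ => ‖g t.1 * h t.2‖ := Summable.mul_norm hg' hh'
  have h2 : HasSum (fun t : ℤ × ℤ => g t.1 * h t.2) (b * c) := HasSum.mul hg hh h1.of_norm
  have h3 : Summable fun t : ℤ × ℤ × ℤ => ‖f t.1 * (fun t : ℤ × ℤ => g t.1 * h t.2) t.2‖ :=
    Summable.mul_norm (f := f) (g := fun t : ℤ × ℤ => g t.1 * h t.2) hf' h1
  exact HasSum.mul (f := f) (g := fun t : ℤ × ℤ => g t.1 * h t.2) hf h2 h3.of_norm

/-- The alternating partial sum `∑_{ℓ < K} (-1)^(a + ℓ) C(a, ℓ)`. -/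
def altSum (K a : ℕ) : ℝ := ∑ ℓ ∈ Finset.range K, (-1) ^ (a + ℓ) * (a.choose ℓ : ℝ)

lemma altSum_zero {K : ℕ} (hK : 1 ≤ K) : altSum K 0 = 1 := by
  obtain ⟨K, rfl⟩ := Nat.exists_eq_add_of_le' hK
  rw [altSum, Finset.sum_range_succ']
  simp

/-- The alternating partial sums of a row of Pascal's triangle telescope to a single entry of the
row above. This is the origin of the factor `C(j - 1, K' - 1)` in `muTilde`. -/
lemma altSum_succ {K a : ℕ} (hK : 1 ≤ K) (ha : 1 ≤ a) :
    altSum K a = -((-1) ^ (a + K) * ((a - 1).choose (K - 1) : ℝ)) := by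
  obtain ⟨K, rfl⟩ := Nat.exists_eq_add_of_le' hK
  obtain ⟨a, rfl⟩ := Nat.exists_eq_add_of_le' ha
  have h := @Int.alternating_sum_range_choose_eq_choose a K
  have h' : ∑ k ∈ Finset.range (K + 1), (-1 : ℝ) ^ k * ((a + 1).choose k : ℝ) =
      (-1) ^ K * (a.choose K : ℝ) := by exact_mod_cast h
  simp only [altSum, pow_add, mul_assoc, ← Finset.mul_sum, Nat.add_sub_cancel] at h' ⊢
  rw [h']
  ring

/-- This is the gain from `K` transmit stages: the orders `1, …, K - 1` cancel. -/
lemma altSum_eq_zero {K a : ℕ} (ha : 1 ≤ a) (h : a < K) : altSum K a = 0 := by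
  rw [altSum_succ (by omega) ha, Nat.choose_eq_zero_of_lt (by omega)]
  simp

/-- The stages imitate a shift by `-u`, and the argument is shifted back by `u`. With all stages
present the coefficient would be `(-u + u) ^ a / a!`; the truncation leaves an alternating partial
sum of the binomial expansion. -/
lemma stagePoly_neg_self (K a : ℕ) (u : ℝ) :
    stagePoly K a (-u) u = altSum K a * (-u) ^ a / (a.factorial : ℝ) := by
  rw [stagePoly, altSum, Finset.sum_mul]
  congr 1
  refine Finset.sum_congr rfl fun ℓ _ => ?_
  rcases lt_or_ge a ℓ with h | h
  · rw [Nat.choose_eq_zero_of_lt h]; simp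
  · have h1 : (-u) ^ a = (-u) ^ ℓ * ((-1) ^ (a - ℓ) * u ^ (a - ℓ)) := by
      rw [← mul_pow, neg_one_mul, ← pow_add, Nat.add_sub_cancel' h]
    have h2 : (-1 : ℝ) ^ (a + ℓ) = (-1) ^ (a - ℓ) := by
      rw [show a + ℓ = (a - ℓ) + 2 * ℓ by omega, pow_add, pow_mul]; simp
    have h3 : ((-1 : ℝ) ^ (a - ℓ)) * (-1) ^ (a - ℓ) = 1 := by
      rw [← mul_pow]; simp
    rw [h1, h2]
    linear_combination -((a.choose ℓ : ℝ) * (-u) ^ ℓ * u ^ (a - ℓ)) * h3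

lemma stagePoly_smul (K b : ℕ) (ε w x : ℝ) :
    stagePoly K b (w * ε) (x * ε) = ε ^ b * stagePoly K b w x := by
  rw [stagePoly, stagePoly, ← mul_div_assoc, Finset.mul_sum]
  congr 1
  refine Finset.sum_congr rfl fun ℓ _ => ?_
  rcases lt_or_ge b ℓ with h | h
  · rw [Nat.choose_eq_zero_of_lt h]; simp
  · rw [mul_pow, mul_pow]
    conv_rhs => rw [show b = ℓ + (b - ℓ) by omega, pow_add, Nat.add_sub_cancel_left]
    rw [Nat.add_sub_cancel' h]
    ring

/-- Coefficient of the pulse pair `(p^(a), q^(b))` in the expansion of the multi-stage transceiver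
for scalar receiver `B`, channel `H` and precoder `A`. -/
def scalarCoeff (KT KR : ℕ) (B H A : ℝ → ℂ) (a b : ℕ) (ω : ℝ) : ℂ :=
  (altSum KT a : ℂ) * (-I) ^ (a + b) / ((a.factorial : ℂ) * (b.factorial : ℂ)) *
    ∑ ℓ ∈ Finset.range KR, (b.choose ℓ : ℂ) * (iteratedDeriv ℓ B ω *
      ∑ s ∈ Finset.range (b - ℓ + 1), ((b - ℓ).choose s : ℂ) *
        (iteratedDeriv (b - ℓ - s) H ω * iteratedDeriv (a + s) A ω))

/-- Impulse response modulated to the frequency `ω`. -/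
def modResponse (F : ℝ → ℂ) (ω : ℝ) (i : ℤ) : ℂ := impulseResponse F i * exp (-(I * ω * i))

lemma norm_modResponse (F : ℝ → ℂ) (ω : ℝ) (i : ℤ) :
    ‖modResponse F ω i‖ = ‖impulseResponse F i‖ := by
  rw [modResponse, norm_mul, show -(I * (ω : ℂ) * i) = I * ((-(ω * i) : ℝ) : ℂ) by push_cast; ring,
    norm_exp_I_mul_ofReal, mul_one]

lemma summable_moment {F : ℝ → ℂ} {E r : ℕ} (hF : ContDiff ℝ ((E + 2 : ℕ) : WithTop ℕ∞) F)
    (hp : Function.Periodic F (2 * Real.pi)) (hr : r ≤ E) (ω : ℝ) :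
    Summable fun i : ℤ => ‖(((-(i : ℝ)) ^ r : ℝ) : ℂ) * modResponse F ω i‖ := by
  refine (summable_norm_pow_mul hr (summable_pow_mul_impulseResponse hF hp)).congr fun i => ?_
  rw [norm_mul, norm_modResponse, Complex.norm_real, norm_pow, norm_neg, Real.norm_eq_abs]

/-- The two polynomials are split into monomials in the three delays, and each monomial sums to a
product of derivatives by `hasSum_moment`. The total degree `a + b ≤ E` ensures that all these
moments converge absolutely. -/
lemma hasSum_scalarCoeff {KT KR E a b : ℕ} {B H A : ℝ → ℂ}
    (hB : ContDiff ℝ ((E + 2 : ℕ) : WithTop ℕ∞) B) (hBp : Function.Periodic B (2 * Real.pi))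
    (hH : ContDiff ℝ ((E + 2 : ℕ) : WithTop ℕ∞) H) (hHp : Function.Periodic H (2 * Real.pi))
    (hA : ContDiff ℝ ((E + 2 : ℕ) : WithTop ℕ∞) A) (hAp : Function.Periodic A (2 * Real.pi))
    (hab : a + b ≤ E) (ω : ℝ) :
    HasSum (fun t : ℤ × ℤ × ℤ =>
      ((stagePoly KT a (-(t.2.2 : ℝ)) t.2.2 *
          stagePoly KR b (-(t.1 : ℝ)) (-(t.2.1 : ℝ) - t.2.2) : ℝ) : ℂ) *
        (modResponse B ω t.1 * (modResponse H ω t.2.1 * modResponse A ω t.2.2)))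
      (scalarCoeff KT KR B H A a b ω) := by
  have hmono : ∀ α β γ : ℕ, α ≤ E → β ≤ E → γ ≤ E → HasSum (fun t : ℤ × ℤ × ℤ =>
      ((((-(t.1 : ℝ)) ^ α : ℝ) : ℂ) * modResponse B ω t.1) *
        (((((-(t.2.1 : ℝ)) ^ β : ℝ) : ℂ) * modResponse H ω t.2.1) *
          ((((-(t.2.2 : ℝ)) ^ γ : ℝ) : ℂ) * modResponse A ω t.2.2)))
      (((-I) ^ α * iteratedDeriv α B ω) * (((-I) ^ β * iteratedDeriv β H ω) *
        ((-I) ^ γ * iteratedDeriv γ A ω))) := by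
    intro α β γ hα hβ hγ
    exact hasSum_mul_mul (f := fun v => (((-(v : ℝ)) ^ α : ℝ) : ℂ) * modResponse B ω v)
      (g := fun v => (((-(v : ℝ)) ^ β : ℝ) : ℂ) * modResponse H ω v)
      (h := fun v => (((-(v : ℝ)) ^ γ : ℝ) : ℂ) * modResponse A ω v)
      (hasSum_moment hB hBp (by omega) ω) (hasSum_moment hH hHp (by omega) ω)
      (hasSum_moment hA hAp (by omega) ω) (summable_moment hB hBp hα ω)
      (summable_moment hH hHp hβ ω) (summable_moment hA hAp hγ ω)
  have hinner : ∀ ℓ ∈ Finset.range KR, HasSum (fun t : ℤ × ℤ × ℤ =>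
      (b.choose ℓ : ℂ) * ∑ s ∈ Finset.range (b - ℓ + 1), ((b - ℓ).choose s : ℂ) *
        (((((-(t.1 : ℝ)) ^ ℓ : ℝ) : ℂ) * modResponse B ω t.1) *
        (((((-(t.2.1 : ℝ)) ^ (b - ℓ - s) : ℝ) : ℂ) * modResponse H ω t.2.1) *
          ((((-(t.2.2 : ℝ)) ^ (a + s) : ℝ) : ℂ) * modResponse A ω t.2.2))))
      ((-I) ^ (a + b) * ((b.choose ℓ : ℂ) * (iteratedDeriv ℓ B ω *
      ∑ s ∈ Finset.range (b - ℓ + 1), ((b - ℓ).choose s : ℂ) *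
        (iteratedDeriv (b - ℓ - s) H ω * iteratedDeriv (a + s) A ω)))) := by
    intro ℓ _
    rcases lt_or_ge b ℓ with h | h
    · rw [Nat.choose_eq_zero_of_lt h]
      simp
    · have h1 : (-I) ^ (a + b) * ((b.choose ℓ : ℂ) * (iteratedDeriv ℓ B ω *
          ∑ s ∈ Finset.range (b - ℓ + 1), ((b - ℓ).choose s : ℂ) *
          (iteratedDeriv (b - ℓ - s) H ω * iteratedDeriv (a + s) A ω))) =
          (b.choose ℓ : ℂ) * ∑ s ∈ Finset.range (b - ℓ + 1), ((b - ℓ).choose s : ℂ) *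
          (((-I) ^ ℓ * iteratedDeriv ℓ B ω) * (((-I) ^ (b - ℓ - s) * iteratedDeriv (b - ℓ - s) H ω) *
          ((-I) ^ (a + s) * iteratedDeriv (a + s) A ω))) := by
        simp only [Finset.mul_sum]
        refine Finset.sum_congr rfl fun s hs => ?_
        have hs' := Finset.mem_range.1 hs
        rw [show a + b = ℓ + ((b - ℓ - s) + (a + s)) by omega, pow_add, pow_add]
        ring
      rw [h1]
      refine HasSum.mul_left _ (hasSum_sum fun s hs => HasSum.mul_left _ ?_)
      have hs' := Finset.mem_range.1 hs
      exact hmono ℓ (b - ℓ - s) (a + s) (by omega) (by omega) (by omega)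
  have h := (hasSum_sum hinner).mul_left
    ((altSum KT a : ℂ) / ((a.factorial : ℂ) * (b.factorial : ℂ)))
  have hval : (altSum KT a : ℂ) / ((a.factorial : ℂ) * (b.factorial : ℂ)) *
      ∑ ℓ ∈ Finset.range KR, ((-I) ^ (a + b) * ((b.choose ℓ : ℂ) * (iteratedDeriv ℓ B ω *
      ∑ s ∈ Finset.range (b - ℓ + 1), ((b - ℓ).choose s : ℂ) *
        (iteratedDeriv (b - ℓ - s) H ω * iteratedDeriv (a + s) A ω)))) =
      scalarCoeff KT KR B H A a b ω := by
    rw [scalarCoeff, ← Finset.mul_sum]; ring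
  rw [hval] at h
  refine (congrArg (fun f => HasSum f _) (funext fun t => ?_)).mpr h
  rw [stagePoly_neg_self, stagePoly]
  -- The binomial expansion of the combined delay of `H` and `A` plays the role of Leibniz' rule for
  -- the product of the two responses.
  have hexp : ∀ ℓ, (-(t.2.1 : ℝ) - t.2.2) ^ (b - ℓ) = ∑ s ∈ Finset.range (b - ℓ + 1),
      (-(t.2.2 : ℝ)) ^ s * (-(t.2.1 : ℝ)) ^ (b - ℓ - s) * ((b - ℓ).choose s : ℝ) := by
    intro ℓ
    rw [← add_pow]; congr 1; ring
  simp only [hexp]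
  push_cast
  simp only [Finset.sum_div, Finset.mul_sum, Finset.sum_mul]
  refine Finset.sum_congr rfl fun ℓ _ => Finset.sum_congr rfl fun s _ => ?_
  rw [pow_add (-(t.2.2 : ℂ)) a s]
  ring

/-- The multi-stage transfer coefficient between two frequencies, for scalar receiver `B`,
channel `H` and precoder `A`, up to the phases of the two subcarriers. -/
def transferCoeff (KT KR κ M : ℕ) (p q : ℕ → ℤ → ℝ) (B H A : ℝ → ℂ) (ω ω' : ℝ) (n : ℤ) : ℂ :=
  ∑ ℓ₁ ∈ Finset.range KT, ∑ ℓ₂ ∈ Finset.range KR,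
    (-I) ^ (ℓ₁ + ℓ₂) / ((ℓ₁.factorial : ℂ) * (ℓ₂.factorial : ℂ) * (2 * (M : ℂ)) ^ (ℓ₁ + ℓ₂)) *
      (iteratedDeriv ℓ₂ B ω * iteratedDeriv ℓ₁ A ω' *
        ∑ m ∈ Finset.Icc (1 : ℤ) (2 * (M : ℤ) * κ), (q ℓ₂ m : ℂ) * exp (I * ω * (m : ℂ)) *
          ∑' i : ℤ, impulseResponse H i *
            ((p ℓ₁ (n - m - i) : ℂ) * exp (I * ω' * ((n - 1 - m - i : ℤ) : ℂ))))

/-- Transfer coefficient of a flat channel between two frequencies. -/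
def flatCoeff (κ M : ℕ) (p q : ℤ → ℝ) (ω ω' : ℝ) (n : ℤ) : ℂ :=
  ∑ m ∈ Finset.Icc (1 : ℤ) (2 * (M : ℤ) * κ), ((p (n - m) * q m : ℝ) : ℂ) *
    (exp (I * ω * (m : ℂ)) * exp (I * ω' * ((n - 1 - m : ℤ) : ℂ)))

/-- Since `(-j) ^ ℓ B^(ℓ)` is the series of the moments `(-v) ^ ℓ` of the taps, and likewise for
`A`, the stages can be summed before the delays. Each triple of delays then sees one weighted sum of
transmit pulses and one of receive pulses. -/
lemma hasSum_transferCoeff {KT KR κ M E : ℕ} {p q : ℕ → ℤ → ℝ} {B H A : ℝ → ℂ} {C : ℝ}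
    (hB : ContDiff ℝ ((E + 2 : ℕ) : WithTop ℕ∞) B) (hBp : Function.Periodic B (2 * Real.pi))
    (hH : ContDiff ℝ ((E + 2 : ℕ) : WithTop ℕ∞) H) (hHp : Function.Periodic H (2 * Real.pi))
    (hA : ContDiff ℝ ((E + 2 : ℕ) : WithTop ℕ∞) A) (hAp : Function.Periodic A (2 * Real.pi))
    (hKT : KT ≤ E) (hKR : KR ≤ E) (hp : ∀ r < KT, ∀ n, |p r n| ≤ C) (ω ω' : ℝ) (n : ℤ) :
    HasSum (fun t : ℤ × ℤ × ℤ => modResponse B ω t.1 * (impulseResponse H t.2.1 *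
        modResponse A ω' t.2.2) *
      ∑ m ∈ Finset.Icc (1 : ℤ) (2 * (M : ℤ) * κ),
        (((∑ ℓ₁ ∈ Finset.range KT, (-(t.2.2 : ℝ) * (2 * (M : ℝ))⁻¹) ^ ℓ₁ / (ℓ₁.factorial : ℝ) *
            p ℓ₁ (n - m - t.2.1)) *
          (∑ ℓ₂ ∈ Finset.range KR, (-(t.1 : ℝ) * (2 * (M : ℝ))⁻¹) ^ ℓ₂ / (ℓ₂.factorial : ℝ) *
            q ℓ₂ m) : ℝ) : ℂ) *
        (exp (I * ω * (m : ℂ)) * exp (I * ω' * ((n - 1 - m - t.2.1 : ℤ) : ℂ))))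
      (transferCoeff KT KR κ M p q B H A ω ω' n) := by
  have hterm : ∀ ℓ₁ ∈ Finset.range KT, ∀ ℓ₂ ∈ Finset.range KR,
      ∀ m ∈ Finset.Icc (1 : ℤ) (2 * (M : ℤ) * κ),
      HasSum (fun t : ℤ × ℤ × ℤ => ((((-(t.1 : ℝ)) ^ ℓ₂ : ℝ) : ℂ) * modResponse B ω t.1) *
        ((impulseResponse H t.2.1 * ((p ℓ₁ (n - m - t.2.1) : ℂ) *
          exp (I * ω' * ((n - 1 - m - t.2.1 : ℤ) : ℂ)))) *
          ((((-(t.2.2 : ℝ)) ^ ℓ₁ : ℝ) : ℂ) * modResponse A ω' t.2.2)))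
        (((-I) ^ ℓ₂ * iteratedDeriv ℓ₂ B ω) * ((∑' i : ℤ, impulseResponse H i *
            ((p ℓ₁ (n - m - i) : ℂ) * exp (I * ω' * ((n - 1 - m - i : ℤ) : ℂ)))) *
          ((-I) ^ ℓ₁ * iteratedDeriv ℓ₁ A ω'))) := by
    intro ℓ₁ h₁ ℓ₂ h₂ m _
    rw [Finset.mem_range] at h₁ h₂
    have hs : Summable fun i : ℤ => ‖impulseResponse H i *
        ((p ℓ₁ (n - m - i) : ℂ) * exp (I * ω' * ((n - 1 - m - i : ℤ) : ℂ)))‖ := by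
      have h0 : Summable fun i : ℤ => ‖impulseResponse H i‖ := by
        simpa using summable_norm_pow_mul (Nat.zero_le E) (summable_pow_mul_impulseResponse hH hHp)
      refine Summable.of_nonneg_of_le (fun i => norm_nonneg _) (fun i => ?_) (h0.mul_right C)
      rw [norm_mul, norm_mul]
      gcongr
      rw [show I * (ω' : ℂ) * ((n - 1 - m - i : ℤ) : ℂ) = I * ((ω' * (n - 1 - m - i : ℤ) : ℝ) : ℂ) by
        push_cast; ring, norm_exp_I_mul_ofReal, mul_one, Complex.norm_real]
      exact hp ℓ₁ h₁ _
    exact hasSum_mul_mul (f := fun v => (((-(v : ℝ)) ^ ℓ₂ : ℝ) : ℂ) * modResponse B ω v)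
      (g := fun i => impulseResponse H i * ((p ℓ₁ (n - m - i) : ℂ) *
        exp (I * ω' * ((n - 1 - m - i : ℤ) : ℂ))))
      (h := fun v => (((-(v : ℝ)) ^ ℓ₁ : ℝ) : ℂ) * modResponse A ω' v)
      (hasSum_moment hB hBp (by omega) ω) hs.of_norm.hasSum
      (hasSum_moment hA hAp (by omega) ω') (summable_moment hB hBp (by omega) ω) hs
      (summable_moment hA hAp (by omega) ω')
  have h : HasSum (fun t : ℤ × ℤ × ℤ => ∑ ℓ₁ ∈ Finset.range KT, ∑ ℓ₂ ∈ Finset.range KR,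
      1 / ((ℓ₁.factorial : ℂ) * (ℓ₂.factorial : ℂ) * (2 * (M : ℂ)) ^ (ℓ₁ + ℓ₂)) *
      ∑ m ∈ Finset.Icc (1 : ℤ) (2 * (M : ℤ) * κ), (q ℓ₂ m : ℂ) * exp (I * ω * (m : ℂ)) *
      (((((-(t.1 : ℝ)) ^ ℓ₂ : ℝ) : ℂ) * modResponse B ω t.1) *
        ((impulseResponse H t.2.1 * ((p ℓ₁ (n - m - t.2.1) : ℂ) *
          exp (I * ω' * ((n - 1 - m - t.2.1 : ℤ) : ℂ)))) *
          ((((-(t.2.2 : ℝ)) ^ ℓ₁ : ℝ) : ℂ) * modResponse A ω' t.2.2)))) (∑ ℓ₁ ∈ Finset.range KT, ∑ ℓ₂ ∈ Finset.range KR,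
      1 / ((ℓ₁.factorial : ℂ) * (ℓ₂.factorial : ℂ) * (2 * (M : ℂ)) ^ (ℓ₁ + ℓ₂)) *
      ∑ m ∈ Finset.Icc (1 : ℤ) (2 * (M : ℤ) * κ), (q ℓ₂ m : ℂ) * exp (I * ω * (m : ℂ)) *
      (((-I) ^ ℓ₂ * iteratedDeriv ℓ₂ B ω) * ((∑' i : ℤ, impulseResponse H i *
            ((p ℓ₁ (n - m - i) : ℂ) * exp (I * ω' * ((n - 1 - m - i : ℤ) : ℂ)))) *
          ((-I) ^ ℓ₁ * iteratedDeriv ℓ₁ A ω')))) := by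
    refine hasSum_sum fun ℓ₁ h₁ => hasSum_sum fun ℓ₂ h₂ => HasSum.mul_left _ ?_
    refine hasSum_sum fun m hm => HasSum.mul_left _ ?_
    exact hterm ℓ₁ h₁ ℓ₂ h₂ m hm
  have hval : transferCoeff KT KR κ M p q B H A ω ω' n = ∑ ℓ₁ ∈ Finset.range KT, ∑ ℓ₂ ∈ Finset.range KR,
      1 / ((ℓ₁.factorial : ℂ) * (ℓ₂.factorial : ℂ) * (2 * (M : ℂ)) ^ (ℓ₁ + ℓ₂)) *
      ∑ m ∈ Finset.Icc (1 : ℤ) (2 * (M : ℤ) * κ), (q ℓ₂ m : ℂ) * exp (I * ω * (m : ℂ)) *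
      (((-I) ^ ℓ₂ * iteratedDeriv ℓ₂ B ω) * ((∑' i : ℤ, impulseResponse H i *
            ((p ℓ₁ (n - m - i) : ℂ) * exp (I * ω' * ((n - 1 - m - i : ℤ) : ℂ)))) *
          ((-I) ^ ℓ₁ * iteratedDeriv ℓ₁ A ω'))) := by
    rw [transferCoeff]
    refine Finset.sum_congr rfl fun ℓ₁ _ => Finset.sum_congr rfl fun ℓ₂ _ => ?_
    rw [pow_add]
    simp only [Finset.mul_sum]
    refine Finset.sum_congr rfl fun m _ => ?_
    ring
  rw [hval]
  refine (congrArg (fun f => HasSum f _) (funext fun t => ?_)).mpr h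
  simp only [Finset.sum_mul_sum]
  push_cast
  simp only [Finset.sum_mul, Finset.mul_sum]
  rw [Finset.sum_comm]
  refine Finset.sum_congr rfl fun ℓ₁ _ => ?_
  rw [Finset.sum_comm]
  refine Finset.sum_congr rfl fun ℓ₂ _ => Finset.sum_congr rfl fun m _ => ?_
  rw [mul_pow, mul_pow, inv_pow, inv_pow, pow_add (2 * (M : ℂ))]
  simp only [div_eq_mul_inv, mul_inv]
  ring

lemma stageSum_eq_zero {K : ℕ} {P : ℕ → ℝ → ℝ} {y : ℝ} (h : ∀ r, P r y = 0) (w : ℝ) :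
    stageSum K P w y = 0 := by
  simp [stageSum, h]

/-- A translation in time moves all delays to the carrier of the receiving subcarrier. -/
lemma sum_stageSum_shift {KT KR κ M : ℕ} {P Q : ℕ → ℝ → ℝ}
    (hQs : ∀ r n, n ∉ Finset.Icc (1 : ℤ) (2 * (M : ℤ) * κ) → Q r (samplePoint κ M n) = 0)
    (B H A : ℝ → ℂ) (ω ω' : ℝ) (n v i u : ℤ) (w₁ w₂ : ℝ) :
    modResponse B ω v * (impulseResponse H i * modResponse A ω' u) *
      ∑ m ∈ Finset.Icc (1 : ℤ) (2 * (M : ℤ) * κ),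
        ((stageSum KT P w₁ (samplePoint κ M (n - m - i)) *
          stageSum KR Q w₂ (samplePoint κ M m) : ℝ) : ℂ) *
        (exp (I * ω * (m : ℂ)) * exp (I * ω' * ((n - 1 - m - i : ℤ) : ℂ))) =
    modResponse B ω v * (modResponse H ω i * modResponse A ω u) *
      ∑' m : ℤ, ((stageSum KT P w₁ (samplePoint κ M (n - m) + u * (2 * (M : ℝ))⁻¹) *
          stageSum KR Q w₂ (samplePoint κ M m + (-(i : ℝ) - u) * (2 * (M : ℝ))⁻¹) : ℝ) : ℂ) *
        (exp (I * ω * (m : ℂ)) * exp (I * ω' * ((n - 1 - m : ℤ) : ℂ))) := by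
  -- The receive pulse vanishes outside the window, so the sum extends to all of `ℤ`, where
  -- translation by `i + u` is allowed.
  rw [← tsum_eq_sum (L := SummationFilter.unconditional ℤ) (f := fun m : ℤ =>
      ((stageSum KT P w₁ (samplePoint κ M (n - m - i)) *
          stageSum KR Q w₂ (samplePoint κ M m) : ℝ) : ℂ) *
        (exp (I * ω * (m : ℂ)) * exp (I * ω' * ((n - 1 - m - i : ℤ) : ℂ))))
    (s := Finset.Icc (1 : ℤ) (2 * (M : ℤ) * κ))
    (fun m hm => by rw [stageSum_eq_zero (fun r => hQs r m hm)]; simp),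
    ← (Equiv.subRight (i + u)).tsum_eq, ← tsum_mul_left, ← tsum_mul_left]
  refine tsum_congr fun m => ?_
  simp only [Equiv.subRight_apply]
  have h1 : samplePoint κ M (n - (m - (i + u)) - i) =
      samplePoint κ M (n - m) + u * (2 * (M : ℝ))⁻¹ := by
    rw [← samplePoint_add]; congr 1; ring
  have h2 : samplePoint κ M (m - (i + u)) =
      samplePoint κ M m + (-(i : ℝ) - u) * (2 * (M : ℝ))⁻¹ := by
    rw [show (-(i : ℝ) - u) = ((-(i + u) : ℤ) : ℝ) by push_cast; ring, ← samplePoint_add]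
    congr 1
  have h3 : exp (I * ω * ((m - (i + u) : ℤ) : ℂ)) =
      exp (-(I * ω * i)) * exp (-(I * ω * u)) * exp (I * ω * (m : ℂ)) := by
    rw [← exp_add, ← exp_add]; congr 1; push_cast; ring
  -- The translation cancels the precoder phase at the transmitting frequency `ω'`, while `h3`
  -- supplies the phases of `i` and `u` at `ω`.
  have h4 : exp (-(I * ω' * u)) * exp (I * ω' * ((n - 1 - (m - (i + u)) - i : ℤ) : ℂ)) =
      exp (I * ω' * ((n - 1 - m : ℤ) : ℂ)) := by
    rw [← exp_add]; congr 1; push_cast; ring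
  rw [h1, h2, h3, ← h4]
  simp only [modResponse]
  ring

/-- This weight dominates every delay that occurs and factors over `v`, `i`, `u`, so its powers can
be summed against each set of taps separately. -/
lemma one_le_delayWeight (v i u : ℤ) :
    1 ≤ (1 + |(v : ℝ)|) * ((1 + |(i : ℝ)|) * (1 + |(u : ℝ)|)) := by
  have hv := abs_nonneg (v : ℝ)
  have hi := abs_nonneg (i : ℝ)
  have hu := abs_nonneg (u : ℝ)
  nlinarith [mul_nonneg hi hu, mul_nonneg hv (mul_nonneg hi hu), mul_nonneg hv hi,
    mul_nonneg hv hu]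

lemma abs_delays_le_delayWeight (v i u : ℤ) :
    |(v : ℝ)| ≤ (1 + |(v : ℝ)|) * ((1 + |(i : ℝ)|) * (1 + |(u : ℝ)|)) ∧
    |(u : ℝ)| ≤ (1 + |(v : ℝ)|) * ((1 + |(i : ℝ)|) * (1 + |(u : ℝ)|)) ∧
    |-(i : ℝ) - u| ≤ (1 + |(v : ℝ)|) * ((1 + |(i : ℝ)|) * (1 + |(u : ℝ)|)) := by
  have hv := abs_nonneg (v : ℝ)
  have hi := abs_nonneg (i : ℝ)
  have hu := abs_nonneg (u : ℝ)
  have h : |-(i : ℝ) - u| ≤ |(i : ℝ)| + |(u : ℝ)| := by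
    simpa using abs_sub (-(i : ℝ)) u
  have h1 := mul_nonneg hi hu
  have h2 := mul_nonneg hv h1
  have h3 := mul_nonneg hv hi
  have h4 := mul_nonneg hv hu
  refine ⟨?_, ?_, ?_⟩ <;> nlinarith

/-- Both summands live on windows of `2Mκ` integers, so at most `4κM` differences count, however far
apart the windows lie. -/
lemma norm_tsum_sub_sum_le {κ M : ℕ} {X Y : ℤ → ℂ} {c : ℝ} (N : ℤ)
    (hX : ∀ m, m ∉ Finset.Icc (N - 2 * (M : ℤ) * κ) (N - 1) → X m = 0)
    (hY : ∀ m, m ∉ Finset.Icc (1 : ℤ) (2 * (M : ℤ) * κ) → Y m = 0)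
    (hc : 0 ≤ c) (h : ∀ m, ‖X m - Y m‖ ≤ c) :
    ‖∑' m, X m - ∑ m ∈ Finset.Icc (1 : ℤ) (2 * (M : ℤ) * κ), Y m‖ ≤ 4 * κ * M * c := by
  set s := Finset.Icc (N - 2 * (M : ℤ) * κ) (N - 1) ∪ Finset.Icc (1 : ℤ) (2 * (M : ℤ) * κ) with hs
  have h1 : ∑' m, X m = ∑ m ∈ s, X m :=
    tsum_eq_sum fun m hm => hX m fun h' => hm (Finset.mem_union_left _ h')
  have h2 : ∑ m ∈ Finset.Icc (1 : ℤ) (2 * (M : ℤ) * κ), Y m = ∑ m ∈ s, Y m :=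
    Finset.sum_subset Finset.subset_union_right fun m _ hm => hY m hm
  have hcard : (s.card : ℝ) ≤ 4 * κ * M := by
    have h3 : s.card ≤ (2 * M * κ) + (2 * M * κ) := by
      refine (Finset.card_union_le _ _).trans (le_of_eq ?_)
      rw [Int.card_Icc, Int.card_Icc]
      congr 1
      · rw [show N - 1 + 1 - (N - 2 * (M : ℤ) * κ) = ((2 * M * κ : ℕ) : ℤ) by push_cast; ring]
        exact Int.toNat_natCast _
      · rw [show 2 * (M : ℤ) * κ + 1 - 1 = ((2 * M * κ : ℕ) : ℤ) by push_cast; ring]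
        exact Int.toNat_natCast _
    have h4 : (s.card : ℝ) ≤ ((2 * M * κ + 2 * M * κ : ℕ) : ℝ) := by exact_mod_cast h3
    push_cast at h4
    linarith
  rw [h1, h2, ← Finset.sum_sub_distrib]
  calc ‖∑ m ∈ s, (X m - Y m)‖ ≤ ∑ _m ∈ s, c := norm_sum_le_of_le s fun m _ => h m
    _ = s.card * c := by rw [Finset.sum_const, nsmul_eq_mul]
    _ ≤ 4 * κ * M * c := by gcongr

/-- For every triple of delays the joint Taylor expansion errs by `O(ε ^ D)` times a power of the
delay weight at each of `O(M)` instants. The taps decay fast enough to sum these bounds, and the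
carriers have modulus one, so the estimate is uniform in both frequencies. -/
lemma exists_bound_transferCoeff_sub {KT KR κ L D : ℕ} {P Q : ℕ → ℝ → ℝ} {B H A : ℝ → ℂ} {C : ℝ}
    (hP : ∀ r < L, ∀ y, HasDerivAt (P r) (P (r + 1) y) y) (hPC : ∀ r ≤ L, ∀ y, |P r y| ≤ C)
    (hQ : ∀ r < L, ∀ y, HasDerivAt (Q r) (Q (r + 1) y) y) (hQC : ∀ r ≤ L, ∀ y, |Q r y| ≤ C)
    (hPs : ∀ M : ℕ, 1 ≤ M → ∀ r n, n ∉ Finset.Icc (1 : ℤ) (2 * (M : ℤ) * κ) →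
      P r (samplePoint κ M n) = 0)
    (hQs : ∀ M : ℕ, 1 ≤ M → ∀ r n, n ∉ Finset.Icc (1 : ℤ) (2 * (M : ℤ) * κ) →
      Q r (samplePoint κ M n) = 0)
    (hKT : KT ≤ L) (hKR : KR ≤ L) (hD : D ≤ L)
    (hB : ContDiff ℝ ((KT + KR + 2 * D + 2 : ℕ) : WithTop ℕ∞) B)
    (hBp : Function.Periodic B (2 * Real.pi))
    (hH : ContDiff ℝ ((KT + KR + 2 * D + 2 : ℕ) : WithTop ℕ∞) H)
    (hHp : Function.Periodic H (2 * Real.pi))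
    (hA : ContDiff ℝ ((KT + KR + 2 * D + 2 : ℕ) : WithTop ℕ∞) A)
    (hAp : Function.Periodic A (2 * Real.pi)) :
    ∃ C' : ℝ, 0 ≤ C' ∧ ∀ M : ℕ, 1 ≤ M → ∀ (ω ω' : ℝ) (n : ℤ),
      ‖transferCoeff KT KR κ M (fun r n => P r (samplePoint κ M n))
          (fun r n => Q r (samplePoint κ M n)) B H A ω ω' n -
        ∑ a ∈ Finset.range D, ∑ b ∈ Finset.range D,
          (((2 * (M : ℝ))⁻¹ ^ (a + b) : ℝ) : ℂ) * scalarCoeff KT KR B H A a b ω *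
            flatCoeff κ M (fun n => P a (samplePoint κ M n)) (fun n => Q b (samplePoint κ M n))
              ω ω' n‖ ≤ C' * (M * (2 * (M : ℝ))⁻¹ ^ D) := by
  obtain ⟨C₁, hC₁0, hC₁⟩ := exists_bound_stageSum_mul_stageSum hP hPC hQ hQC hKT hKR hD
  -- The exponent of `τ` in `exists_bound_stageSum_mul_stageSum`; the assumed smoothness `E + 2`
  -- makes the taps summable against it.
  set E := KT + KR + 2 * D with hE
  set wt : (ℝ → ℂ) → ℤ → ℝ := fun F i => (1 + |(i : ℝ)|) ^ E * ‖impulseResponse F i‖ with hwt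
  have hsB : Summable (wt B) := summable_pow_mul_impulseResponse hB hBp
  have hsH : Summable (wt H) := summable_pow_mul_impulseResponse hH hHp
  have hsA : Summable (wt A) := summable_pow_mul_impulseResponse hA hAp
  have hwt0 : ∀ F i, 0 ≤ wt F i := fun F i => by simp only [hwt]; positivity
  have hsHA : Summable fun t : ℤ × ℤ => wt H t.1 * wt A t.2 :=
    hsH.mul_of_nonneg hsA (hwt0 H) (hwt0 A)
  have hsBHA : Summable fun t : ℤ × ℤ × ℤ => wt B t.1 * (wt H t.2.1 * wt A t.2.2) :=
    Summable.mul_of_nonneg (f := wt B) (g := fun t : ℤ × ℤ => wt H t.1 * wt A t.2) hsB hsHA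
      (hwt0 B) (fun t => mul_nonneg (hwt0 H _) (hwt0 A _))
  set S := ∑' t : ℤ × ℤ × ℤ, wt B t.1 * (wt H t.2.1 * wt A t.2.2) with hS
  have hS0 : 0 ≤ S := tsum_nonneg fun t => mul_nonneg (hwt0 B _) (mul_nonneg (hwt0 H _) (hwt0 A _))
  refine ⟨4 * κ * C₁ * S, by positivity, ?_⟩
  intro M hM ω ω' n
  have hM' : (1 : ℝ) ≤ M := by exact_mod_cast hM
  set ε := (2 * (M : ℝ))⁻¹ with hε
  have hε0 : 0 ≤ ε := by positivity
  have hε1 : ε ≤ 1 := inv_le_one_of_one_le₀ (by linarith)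
  set f : ℤ → ℂ := fun m => exp (I * ω * (m : ℂ)) * exp (I * ω' * ((n - 1 - m : ℤ) : ℂ)) with hf
  have hfn : ∀ m, ‖f m‖ = 1 := by
    intro m
    rw [hf]
    simp only
    rw [norm_mul, show I * (ω : ℂ) * (m : ℂ) = I * ((ω * m : ℝ) : ℂ) by push_cast; ring,
      show I * (ω' : ℂ) * ((n - 1 - m : ℤ) : ℂ) = I * ((ω' * (n - 1 - m : ℤ) : ℝ) : ℂ) by
        push_cast; ring, norm_exp_I_mul_ofReal, norm_exp_I_mul_ofReal, mul_one]
  have h1 := hasSum_transferCoeff (KT := KT) (KR := KR) (κ := κ) (M := M) (E := E)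
    (p := fun r n => P r (samplePoint κ M n)) (q := fun r n => Q r (samplePoint κ M n)) (C := C)
    hB hBp hH hHp hA hAp (by omega) (by omega) (fun r hr n => hPC r (by omega) _) ω ω' n
  have h2 : HasSum (fun t : ℤ × ℤ × ℤ => ∑ a ∈ Finset.range D, ∑ b ∈ Finset.range D,
      (((ε ^ (a + b) : ℝ) : ℂ) * (((stagePoly KT a (-(t.2.2 : ℝ)) t.2.2 *
          stagePoly KR b (-(t.1 : ℝ)) (-(t.2.1 : ℝ) - t.2.2) : ℝ) : ℂ) *
        (modResponse B ω t.1 * (modResponse H ω t.2.1 * modResponse A ω t.2.2)))) *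
        flatCoeff κ M (fun n => P a (samplePoint κ M n)) (fun n => Q b (samplePoint κ M n))
              ω ω' n)
      (∑ a ∈ Finset.range D, ∑ b ∈ Finset.range D,
          ((ε ^ (a + b) : ℝ) : ℂ) * scalarCoeff KT KR B H A a b ω *
            flatCoeff κ M (fun n => P a (samplePoint κ M n)) (fun n => Q b (samplePoint κ M n))
              ω ω' n) := by
    refine hasSum_sum fun a ha => hasSum_sum fun b hb => ?_
    have ha' := Finset.mem_range.1 ha
    have hb' := Finset.mem_range.1 hb
    exact ((hasSum_scalarCoeff hB hBp hH hHp hA hAp (by omega) ω).mul_left _).mul_right _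
  have h3 := h1.sub h2
  rw [← h3.tsum_eq]
  refine tsum_of_norm_bounded (hsBHA.hasSum.mul_left (4 * κ * M * (C₁ * ε ^ D))) ?_ |>.trans
    (le_of_eq (by rw [← hS]; ring))
  rintro ⟨v, i, u⟩
  simp only
  have hshift := sum_stageSum_shift (KT := KT) (KR := KR) (P := P) (Q := Q) (hQs M hM) B H A ω ω' n
    v i u (-(u : ℝ) * ε) (-(v : ℝ) * ε)
  simp only [stageSum] at hshift
  rw [hshift]
  set τ := (1 + |(v : ℝ)|) * ((1 + |(i : ℝ)|) * (1 + |(u : ℝ)|)) with hτ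
  have hτ1 : 1 ≤ τ := one_le_delayWeight v i u
  obtain ⟨hv, hu, hiu⟩ := abs_delays_le_delayWeight v i u
  rw [← hτ] at hv hu hiu
  -- By homogeneity of `stagePoly` the powers of `ε` move inside, which turns the claimed main term
  -- into the Taylor polynomial at the scaled delays.
  have hmain : ∑ a ∈ Finset.range D, ∑ b ∈ Finset.range D,
      (((ε ^ (a + b) : ℝ) : ℂ) * (((stagePoly KT a (-(u : ℝ)) u *
          stagePoly KR b (-(v : ℝ)) (-(i : ℝ) - u) : ℝ) : ℂ) *
        (modResponse B ω v * (modResponse H ω i * modResponse A ω u)))) *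
        flatCoeff κ M (fun n => P a (samplePoint κ M n)) (fun n => Q b (samplePoint κ M n)) ω ω' n =
      modResponse B ω v * (modResponse H ω i * modResponse A ω u) *
        ∑ m ∈ Finset.Icc (1 : ℤ) (2 * (M : ℤ) * κ),
          ((∑ a ∈ Finset.range D, ∑ b ∈ Finset.range D,
            stagePoly KT a (-(u : ℝ) * ε) (u * ε) *
            stagePoly KR b (-(v : ℝ) * ε) ((-(i : ℝ) - u) * ε) *
            (P a (samplePoint κ M (n - m)) * Q b (samplePoint κ M m)) : ℝ) : ℂ) * f m := by
    simp only [flatCoeff, stagePoly_smul]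
    push_cast
    simp only [Finset.mul_sum, Finset.sum_mul]
    conv_rhs => rw [Finset.sum_comm]
    refine Finset.sum_congr rfl fun a _ => ?_
    rw [Finset.sum_comm]
    refine Finset.sum_congr rfl fun m _ => Finset.sum_congr rfl fun b _ => ?_
    rw [hf, pow_add]
    push_cast
    ring
  rw [hmain, ← mul_sub, norm_mul, norm_mul, norm_mul, norm_modResponse, norm_modResponse,
    norm_modResponse]
  have hbound := norm_tsum_sub_sum_le (κ := κ) (M := M) (X := fun m : ℤ =>
      ((stageSum KT P (-(u : ℝ) * ε) (samplePoint κ M (n - m) + u * ε) *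
          stageSum KR Q (-(v : ℝ) * ε) (samplePoint κ M m + (-(i : ℝ) - u) * ε) : ℝ) : ℂ) * f m)
    (Y := fun m => ((∑ a ∈ Finset.range D, ∑ b ∈ Finset.range D,
            stagePoly KT a (-(u : ℝ) * ε) (u * ε) *
            stagePoly KR b (-(v : ℝ) * ε) ((-(i : ℝ) - u) * ε) *
            (P a (samplePoint κ M (n - m)) * Q b (samplePoint κ M m)) : ℝ) : ℂ) * f m)
    (c := C₁ * (ε ^ D * τ ^ E)) (n + u) ?_ ?_ (by positivity) ?_
  · calc ‖impulseResponse B v‖ * (‖impulseResponse H i‖ * ‖impulseResponse A u‖) * _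
        ≤ ‖impulseResponse B v‖ * (‖impulseResponse H i‖ * ‖impulseResponse A u‖) *
          (4 * κ * M * (C₁ * (ε ^ D * τ ^ E))) := by
          gcongr
          exact hbound
      _ = 4 * κ * M * (C₁ * ε ^ D) * (wt B v * (wt H i * wt A u)) := by
          simp only [hwt, hτ, mul_pow]; ring
  -- The precoder delay moves the window of the transmit pulse by `u`.
  · intro m hm
    have hzero : ∀ r, P r (samplePoint κ M (n - m) + u * ε) = 0 := by
      intro r
      rw [hε, ← samplePoint_add]
      refine hPs M hM r _ ?_
      rw [Finset.mem_Icc] at hm ⊢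
      omega
    rw [stageSum_eq_zero hzero]
    simp
  · intro m hm
    have hzero : ∀ r, Q r (samplePoint κ M m) = 0 := fun r => hQs M hM r m hm
    simp [hzero]
  · intro m
    rw [← sub_mul, norm_mul, hfn, mul_one, ← ofReal_sub, Complex.norm_real]
    refine hC₁ ε τ _ _ _ _ hε0 hε1 hτ1 ?_ ?_ ?_ ?_ _ _
    all_goals rw [abs_mul, abs_of_nonneg hε0, mul_comm]
    · rw [abs_neg]; gcongr
    · gcongr
    · rw [abs_neg]; gcongr
    · gcongr

/-! ### The received samples as linear functions of the transmitted symbols -/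

lemma iteratedDeriv_fun_star (F : ℝ → ℂ) (r : ℕ) (x : ℝ) :
    iteratedDeriv r (fun y => star (F y)) x = star (iteratedDeriv r F x) := by
  induction r generalizing x with
  | zero => simp
  | succ r ih =>
    rw [iteratedDeriv_succ, iteratedDeriv_succ, funext ih]
    exact deriv.star

lemma pulseSample_eq_zero {Ts : ℝ} {κ M : ℕ} {g : ℝ → ℝ} {r : ℕ} {n : ℤ}
    (h : n ∉ Finset.Icc (1 : ℤ) (2 * (M : ℤ) * κ)) : pulseSample Ts κ M g r n = 0 :=
  if_neg fun h' => h (Finset.mem_Icc.2 h')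

/-- The time index `M (j - c) + 1` attached to the input column `c` and the output column `j`. -/
def lagTime {N : ℕ} (M : ℕ) (j : ℤ) (c : Fin N × Fin 2) : ℤ :=
  (M : ℤ) * (j - (2 * ((c.1 : ℕ) : ℤ) + ((c.2 : ℕ) : ℤ))) + 1

/-- Only the difference between output and input column enters, through `lagTime`; this makes the
later sums over columns sums over lags. -/
lemma receivedSISO_eq_sum {κ M N : ℕ} (hM : 1 ≤ M) {g h : ℤ → ℝ}
    (hg : ∀ n, n ∉ Finset.Icc (1 : ℤ) (2 * (M : ℤ) * κ) → g n = 0) (F X : ℝ → ℂ)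
    (S : Matrix (Fin (2 * M)) (Fin N × Fin 2) ℂ) (k : Fin (2 * M)) (j : ℤ) :
    receivedSISO κ g h F (Lam M X * S) k j =
      ∑ k' : Fin (2 * M), ∑ c : Fin N × Fin 2, S k' c *
        (phase M k * star (phase M k') / (M : ℂ) * (X (freq M k') *
          ∑ m ∈ Finset.Icc (1 : ℤ) (2 * (M : ℤ) * κ), (h m : ℂ) * exp (I * freq M k * (m : ℂ)) *
            ∑' i : ℤ, impulseResponse F i * ((g (lagTime M j c - m - i) : ℂ) *
              exp (I * freq M k' * ((lagTime M j c - 1 - m - i : ℤ) : ℂ))))) := by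
  have hsq : (1 / (Real.sqrt (2 * (M : ℝ)) : ℂ)) * (1 / (Real.sqrt (2 * (M : ℝ)) : ℂ)) =
      1 / (2 * (M : ℂ)) := by
    rw [div_mul_div_comm, one_mul, ← ofReal_mul, Real.mul_self_sqrt (by positivity)]
    push_cast; ring
  have hsum : ∀ (m : ℤ) (k' : Fin (2 * M)) (c : Fin N × Fin 2), Summable fun i : ℤ =>
      impulseResponse F i * ((g (lagTime M j c - m - i) : ℂ) *
              exp (I * freq M k' * ((lagTime M j c - 1 - m - i : ℤ) : ℂ))) := by
    intro m k' c
    -- The pulse is finitely supported, so the channel sum is finite and no decay of the impulse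
    -- response of `F` is needed here.
    refine summable_of_ne_finset_zero (s := Finset.Icc (lagTime M j c - m - 2 * (M : ℤ) * κ)
      (lagTime M j c - m - 1)) fun i hi => ?_
    rw [hg _ (by rw [Finset.mem_Icc] at hi ⊢; omega)]
    simp
  have hch : ∀ m : ℤ, channel F (modulate g (Lam M X * S)) ((M : ℤ) * j + 1 - m) =
      (1 / (Real.sqrt (2 * (M : ℝ)) : ℂ)) * ∑ k' : Fin (2 * M), ∑ c : Fin N × Fin 2,
        star (phase M k') * (X (freq M k') * S k' c) *
        ∑' i : ℤ, impulseResponse F i * ((g (lagTime M j c - m - i) : ℂ) *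
              exp (I * freq M k' * ((lagTime M j c - 1 - m - i : ℤ) : ℂ))) := by
    intro m
    have h := (hasSum_sum (s := (Finset.univ : Finset (Fin (2 * M)))) fun k' _ =>
      hasSum_sum (s := (Finset.univ : Finset (Fin N × Fin 2))) fun c _ =>
        (hsum m k' c).hasSum.mul_left (star (phase M k') * (X (freq M k') * S k' c))).mul_left
      (1 / (Real.sqrt (2 * (M : ℝ)) : ℂ))
    rw [← h.tsum_eq, channel]
    refine tsum_congr fun i => ?_
    rw [modulate]
    simp only [Finset.mul_sum, Lam, Matrix.diagonal_mul]
    refine Finset.sum_congr rfl fun k' _ => Finset.sum_congr rfl fun c _ => ?_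
    rw [show (M : ℤ) * j + 1 - m - i - (M : ℤ) * (2 * ((c.1 : ℕ) : ℤ) + ((c.2 : ℕ) : ℤ)) =
      lagTime M j c - m - i by rw [lagTime]; ring,
      show lagTime M j c - m - i - 1 = lagTime M j c - 1 - m - i by ring]
    ring
  rw [receivedSISO, demodulate]
  simp only [hch]
  -- The two filterbank normalizations and the receiver gain `2` combine to `1 / M`.
  have h2 : (2 : ℂ) * (1 / (Real.sqrt (2 * (M : ℝ)) : ℂ)) * (1 / (Real.sqrt (2 * (M : ℝ)) : ℂ)) =
      1 / (M : ℂ) := by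
    rw [mul_assoc, hsq]
    have : (M : ℂ) ≠ 0 := by exact_mod_cast (by omega : M ≠ 0)
    field_simp
  simp only [Finset.mul_sum]
  rw [Finset.sum_comm]
  refine Finset.sum_congr rfl fun k' _ => ?_
  rw [Finset.sum_comm]
  refine Finset.sum_congr rfl fun c _ => Finset.sum_congr rfl fun m _ => ?_
  rw [div_eq_mul_one_div _ (M : ℂ), ← h2]
  ring

lemma sum_sum_sum_comm {α β γ R : Type*} [AddCommMonoid R] (s : Finset α) (t : Finset β)
    (r : Finset γ) (f : α → β → γ → R) :
    ∑ a ∈ s, ∑ b ∈ t, ∑ x ∈ r, f a b x = ∑ x ∈ r, ∑ a ∈ s, ∑ b ∈ t, f a b x := by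
  rw [Finset.sum_comm (s := r)]
  exact Finset.sum_congr rfl fun a _ => Finset.sum_comm

namespace Transceiver

variable {NT NR NS : ℕ} (T : Transceiver NT NR NS)

/-- The coefficient of a transmitted symbol of stream `nS` on subcarrier `k'` in the received
samples of stream `n` on subcarrier `k`. -/
def symbolCoeff (M : ℕ) (n nS : Fin NS) (k k' : Fin (2 * M)) (t : ℤ) : ℂ :=
  phase M k * star (phase M k') / (M : ℂ) * ∑ nR : Fin NR, ∑ nT : Fin NT,
    transferCoeff T.KT T.KR T.κ M (T.pS M) (T.qS M) (fun ω => star (T.B ω nR n))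
      (fun ω => T.H ω nR nT) (fun ω => T.A ω nT nS) (freq M k) (freq M k') t

lemma received_eq_sum {M N : ℕ} (hM : 1 ≤ M)
    (S : Fin NS → Matrix (Fin (2 * M)) (Fin N × Fin 2) ℂ) (n : Fin NS) (k : Fin (2 * M)) (j : ℤ) :
    T.received S n k j = ∑ nS : Fin NS, ∑ k' : Fin (2 * M), ∑ c : Fin N × Fin 2,
      S nS k' c * T.symbolCoeff M n nS k k' (lagTime M j c) := by
  have hp : ∀ r n, n ∉ Finset.Icc (1 : ℤ) (2 * (M : ℤ) * T.κ) → T.pS M r n = 0 :=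
    fun r n h => pulseSample_eq_zero h
  rw [received]
  simp only [receivedStage, receivedSISO_eq_sum hM (hp _), symbolCoeff, transferCoeff, matDeriv,
    Matrix.of_apply, iteratedDeriv_fun_star]
  generalize hG : (fun (ℓ₁ ℓ₂ : ℕ) (nR : Fin NR) (nT : Fin NT) (k' : Fin (2 * M))
    (c : Fin N × Fin 2) => ∑ m ∈ Finset.Icc (1 : ℤ) (2 * (M : ℤ) * T.κ),
      (T.qS M ℓ₂ m : ℂ) * exp (I * freq M k * (m : ℂ)) *
            ∑' i : ℤ, impulseResponse (fun ω => T.H ω nR nT) i *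
              ((T.pS M ℓ₁ (lagTime M j c - m - i) : ℂ) *
              exp (I * freq M k' * ((lagTime M j c - 1 - m - i : ℤ) : ℂ)))) = G
  have hG' : ∀ ℓ₁ ℓ₂ nR nT k' c, ∑ m ∈ Finset.Icc (1 : ℤ) (2 * (M : ℤ) * T.κ),
      (T.qS M ℓ₂ m : ℂ) * exp (I * freq M k * (m : ℂ)) *
            ∑' i : ℤ, impulseResponse (fun ω => T.H ω nR nT) i *
              ((T.pS M ℓ₁ (lagTime M j c - m - i) : ℂ) *
              exp (I * freq M k' * ((lagTime M j c - 1 - m - i : ℤ) : ℂ))) =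
      G ℓ₁ ℓ₂ nR nT k' c := by
    intro ℓ₁ ℓ₂ nR nT k' c; rw [← hG]
  simp only [hG', Finset.mul_sum]
  rw [sum_sum_sum_comm]
  refine Finset.sum_congr rfl fun nS _ => ?_
  rw [sum_sum_sum_comm]
  simp only [sum_sum_sum_comm (Finset.range T.KT) (Finset.range T.KR)]
  rw [sum_sum_sum_comm]
  refine Finset.sum_congr rfl fun k' _ => ?_
  rw [sum_sum_sum_comm]
  refine Finset.sum_congr rfl fun c _ => Finset.sum_congr rfl fun nR _ =>
    Finset.sum_congr rfl fun nT _ => Finset.sum_congr rfl fun ℓ₁ _ =>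
    Finset.sum_congr rfl fun ℓ₂ _ => ?_
  ring

end Transceiver

/-! ### Parseval identities over the subcarriers -/

/-- A geometric sum of `2M`-th roots of unity. The integer offset `c` contributes a constant phase,
which is `1` in the divisible case and harmless otherwise. -/
lemma sum_exp_subcarriers {M : ℕ} (hM : 1 ≤ M) (x c : ℤ) :
    ∑ k : Fin (2 * M), exp (I * ((Real.pi * x * (((k : ℕ) : ℝ) - c) / M : ℝ) : ℂ)) =
      if (2 * (M : ℤ)) ∣ x then 2 * (M : ℂ) else 0 := by
  have hM0 : (M : ℂ) ≠ 0 := by exact_mod_cast (by omega : M ≠ 0)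
  have hpi : (Real.pi : ℂ) ≠ 0 := by exact_mod_cast Real.pi_ne_zero
  set ζ : ℂ := exp (I * (Real.pi * x / M)) with hζ
  have hterm : ∀ k : ℕ, exp (I * ((Real.pi * x * ((k : ℝ) - c) / M : ℝ) : ℂ)) =
      exp (-(I * (Real.pi * x * c / M))) * ζ ^ k := by
    intro k
    rw [hζ, ← exp_nat_mul, ← exp_add]
    congr 1
    push_cast
    ring
  split_ifs with hdvd
  · obtain ⟨y, rfl⟩ := hdvd
    have h1 : ∀ k : Fin (2 * M),
        exp (I * ((Real.pi * ((2 * (M : ℤ) * y : ℤ) : ℝ) * (((k : ℕ) : ℝ) - c) / M : ℝ) : ℂ)) = 1 := by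
      intro k
      rw [exp_eq_one_iff]
      refine ⟨y * (((k : ℕ) : ℤ) - c), ?_⟩
      push_cast
      field_simp
    rw [Finset.sum_congr rfl fun k _ => h1 k]
    simp
  · have hζ1 : ζ ≠ 1 := by
      intro h
      rw [hζ, exp_eq_one_iff] at h
      obtain ⟨y, hy⟩ := h
      refine hdvd ⟨y, ?_⟩
      have h2 : (x : ℂ) = 2 * M * y := by
        have hI := I_ne_zero
        field_simp at hy
        linear_combination hy
      exact_mod_cast h2
    have hζM : ζ ^ (2 * M) = 1 := by
      rw [hζ, ← exp_nat_mul, exp_eq_one_iff]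
      refine ⟨x, ?_⟩
      push_cast
      field_simp
    rw [Finset.sum_congr rfl fun (k : Fin (2 * M)) _ => hterm (k : ℕ), ← Finset.mul_sum,
      Fin.sum_univ_eq_sum_range (fun k => ζ ^ k) (2 * M), geom_sum_eq hζ1, hζM]
    simp

/-- The phase with which the `i`-th polyphase component of the pulses couples the subcarriers
`k'` and `k`. -/
def chirp (M : ℕ) (k k' : Fin (2 * M)) (i : Fin (2 * M)) : ℂ :=
  exp (I * ((Real.pi * (((k' : ℕ) : ℝ) - ((k : ℕ) : ℝ)) * (2 * ((i : ℕ) : ℝ) + M + 1) / (2 * M) :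
    ℝ) : ℂ))

/-- The phases differ by `π (k' - k) (i - i') / M`, and `|i - i'| < 2M`. -/
lemma sum_chirp_mul_conj {M : ℕ} (hM : 1 ≤ M) (k i i' : Fin (2 * M)) :
    ∑ k', chirp M k k' i * star (chirp M k k' i') = if i = i' then 2 * (M : ℂ) else 0 := by
  have hM0 : (M : ℝ) ≠ 0 := by exact_mod_cast (by omega : M ≠ 0)
  have h := sum_exp_subcarriers hM (((i : ℕ) : ℤ) - ((i' : ℕ) : ℤ)) ((k : ℕ) : ℤ)
  have hiff : (2 * (M : ℤ)) ∣ (((i : ℕ) : ℤ) - ((i' : ℕ) : ℤ)) ↔ i = i' := by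
    constructor
    · intro h
      have h1 := i.2
      have h2 := i'.2
      have h3 := Int.eq_zero_of_abs_lt_dvd h (by rw [abs_lt]; constructor <;> omega)
      exact Fin.ext (by omega)
    · rintro rfl; simp
  simp only [hiff] at h
  rw [← h]
  refine Finset.sum_congr rfl fun k' _ => ?_
  rw [chirp, chirp, star_def, ← exp_conj, ← exp_add]
  congr 1
  rw [map_mul, conj_I, conj_ofReal, ← sub_eq_zero]
  push_cast
  have : (M : ℂ) ≠ 0 := by exact_mod_cast hM0
  field_simp
  ring

/-- Without conjugation the phases add, and what survives is the pairing `i + i' + 1 ≡ M` modulo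
`2M`: the reflection inside each half of the polyphase components, i.e. `I₂ ⊗ J_M`. -/
lemma sum_chirp_mul {M : ℕ} (hM : 1 ≤ M) (k i i' : Fin (2 * M)) :
    ∑ k', chirp M k k' i * chirp M k k' i' =
      if (2 * (M : ℤ)) ∣ ((i : ℕ) : ℤ) + ((i' : ℕ) : ℤ) + M + 1 then 2 * (M : ℂ) else 0 := by
  rw [← sum_exp_subcarriers hM (((i : ℕ) : ℤ) + ((i' : ℕ) : ℤ) + M + 1) ((k : ℕ) : ℤ)]
  refine Finset.sum_congr rfl fun k' _ => ?_
  rw [chirp, chirp, ← exp_add]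
  congr 1
  have : (M : ℂ) ≠ 0 := by exact_mod_cast (by omega : M ≠ 0)
  push_cast
  field_simp
  ring

/-- Orthogonality in the other index: a pulse product with constant polyphase components reaches
only its own subcarrier. The subtraction of `1/2` in `RR0` relies on this. -/
lemma sum_chirp {M : ℕ} (hM : 1 ≤ M) (k k' : Fin (2 * M)) :
    ∑ i, chirp M k k' i = if k' = k then 2 * (M : ℂ) else 0 := by
  have hM0 : (M : ℂ) ≠ 0 := by exact_mod_cast (by omega : M ≠ 0)
  have h := sum_exp_subcarriers hM (((k' : ℕ) : ℤ) - ((k : ℕ) : ℤ)) 0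
  have hiff : (2 * (M : ℤ)) ∣ (((k' : ℕ) : ℤ) - ((k : ℕ) : ℤ)) ↔ k' = k := by
    constructor
    · intro h
      have h1 := k.2
      have h2 := k'.2
      have h3 := Int.eq_zero_of_abs_lt_dvd h (by rw [abs_lt]; constructor <;> omega)
      exact Fin.ext (by omega)
    · rintro rfl; simp
  simp only [hiff] at h
  have hfac : ∀ i, chirp M k k' i =
      exp (I * ((Real.pi * (((k' : ℕ) : ℝ) - ((k : ℕ) : ℝ)) * (M + 1) / (2 * M) : ℝ) : ℂ)) *
      exp (I * ((Real.pi * ((((k' : ℕ) : ℤ) - ((k : ℕ) : ℤ) : ℤ) : ℝ) *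
        (((i : ℕ) : ℝ) - (0 : ℤ)) / M : ℝ) : ℂ)) := by
    intro i
    rw [chirp, ← exp_add]
    congr 1
    push_cast
    field_simp
    ring
  rw [Finset.sum_congr rfl fun i _ => hfac i, ← Finset.mul_sum, h]
  split_ifs with hk
  · subst hk; simp
  · simp

/-- The reflection of the polyphase components in the matrices `U⁺` and `U⁻`. -/
def reflMat (M : ℕ) : Matrix (Fin (2 * M)) (Fin (2 * M)) ℝ := kron M 1 (antiId M)

lemma reflMat_apply {M : ℕ} (i i' : Fin (2 * M)) :
    reflMat M i i' =
      if (2 * (M : ℤ)) ∣ ((i : ℕ) : ℤ) + ((i' : ℕ) : ℤ) + M + 1 then 1 else 0 := by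
  obtain ⟨⟨x, y⟩, rfl⟩ := finProdFinEquiv.surjective i
  obtain ⟨⟨x', y'⟩, rfl⟩ := finProdFinEquiv.surjective i'
  have hy := y.2
  have hy' := y'.2
  rw [reflMat, kron, Matrix.reindex_apply, Matrix.submatrix_apply, Equiv.symm_apply_apply,
    Equiv.symm_apply_apply, Matrix.kroneckerMap_apply, antiId, Matrix.of_apply]
  simp only [finProdFinEquiv_apply_val, Matrix.one_apply]
  have key : (x = x' ∧ (y : ℕ) + (y' : ℕ) + 1 = M) ↔ (2 * (M : ℤ)) ∣
      (((y : ℕ) + M * (x : ℕ) : ℕ) : ℤ) + (((y' : ℕ) + M * (x' : ℕ) : ℕ) : ℤ) + M + 1 := by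
    -- Here `0 < s < 2M`. The divisibility concerns `s + M` or `s + 3M` inside one half and `s + 2M`
    -- across the halves, and the last case is impossible.
    set s : ℤ := ((y : ℕ) : ℤ) + ((y' : ℕ) : ℤ) + 1 with hs
    have hmid : 2 * (M : ℤ) ∣ s + M ↔ (y : ℕ) + (y' : ℕ) + 1 = M := by
      constructor
      · intro h
        have h1 : 2 * (M : ℤ) ∣ s - M := by
          have := dvd_sub_self_right.2 h
          rwa [show s + (M : ℤ) - 2 * M = s - M by ring] at this
        have := Int.eq_zero_of_abs_lt_dvd h1 (by rw [abs_lt]; constructor <;> omega)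
        omega
      · intro h
        exact ⟨1, by omega⟩
    have hno : ¬ 2 * (M : ℤ) ∣ s := fun h => by
      have := Int.eq_zero_of_abs_lt_dvd h (by rw [abs_lt]; constructor <;> omega)
      omega
    fin_cases x <;> fin_cases x'
    · rw [← hmid]
      simp [hs, add_right_comm]
    · have : (((y : ℕ) + M * 0 : ℕ) : ℤ) + (((y' : ℕ) + M * 1 : ℕ) : ℤ) + M + 1 =
          s + 2 * M := by push_cast; ring
      simp only [Fin.zero_eta, Fin.mk_one, zero_ne_one, false_and, false_iff]
      change ¬ _ ∣ (((y : ℕ) + M * 0 : ℕ) : ℤ) + (((y' : ℕ) + M * 1 : ℕ) : ℤ) + M + 1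
      rwa [this, dvd_add_self_right]
    · have : (((y : ℕ) + M * 1 : ℕ) : ℤ) + (((y' : ℕ) + M * 0 : ℕ) : ℤ) + M + 1 =
          s + 2 * M := by push_cast; ring
      simp only [Fin.zero_eta, Fin.mk_one, one_ne_zero, false_and, false_iff]
      change ¬ _ ∣ (((y : ℕ) + M * 1 : ℕ) : ℤ) + (((y' : ℕ) + M * 0 : ℕ) : ℤ) + M + 1
      rwa [this, dvd_add_self_right]
    · have : (((y : ℕ) + M * 1 : ℕ) : ℤ) + (((y' : ℕ) + M * 1 : ℕ) : ℤ) + M + 1 =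
          s + M + 2 * M := by push_cast; ring
      simp only [Fin.mk_one, true_and]
      change _ ↔ _ ∣ (((y : ℕ) + M * 1 : ℕ) : ℤ) + (((y' : ℕ) + M * 1 : ℕ) : ℤ) + M + 1
      rw [this, dvd_add_self_right, hmid]
  by_cases h1 : x = x' <;> by_cases h2 : (y : ℕ) + (y' : ℕ) + 1 = M
  · rw [if_pos h1, if_pos h2, if_pos (key.1 ⟨h1, h2⟩), mul_one]
  · rw [if_neg h2, if_neg (fun h => h2 (key.2 h).2), mul_zero]
  · rw [if_neg h1, if_neg (fun h => h1 (key.2 h).1), zero_mul]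
  · rw [if_neg h1, if_neg (fun h => h1 (key.2 h).1), zero_mul]

lemma kron_one_one (M : ℕ) : kron M 1 1 = 1 := by
  rw [kron, Matrix.one_kronecker_one, Matrix.reindex_apply, Matrix.submatrix_one_equiv]

lemma Uplus_eq (M : ℕ) : Uplus M = 1 + reflMat M := by
  rw [Uplus, reflMat, ← kron_one_one, kron, kron, kron, Matrix.kronecker_add]; rfl

lemma Uminus_eq (M : ℕ) : Uminus M = 1 - reflMat M := by
  rw [Uminus, reflMat, ← kron_one_one]
  ext i j
  simp only [kron, Matrix.reindex_apply, Matrix.submatrix_apply, Matrix.sub_apply,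
    Matrix.kroneckerMap_apply, mul_sub]

lemma reflMat_symm {M : ℕ} (i i' : Fin (2 * M)) : reflMat M i i' = reflMat M i' i := by
  rw [reflMat_apply, reflMat_apply, add_comm ((i : ℕ) : ℤ)]

lemma Uplus_symm {M : ℕ} (i i' : Fin (2 * M)) : Uplus M i i' = Uplus M i' i := by
  rw [Uplus_eq, Matrix.add_apply, Matrix.add_apply, reflMat_symm, Matrix.one_apply,
    Matrix.one_apply]
  simp only [eq_comm]

lemma Uminus_symm {M : ℕ} (i i' : Fin (2 * M)) : Uminus M i i' = Uminus M i' i := by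
  rw [Uminus_eq, Matrix.sub_apply, Matrix.sub_apply, reflMat_symm, Matrix.one_apply,
    Matrix.one_apply]
  simp only [eq_comm]

/-- The bilinear form of a square matrix. -/
def bilin {ι : Type*} [Fintype ι] (U : Matrix ι ι ℝ) (a b : ι → ℝ) : ℝ :=
  ∑ i, ∑ i', a i * b i' * U i i'

/-- The combination of the polyphase components `a` received on subcarrier `k` from `k'`. -/
def chirpSum (M : ℕ) (k k' : Fin (2 * M)) (a : Fin (2 * M) → ℝ) : ℂ :=
  ∑ i, (a i : ℂ) * chirp M k k' i

lemma sum_chirpSum_mul_conj {M : ℕ} (hM : 1 ≤ M) (k : Fin (2 * M)) (a b : Fin (2 * M) → ℝ) :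
    ∑ k', chirpSum M k k' a * star (chirpSum M k k' b) = ((2 * M * bilin 1 a b : ℝ) : ℂ) := by
  simp only [chirpSum, star_sum, Finset.sum_mul_sum]
  rw [← sum_sum_sum_comm]
  have h : ∀ i i', ∑ k', (a i : ℂ) * chirp M k k' i * star ((b i' : ℂ) * chirp M k k' i') =
      ((a i * b i' : ℝ) : ℂ) * if i = i' then 2 * (M : ℂ) else 0 := by
    intro i i'
    rw [← sum_chirp_mul_conj hM k i i', Finset.mul_sum]
    refine Finset.sum_congr rfl fun k' _ => ?_
    rw [star_mul', star_def, conj_ofReal]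
    push_cast; ring
  simp only [h, bilin, Matrix.one_apply]
  push_cast
  simp only [Finset.mul_sum]
  refine Finset.sum_congr rfl fun i _ => Finset.sum_congr rfl fun i' _ => ?_
  split_ifs <;> simp; ring

lemma sum_chirpSum_mul {M : ℕ} (hM : 1 ≤ M) (k : Fin (2 * M)) (a b : Fin (2 * M) → ℝ) :
    ∑ k', chirpSum M k k' a * chirpSum M k k' b = ((2 * M * bilin (reflMat M) a b : ℝ) : ℂ) := by
  simp only [chirpSum, Finset.sum_mul_sum]
  rw [← sum_sum_sum_comm]
  have h : ∀ i i', ∑ k', (a i : ℂ) * chirp M k k' i * ((b i' : ℂ) * chirp M k k' i') =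
      ((a i * b i' : ℝ) : ℂ) *
      if (2 * (M : ℤ)) ∣ ((i : ℕ) : ℤ) + ((i' : ℕ) : ℤ) + M + 1 then 2 * (M : ℂ) else 0 := by
    intro i i'
    rw [← sum_chirp_mul hM k i i', Finset.mul_sum]
    refine Finset.sum_congr rfl fun k' _ => ?_
    push_cast; ring
  simp only [h, bilin, reflMat_apply]
  push_cast
  simp only [Finset.mul_sum]
  refine Finset.sum_congr rfl fun i _ => Finset.sum_congr rfl fun i' _ => ?_
  split_ifs <;> simp; ring

lemma bilin_Uplus {M : ℕ} (a b : Fin (2 * M) → ℝ) :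
    bilin (Uplus M) a b = bilin 1 a b + bilin (reflMat M) a b := by
  simp only [bilin, Uplus_eq, Matrix.add_apply, mul_add, Finset.sum_add_distrib]

lemma bilin_Uminus {M : ℕ} (a b : Fin (2 * M) → ℝ) :
    bilin (Uminus M) a b = bilin 1 a b - bilin (reflMat M) a b := by
  simp only [bilin, Uminus_eq, Matrix.sub_apply, mul_sub, Finset.sum_sub_distrib]

/-- Polarization: `Re z Re w` is half the real part of `z w̄ + z w`. The conjugated product gives
the identity and the plain product the reflection, hence `U⁺`; for imaginary parts the sign of the
latter changes, hence `U⁻`. -/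
lemma sum_re_mul_re {M : ℕ} (hM : 1 ≤ M) (k : Fin (2 * M)) (a b : Fin (2 * M) → ℝ) :
    ∑ k', (chirpSum M k k' a).re * (chirpSum M k k' b).re = M * bilin (Uplus M) a b := by
  have h1 := congrArg re (sum_chirpSum_mul_conj hM k a b)
  have h2 := congrArg re (sum_chirpSum_mul hM k a b)
  rw [re_sum, ofReal_re] at h1 h2
  rw [bilin_Uplus]
  have h3 : ∑ k', (chirpSum M k k' a).re * (chirpSum M k k' b).re =
      (1 / 2) * ((∑ k', (chirpSum M k k' a * star (chirpSum M k k' b)).re) +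
        ∑ k', (chirpSum M k k' a * chirpSum M k k' b).re) := by
    rw [← Finset.sum_add_distrib, Finset.mul_sum]
    refine Finset.sum_congr rfl fun k' _ => ?_
    simp only [mul_re, star_def, conj_re, conj_im]; ring
  rw [h3, h1, h2]; ring

lemma sum_im_mul_im {M : ℕ} (hM : 1 ≤ M) (k : Fin (2 * M)) (a b : Fin (2 * M) → ℝ) :
    ∑ k', (chirpSum M k k' a).im * (chirpSum M k k' b).im = M * bilin (Uminus M) a b := by
  have h1 := congrArg re (sum_chirpSum_mul_conj hM k a b)
  have h2 := congrArg re (sum_chirpSum_mul hM k a b)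
  rw [re_sum, ofReal_re] at h1 h2
  rw [bilin_Uminus]
  have h3 : ∑ k', (chirpSum M k k' a).im * (chirpSum M k k' b).im =
      (1 / 2) * ((∑ k', (chirpSum M k k' a * star (chirpSum M k k' b)).re) -
        ∑ k', (chirpSum M k k' a * chirpSum M k k' b).re) := by
    rw [← Finset.sum_sub_distrib, Finset.mul_sum]
    refine Finset.sum_congr rfl fun k' _ => ?_
    simp only [mul_re, star_def, conj_re, conj_im]; ring
  rw [h3, h1, h2]; ring

/-- Both Parseval sums are real, so the mixed products cancel over the subcarriers. The real and
imaginary parts of the expansion coefficients therefore never mix. -/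
lemma sum_re_mul_im {M : ℕ} (hM : 1 ≤ M) (k : Fin (2 * M)) (a b : Fin (2 * M) → ℝ) :
    ∑ k', (chirpSum M k k' a).re * (chirpSum M k k' b).im = 0 := by
  have h1 := congrArg im (sum_chirpSum_mul_conj hM k a b)
  have h2 := congrArg im (sum_chirpSum_mul hM k a b)
  rw [im_sum, ofReal_im] at h1 h2
  have h3 : ∑ k', (chirpSum M k k' a).re * (chirpSum M k k' b).im =
      (1 / 2) * ((∑ k', (chirpSum M k k' a * chirpSum M k k' b).im) -
        ∑ k', (chirpSum M k k' a * star (chirpSum M k k' b)).im) := by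
    rw [← Finset.sum_sub_distrib, Finset.mul_sum]
    refine Finset.sum_congr rfl fun k' _ => ?_
    simp only [mul_im, star_def, conj_re, conj_im]; ring
  rw [h3, h1, h2]; ring

/-! ### Folded pulses -/

/-- The sum of the products of pulse samples with lag `M d + 1` that share the polyphase
index `i`. -/
def foldedPulse (κ M : ℕ) (p q : ℤ → ℝ) (d : ℤ) (i : Fin (2 * M)) : ℝ :=
  ∑ v : Fin κ, p ((M : ℤ) * d + 1 - (2 * (M : ℤ) * ((v : ℕ) : ℤ) + 2 * M - ((i : ℕ) : ℤ))) *
    q (2 * (M : ℤ) * ((v : ℕ) : ℤ) + 2 * M - ((i : ℕ) : ℤ))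

/-- Each index is written as `2Mv + 2M - i`; counting `i` downwards matches the factor `J_{2M}`
applied to the receive pulse. -/
lemma sum_Icc_eq_sum_polyphase {R : Type*} [AddCommMonoid R] (κ M : ℕ) (F : ℤ → R) :
    ∑ m ∈ Finset.Icc (1 : ℤ) (2 * (M : ℤ) * κ), F m =
      ∑ v : Fin κ, ∑ i : Fin (2 * M),
        F (2 * (M : ℤ) * ((v : ℕ) : ℤ) + 2 * M - ((i : ℕ) : ℤ)) := by
  have h1 : ∑ m ∈ Finset.Icc (1 : ℤ) (2 * (M : ℤ) * κ), F m =
      ∑ x ∈ Finset.range (κ * (2 * M)), F ((x : ℤ) + 1) := by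
    have hL : 2 * (M : ℤ) * κ = ((κ * (2 * M) : ℕ) : ℤ) := by push_cast; ring
    rw [hL]
    refine Finset.sum_nbij' (fun m => (m - 1).toNat) (fun x => (x : ℤ) + 1) ?_ ?_ ?_ ?_ ?_
    · intro m hm
      rw [Finset.mem_Icc] at hm
      rw [Finset.mem_range]
      omega
    · intro x hx
      rw [Finset.mem_range] at hx
      rw [Finset.mem_Icc]
      omega
    · intro m hm
      rw [Finset.mem_Icc] at hm
      omega
    · intro x _
      simp
    · intro m hm
      rw [Finset.mem_Icc] at hm
      congr 1
      omega
  rw [h1, ← Fin.sum_univ_eq_sum_range (fun x => F ((x : ℤ) + 1)), ← finProdFinEquiv.sum_comp,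
    Fintype.sum_prod_type]
  refine Finset.sum_congr rfl fun v _ => ?_
  rw [← Equiv.sum_comp Fin.revPerm]
  refine Finset.sum_congr rfl fun i _ => ?_
  congr 1
  simp only [finProdFinEquiv_apply_val, Fin.revPerm_apply, Fin.val_rev]
  have := i.2
  push_cast [Nat.cast_sub (by omega : (i : ℕ) + 1 ≤ 2 * M)]
  ring

lemma exp_pi_mul_int (x : ℤ) :
    exp (I * (Real.pi * x)) = ((Real.cos (x * Real.pi) : ℝ) : ℂ) := by
  rw [show I * ((Real.pi : ℂ) * x) = ((x * Real.pi : ℝ) : ℂ) * I by push_cast; ring, exp_mul_I,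
    ← ofReal_cos, ← ofReal_sin, Real.sin_int_mul_pi]
  simp

/-- The subcarrier carriers have period `2M`, so only the polyphase index matters and the pulse
product folds. A lag of `M d` samples leaves the sign `e^{jπ k' d}`, written as a cosine so that it
is visibly real. -/
lemma phase_mul_flatCoeff {κ M : ℕ} (hM : 1 ≤ M) (p q : ℤ → ℝ) (k k' : Fin (2 * M)) (d : ℤ) :
    phase M k * star (phase M k') / (M : ℂ) *
      flatCoeff κ M p q (freq M k) (freq M k') ((M : ℤ) * d + 1) =
    ((Real.cos ((((k' : ℕ) : ℤ) * d : ℤ) * Real.pi) / M : ℝ) : ℂ) *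
      chirpSum M k k' (foldedPulse κ M p q d) := by
  have hM0 : (M : ℂ) ≠ 0 := by exact_mod_cast (by omega : M ≠ 0)
  have hexp : ∀ (v : Fin κ) (i : Fin (2 * M)),
      phase M k * star (phase M k') *
      (exp (I * freq M k * ((2 * (M : ℤ) * ((v : ℕ) : ℤ) + 2 * M - ((i : ℕ) : ℤ) : ℤ) : ℂ)) *
      exp (I * freq M k' * (((M : ℤ) * d + 1 - 1 -
        (2 * (M : ℤ) * ((v : ℕ) : ℤ) + 2 * M - ((i : ℕ) : ℤ)) : ℤ) : ℂ))) =
      ((Real.cos ((((k' : ℕ) : ℤ) * d : ℤ) * Real.pi) : ℝ) : ℂ) * chirp M k k' i := by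
    intro v i
    rw [← exp_pi_mul_int, chirp, phase, phase, star_def, ← exp_conj, ← exp_add, ← exp_add,
      ← exp_add, ← exp_add]
    have hconj : (starRingEnd ℂ) (-(I * Real.pi * ((M : ℂ) + 1) * ((k' : ℕ) : ℂ) / (2 * (M : ℂ)))) =
        I * Real.pi * ((M : ℂ) + 1) * ((k' : ℕ) : ℂ) / (2 * (M : ℂ)) := by
      rw [show -(I * Real.pi * ((M : ℂ) + 1) * ((k' : ℕ) : ℂ) / (2 * (M : ℂ))) =
        I * ((-(Real.pi * (M + 1) * ((k' : ℕ) : ℝ) / (2 * M)) : ℝ) : ℂ) by push_cast; ring,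
        map_mul, conj_I, conj_ofReal]
      push_cast
      ring
    rw [hconj, exp_eq_exp_iff_exists_int]
    -- The number of whole turns contributed by `2M (v + 1)` at the difference of the two
    -- frequencies.
    refine ⟨(((k : ℕ) : ℤ) - ((k' : ℕ) : ℤ)) * (((v : ℕ) : ℤ) + 1), ?_⟩
    simp only [freq]
    push_cast
    field_simp
    ring
  rw [flatCoeff, sum_Icc_eq_sum_polyphase, chirpSum, Finset.sum_comm, Finset.mul_sum,
    Finset.mul_sum]
  refine Finset.sum_congr rfl fun i _ => ?_
  rw [foldedPulse]
  push_cast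
  rw [Finset.mul_sum, Finset.sum_mul, Finset.mul_sum]
  refine Finset.sum_congr rfl fun v _ => ?_
  have h := hexp v i
  push_cast at h ⊢
  linear_combination (((p ((M : ℤ) * d + 1 - (2 * (M : ℤ) * ((v : ℕ) : ℤ) + 2 * M - ((i : ℕ) : ℤ))) : ℂ) *
    (q (2 * (M : ℤ) * ((v : ℕ) : ℤ) + 2 * M - ((i : ℕ) : ℤ)) : ℂ)) / M) * h

/-- `ρ d`, as a function of the lag `d`, is given by the columns of `Rm` at even lags and by the
columns of `Sm` at odd lags, and it vanishes at all other lags. -/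
structure IsFolding (κ M : ℕ) (ρ : ℤ → Fin (2 * M) → ℝ)
    (Rm Sm : Matrix (Fin (2 * M)) (Fin (2 * κ - 1)) ℝ) : Prop where
  even : ∀ (w : Fin (2 * κ - 1)) i, ρ (2 * ((w : ℕ) : ℤ) + 2) i = Rm i w
  even_zero : ∀ w : ℤ, ¬ (0 ≤ w ∧ w ≤ 2 * (κ : ℤ) - 2) → ∀ i, ρ (2 * w + 2) i = 0
  low : ∀ (w : Fin (2 * κ - 1)) (i : Fin (2 * M)), (i : ℕ) < M →
    ρ (2 * ((w : ℕ) : ℤ) + 3) i = Sm i w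
  low_zero : ∀ w : ℤ, ¬ (0 ≤ w ∧ w ≤ 2 * (κ : ℤ) - 2) → ∀ i : Fin (2 * M), (i : ℕ) < M →
    ρ (2 * w + 3) i = 0
  high : ∀ (w : Fin (2 * κ - 1)) (i : Fin (2 * M)), M ≤ (i : ℕ) →
    ρ (2 * ((w : ℕ) : ℤ) + 1) i = Sm i w
  high_zero : ∀ w : ℤ, ¬ (0 ≤ w ∧ w ≤ 2 * (κ : ℤ) - 2) → ∀ i : Fin (2 * M), M ≤ (i : ℕ) →
    ρ (2 * w + 1) i = 0

lemma antiId_mul_polyphase {M κ : ℕ} (q : ℤ → ℝ) (i : Fin (2 * M)) (v : Fin κ) :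
    (antiId (2 * M) * polyphase M κ q) i v =
      q (2 * (M : ℤ) * ((v : ℕ) : ℤ) + 2 * M - ((i : ℕ) : ℤ)) := by
  rw [Matrix.mul_apply, Finset.sum_eq_single i.rev]
  · have := i.2
    rw [antiId, Matrix.of_apply, if_pos (by rw [Fin.val_rev]; omega), one_mul, polyphase,
      Matrix.of_apply, Fin.val_rev]
    congr 1
    push_cast [Nat.cast_sub (by omega : (i : ℕ) + 1 ≤ 2 * M)]
    ring
  · intro x _ hx
    rw [antiId, Matrix.of_apply, if_neg, zero_mul]
    intro h
    apply hx
    ext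
    rw [Fin.val_rev]
    omega
  · simp

lemma kron_antiId_mul_apply {M κ : ℕ} (X : Matrix (Fin (2 * M)) (Fin κ) ℝ) (i i' : Fin (2 * M))
    (h : (i : ℕ) + M = i' ∨ (i' : ℕ) + M = i) (u : Fin κ) :
    (kron M (antiId 2) 1 * X) i u = X i' u := by
  rw [Matrix.mul_apply, Finset.sum_eq_single i']
  · obtain ⟨⟨x, y⟩, rfl⟩ := finProdFinEquiv.surjective i
    obtain ⟨⟨x', y'⟩, rfl⟩ := finProdFinEquiv.surjective i'
    have hy := y.2
    have hy' := y'.2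
    rw [kron, Matrix.reindex_apply, Matrix.submatrix_apply, Equiv.symm_apply_apply,
      Equiv.symm_apply_apply, Matrix.kroneckerMap_apply, antiId, Matrix.of_apply]
    simp only [finProdFinEquiv_apply_val] at h
    have hx : (x : ℕ) + (x' : ℕ) + 1 = 2 ∧ y = y' := by
      fin_cases x <;> fin_cases x' <;> simp [Fin.ext_iff] at h ⊢ <;> omega
    rw [if_pos hx.1, hx.2, Matrix.one_apply_eq]
    ring
  · intro z _ hz
    obtain ⟨⟨x, y⟩, rfl⟩ := finProdFinEquiv.surjective i
    obtain ⟨⟨x', y'⟩, rfl⟩ := finProdFinEquiv.surjective z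
    rw [kron, Matrix.reindex_apply, Matrix.submatrix_apply, Equiv.symm_apply_apply,
      Equiv.symm_apply_apply, Matrix.kroneckerMap_apply, antiId, Matrix.of_apply]
    simp only [finProdFinEquiv_apply_val] at h
    by_cases hx : (x : ℕ) + (x' : ℕ) + 1 = 2 ∧ y = y'
    · exfalso
      apply hz
      ext
      rw [finProdFinEquiv_apply_val]
      have hi' := i'.2
      have hy := y.2
      obtain ⟨h1, rfl⟩ := hx
      fin_cases x <;> fin_cases x' <;> simp at h h1 ⊢ <;> omega
    · rw [not_and_or] at hx
      rcases hx with hx | hx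
      · rw [if_neg hx]; ring
      · rw [Matrix.one_apply_ne hx]; ring
  · simp

lemma sum_ite_add_eq {κ : ℕ} {f : ℤ → ℝ} (hf : ∀ x, ¬ (0 ≤ x ∧ x < (κ : ℤ)) → f x = 0) (v w : ℕ) :
    ∑ u : Fin κ, (if (u : ℕ) + v = w then f ((u : ℕ) : ℤ) else 0) = f ((w : ℤ) - v) := by
  by_cases h : v ≤ w ∧ w - v < κ
  · rw [Finset.sum_eq_single ⟨w - v, h.2⟩]
    · rw [if_pos (by simp only; omega)]
      congr 1
      simp only
      omega
    · intro u _ hu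
      rw [if_neg]
      intro h'
      exact hu (Fin.ext (by simp only; omega))
    · simp
  · rw [hf _ (by omega), Finset.sum_eq_zero]
    intro u _
    have := u.2
    rw [if_neg (by omega)]

/-- An odd lag shifts the transmit pulse by half a block. Components with `i < M` stay in the same
block after adding `M`, the others are reached by subtracting `M`, so one column of `𝒮` collects two
different odd lags. -/
lemma isFolding_foldedPulse {κ M : ℕ} {p : ℤ → ℝ} (q : ℤ → ℝ)
    (hp : ∀ n, n ∉ Finset.Icc (1 : ℤ) (2 * (M : ℤ) * κ) → p n = 0) :
    IsFolding κ M (foldedPulse κ M p q) (Rmat M κ p q) (Smat M κ p q) := by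
  have hsupp : ∀ (y : ℕ) (x : ℤ), y < 2 * M → ¬ (0 ≤ x ∧ x < (κ : ℤ)) →
      p (2 * (M : ℤ) * x + y + 1) = 0 := by
    intro y x hy hx
    refine hp _ fun h => hx ?_
    rw [Finset.mem_Icc] at h
    constructor
    · by_contra h0
      have : x ≤ -1 := by omega
      nlinarith
    · by_contra h0
      have : (κ : ℤ) ≤ x := by omega
      nlinarith
  have hconv : ∀ (X : Matrix (Fin (2 * M)) (Fin κ) ℝ) (i : Fin (2 * M)) (y : ℕ), y < 2 * M →
      (∀ u : Fin κ, X i u = p (2 * (M : ℤ) * ((u : ℕ) : ℤ) + y + 1)) → ∀ w : Fin (2 * κ - 1),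
      rowConv X (antiId (2 * M) * polyphase M κ q) i w =
        ∑ v : Fin κ, p (2 * (M : ℤ) * (((w : ℕ) : ℤ) - ((v : ℕ) : ℤ)) + y + 1) *
          q (2 * (M : ℤ) * ((v : ℕ) : ℤ) + 2 * M - ((i : ℕ) : ℤ)) := by
    intro X i y hy hX w
    rw [rowConv, Matrix.of_apply, Finset.sum_comm]
    refine Finset.sum_congr rfl fun v _ => ?_
    rw [← sum_ite_add_eq (f := fun x => p (2 * (M : ℤ) * x + y + 1)) (fun x hx => hsupp y x hy hx)
      (v : ℕ) (w : ℕ), Finset.sum_mul]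
    refine Finset.sum_congr rfl fun u _ => ?_
    rw [hX, antiId_mul_polyphase]
    split_ifs <;> simp
  have hzero : ∀ (y : ℕ) (w : ℤ), y < 2 * M → ¬ (0 ≤ w ∧ w ≤ 2 * (κ : ℤ) - 2) → ∀ i : Fin (2 * M),
      ∑ v : Fin κ, p (2 * (M : ℤ) * (w - ((v : ℕ) : ℤ)) + y + 1) *
          q (2 * (M : ℤ) * ((v : ℕ) : ℤ) + 2 * M - ((i : ℕ) : ℤ)) = 0 := by
    intro y w hy hw i
    refine Finset.sum_eq_zero fun v _ => ?_
    have := v.2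
    rw [hsupp y _ hy (by omega), zero_mul]
  have heven : ∀ (w : ℤ) (i : Fin (2 * M)), foldedPulse κ M p q (2 * w + 2) i =
      ∑ v : Fin κ, p (2 * (M : ℤ) * (w - ((v : ℕ) : ℤ)) + ((i : ℕ) : ℤ) + 1) *
          q (2 * (M : ℤ) * ((v : ℕ) : ℤ) + 2 * M - ((i : ℕ) : ℤ)) := by
    intro w i
    refine Finset.sum_congr rfl fun v _ => ?_
    congr 2
    ring
  have hlow : ∀ (w : ℤ) (i : Fin (2 * M)), foldedPulse κ M p q (2 * w + 3) i =
      ∑ v : Fin κ, p (2 * (M : ℤ) * (w - ((v : ℕ) : ℤ)) + (((i : ℕ) + M : ℕ) : ℤ) + 1) *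
          q (2 * (M : ℤ) * ((v : ℕ) : ℤ) + 2 * M - ((i : ℕ) : ℤ)) := by
    intro w i
    refine Finset.sum_congr rfl fun v _ => ?_
    congr 2
    push_cast
    ring
  have hhigh : ∀ (w : ℤ) (i : Fin (2 * M)), M ≤ (i : ℕ) → foldedPulse κ M p q (2 * w + 1) i =
      ∑ v : Fin κ, p (2 * (M : ℤ) * (w - ((v : ℕ) : ℤ)) + (((i : ℕ) - M : ℕ) : ℤ) + 1) *
          q (2 * (M : ℤ) * ((v : ℕ) : ℤ) + 2 * M - ((i : ℕ) : ℤ)) := by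
    intro w i hi
    refine Finset.sum_congr rfl fun v _ => ?_
    congr 2
    push_cast [Nat.cast_sub hi]
    ring
  refine ⟨?_, ?_, ?_, ?_, ?_, ?_⟩
  · intro w i
    rw [heven, Rmat, hconv _ i (i : ℕ) i.2 (fun u => by rw [polyphase, Matrix.of_apply])]
  · intro w hw i
    rw [heven]
    exact hzero i w i.2 hw i
  · intro w i hi
    rw [hlow, Smat, hconv _ i ((i : ℕ) + M) (by omega) (fun u => by
      rw [kron_antiId_mul_apply _ i ⟨(i : ℕ) + M, by omega⟩ (Or.inl rfl), polyphase,
        Matrix.of_apply])]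
  · intro w hw i hi
    rw [hlow]
    exact hzero _ w (by omega) hw i
  · intro w i hi
    have := i.2
    rw [hhigh _ _ hi, Smat, hconv _ i ((i : ℕ) - M) (by omega) (fun u => by
      rw [kron_antiId_mul_apply _ i ⟨(i : ℕ) - M, by omega⟩ (Or.inr (by simp only; omega)),
        polyphase, Matrix.of_apply])]
  · intro w hw i hi
    have := i.2
    rw [hhigh _ _ hi]
    exact hzero _ w (by omega) hw i

/-- Lag `2κ` is column `κ - 1` counted from zero, the central one. -/
lemma IsFolding.sub_centralOnes {κ M : ℕ} {ρ : ℤ → Fin (2 * M) → ℝ}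
    {Rm Sm : Matrix (Fin (2 * M)) (Fin (2 * κ - 1)) ℝ} (h : IsFolding κ M ρ Rm Sm) (hκ : 1 ≤ κ)
    (c : ℝ) :
    IsFolding κ M (fun d i => ρ d i - if d = 2 * (κ : ℤ) then c else 0)
      (Rm - c • centralOnes M κ) Sm := by
  refine ⟨?_, ?_, ?_, ?_, ?_, ?_⟩
  · intro w i
    rw [h.even, Matrix.sub_apply, Matrix.smul_apply, centralOnes, Matrix.of_apply]
    congr 1
    by_cases hw : (w : ℕ) + 1 = κ
    · rw [if_pos hw, if_pos (by omega)]; simp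
    · rw [if_neg hw, if_neg (by omega)]; simp
  · intro w hw i
    rw [h.even_zero w hw, if_neg (by omega), sub_zero]
  · intro w i hi
    rw [h.low w i hi, if_neg (by omega), sub_zero]
  · intro w hw i hi
    rw [h.low_zero w hw i hi, if_neg (by omega), sub_zero]
  · intro w i hi
    rw [h.high w i hi, if_neg (by omega), sub_zero]
  · intro w hw i hi
    rw [h.high_zero w hw i hi, if_neg (by omega), sub_zero]

/-! ### Second-order forms of the folded pulses -/

/-- The bounds on `s` place the whole support of `F` inside the frame. Here the condition `κ + 1 ≤ ℓ
≤ N - κ` is spent: every interfering column is actually transmitted. -/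
lemma sum_fin_shift {κ N : ℕ} {F : ℤ → ℝ} (hF : ∀ w, ¬ (0 ≤ w ∧ w ≤ 2 * (κ : ℤ) - 2) → F w = 0)
    {s : ℤ} (h1 : 2 * (κ : ℤ) - 2 ≤ s) (h2 : s < N) :
    ∑ c : Fin N, F (s - ((c : ℕ) : ℤ)) = ∑ w : Fin (2 * κ - 1), F ((w : ℕ) : ℤ) := by
  symm
  refine Finset.sum_bij_ne_zero (fun w _ _ => ⟨(s - ((w : ℕ) : ℤ)).toNat, ?_⟩) ?_ ?_ ?_ ?_
  · have := w.2
    omega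
  · intros; exact Finset.mem_univ _
  · intro w _ _ w' _ _ h
    have := w.2
    have := w'.2
    simp only [Fin.mk.injEq] at h
    exact Fin.ext (by omega)
  · intro c _ hc
    have hw : 0 ≤ s - ((c : ℕ) : ℤ) ∧ s - ((c : ℕ) : ℤ) ≤ 2 * (κ : ℤ) - 2 := by
      by_contra h
      exact hc (hF _ h)
    have hval : (((s - ((c : ℕ) : ℤ)).toNat : ℕ) : ℤ) = s - ((c : ℕ) : ℤ) := by omega
    refine ⟨⟨(s - ((c : ℕ) : ℤ)).toNat, by omega⟩, Finset.mem_univ _, ?_, ?_⟩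
    · simpa only [hval] using hc
    · exact Fin.ext (by simp only; omega)
  · intro w _ _
    congr 1
    have := w.2
    simp only
    omega

lemma trace_mul_transpose_mul {ι γ : Type*} [Fintype ι] [Fintype γ] (X Y : Matrix ι γ ℝ)
    (U : Matrix ι ι ℝ) (hU : ∀ i i', U i i' = U i' i) :
    Matrix.trace (X * Yᵀ * U) = ∑ i, ∑ i', (∑ w, X i w * Y i' w) * U i i' := by
  simp only [Matrix.trace, Matrix.diag_apply, Matrix.mul_apply, Matrix.transpose_apply]
  exact Finset.sum_congr rfl fun i _ => Finset.sum_congr rfl fun i' _ => by rw [hU i' i]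

lemma sum_bilin_eq {ι : Type*} [Fintype ι] {N : ℕ} (U : Matrix ι ι ℝ) (a b : Fin N → ι → ℝ) :
    ∑ c, bilin U (a c) (b c) = ∑ i, ∑ i', (∑ c, a c i * b c i') * U i i' := by
  simp only [bilin, Finset.sum_mul]
  rw [Finset.sum_comm]
  exact Finset.sum_congr rfl fun i _ => Finset.sum_comm

namespace IsFolding

variable {κ M : ℕ} {ρ ρ' : ℤ → Fin (2 * M) → ℝ}
  {Rm Sm Rm' Sm' : Matrix (Fin (2 * M)) (Fin (2 * κ - 1)) ℝ}

lemma sum_bilin_even (h : IsFolding κ M ρ Rm Sm) (h' : IsFolding κ M ρ' Rm' Sm')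
    {U : Matrix (Fin (2 * M)) (Fin (2 * M)) ℝ} (hU : ∀ i i', U i i' = U i' i) {N : ℕ} {s : ℤ}
    (h1 : 2 * (κ : ℤ) - 2 ≤ s) (h2 : s < N) :
    ∑ c : Fin N, bilin U (ρ (2 * (s - ((c : ℕ) : ℤ)) + 2)) (ρ' (2 * (s - ((c : ℕ) : ℤ)) + 2)) =
      Matrix.trace (Rm * Rm'ᵀ * U) := by
  rw [trace_mul_transpose_mul _ _ _ hU, sum_bilin_eq]
  refine Finset.sum_congr rfl fun i _ => Finset.sum_congr rfl fun i' _ => ?_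
  rw [sum_fin_shift (F := fun w => ρ (2 * w + 2) i * ρ' (2 * w + 2) i')
    (fun w hw => by rw [h.even_zero w hw, zero_mul]) h1 h2]
  congr 1
  exact Finset.sum_congr rfl fun w _ => by rw [h.even, h'.even]

/-- Since `U` does not couple the two halves of the polyphase components, the sum over columns may
be re-indexed with a different shift in each half, as the odd lags require. -/
lemma sum_bilin_odd (h : IsFolding κ M ρ Rm Sm) (h' : IsFolding κ M ρ' Rm' Sm')
    {U : Matrix (Fin (2 * M)) (Fin (2 * M)) ℝ} (hU : ∀ i i', U i i' = U i' i)
    (hblock : ∀ i i', U i i' ≠ 0 → ((i : ℕ) < M ↔ (i' : ℕ) < M)) {N : ℕ} {s : ℤ}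
    (h1 : 2 * (κ : ℤ) - 2 ≤ s) (h2 : s + 1 < N) :
    ∑ c : Fin N, bilin U (ρ (2 * (s - ((c : ℕ) : ℤ)) + 3)) (ρ' (2 * (s - ((c : ℕ) : ℤ)) + 3)) =
      Matrix.trace (Sm * Sm'ᵀ * U) := by
  rw [trace_mul_transpose_mul _ _ _ hU, sum_bilin_eq]
  refine Finset.sum_congr rfl fun i _ => Finset.sum_congr rfl fun i' _ => ?_
  by_cases hne : U i i' = 0
  · rw [hne, mul_zero, mul_zero]
  congr 1
  have hb := hblock i i' hne
  by_cases hi : (i : ℕ) < M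
  · have hi' := hb.1 hi
    rw [sum_fin_shift (F := fun w => ρ (2 * w + 3) i * ρ' (2 * w + 3) i')
      (fun w hw => by rw [h.low_zero w hw i hi, zero_mul]) h1 (by omega)]
    exact Finset.sum_congr rfl fun w _ => by rw [h.low w i hi, h'.low w i' hi']
  · have hi' : M ≤ (i' : ℕ) := by
      by_contra hc
      exact hi (hb.2 (by omega))
    have hi2 : M ≤ (i : ℕ) := by omega
    -- The upper half uses the next column, hence the stronger assumption `s + 1 < N`.
    have hshift : ∀ c : Fin N, 2 * (s - ((c : ℕ) : ℤ)) + 3 = 2 * (s + 1 - ((c : ℕ) : ℤ)) + 1 := by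
      intro c; ring
    simp only [hshift]
    rw [sum_fin_shift (F := fun w => ρ (2 * w + 1) i * ρ' (2 * w + 1) i')
      (fun w hw => by rw [h.high_zero w hw i hi2, zero_mul]) (by omega) h2]
    exact Finset.sum_congr rfl fun w _ => by rw [h.high w i hi2, h'.high w i' hi']

end IsFolding

lemma reflMat_block {M : ℕ} {i i' : Fin (2 * M)} (h : reflMat M i i' ≠ 0) :
    (i : ℕ) < M ↔ (i' : ℕ) < M := by
  rw [reflMat_apply] at h
  have hdvd : (2 * (M : ℤ)) ∣ ((i : ℕ) : ℤ) + ((i' : ℕ) : ℤ) + M + 1 := by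
    by_contra hn
    exact h (if_neg hn)
  have h1 := i.2
  have h2 := i'.2
  have hdvd' : (2 * (M : ℤ)) ∣ ((i : ℕ) : ℤ) + ((i' : ℕ) : ℤ) + M + 1 - 2 * M :=
    dvd_sub_self_right.2 hdvd
  constructor
  · intro hi
    by_contra hi'
    have := Int.eq_zero_of_abs_lt_dvd hdvd' (by rw [abs_lt]; constructor <;> omega)
    omega
  · intro hi'
    by_contra hi
    have := Int.eq_zero_of_abs_lt_dvd hdvd' (by rw [abs_lt]; constructor <;> omega)
    omega

lemma Uplus_block {M : ℕ} (i i' : Fin (2 * M)) (h : Uplus M i i' ≠ 0) :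
    (i : ℕ) < M ↔ (i' : ℕ) < M := by
  by_cases hr : reflMat M i i' = 0
  · by_cases hii : i = i'
    · rw [hii]
    · exact absurd (by rw [Uplus_eq, Matrix.add_apply, hr, Matrix.one_apply_ne hii, add_zero]) h
  · exact reflMat_block hr

lemma Uminus_block {M : ℕ} (i i' : Fin (2 * M)) (h : Uminus M i i' ≠ 0) :
    (i : ℕ) < M ↔ (i' : ℕ) < M := by
  by_cases hr : reflMat M i i' = 0
  · by_cases hii : i = i'
    · rw [hii]
    · exact absurd (by rw [Uminus_eq, Matrix.sub_apply, hr, Matrix.one_apply_ne hii, sub_zero]) h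
  · exact reflMat_block hr

/-- The factor `(-j)^o j^e`, with which a staggered input column of type `e` enters an output of
type `o`, where type `0` means real and type `1` means imaginary. -/
def unitFactor (o e : Fin 2) : ℂ := if e = o then 1 else if o = 0 then I else -I

/-- The coefficient of the symbol part with subcarrier `k'` and column `c` in the output column
`2 s + o` for the folded pulse `ρ`. -/
def foldCoeff {M N : ℕ} (k : Fin (2 * M)) (ρ : ℤ → Fin (2 * M) → ℝ) (s : ℤ) (o : Fin 2)
    (x : Fin (2 * M) × Fin N × Fin 2) : ℂ :=
  unitFactor o x.2.2 *
    (((Real.cos (((((x.1 : ℕ) : ℤ) * (2 * s + ((o : ℕ) : ℤ) -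
      (2 * ((x.2.1 : ℕ) : ℤ) + ((x.2.2 : ℕ) : ℤ))) : ℤ) : ℝ) * Real.pi) / M : ℝ) : ℂ) *
      chirpSum M k x.1 (ρ (2 * s + ((o : ℕ) : ℤ) - (2 * ((x.2.1 : ℕ) : ℤ) + ((x.2.2 : ℕ) : ℤ)))))

lemma cos_int_mul_pi_div_sq (x : ℤ) (M : ℕ) :
    (Real.cos (x * Real.pi) / M) * (Real.cos (x * Real.pi) / M) = 1 / (M : ℝ) ^ 2 := by
  have h := Real.sin_sq_add_cos_sq (x * Real.pi)
  rw [Real.sin_int_mul_pi] at h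
  rw [div_mul_div_comm, ← sq, ← sq]
  congr 1
  linarith

section

variable {κ M N : ℕ} {ρ ρ' : ℤ → Fin (2 * M) → ℝ}
  {Rm Sm Rm' Sm' : Matrix (Fin (2 * M)) (Fin (2 * κ - 1)) ℝ}

/-- The signs `cos (π k' d)` square to one. A column of the type opposite to the output carries a
factor `±j`, which exchanges real and imaginary parts and hence `U⁺` and `U⁻`. -/
lemma sum_subcarriers_foldCoeff (hM : 1 ≤ M) (k : Fin (2 * M)) (ρ ρ' : ℤ → Fin (2 * M) → ℝ) (s : ℤ)
    (o : Fin 2) (c : Fin N × Fin 2) (d : ℤ)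
    (hd : 2 * s + ((o : ℕ) : ℤ) - (2 * ((c.1 : ℕ) : ℤ) + ((c.2 : ℕ) : ℤ)) = d) :
    (∑ k', (foldCoeff k ρ s o (k', c)).re * (foldCoeff k ρ' s o (k', c)).re =
      1 / M * bilin (if c.2 = o then Uplus M else Uminus M) (ρ d) (ρ' d)) ∧
    (∑ k', (foldCoeff k ρ s o (k', c)).im * (foldCoeff k ρ' s o (k', c)).im =
      1 / M * bilin (if c.2 = o then Uminus M else Uplus M) (ρ d) (ρ' d)) ∧
    (∑ k', (foldCoeff k ρ s o (k', c)).re * (foldCoeff k ρ' s o (k', c)).im = 0) := by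
  have hM0 : (M : ℝ) ≠ 0 := by exact_mod_cast (by omega : M ≠ 0)
  simp only [foldCoeff, hd]
  have hrr : 1 / (M : ℝ) * bilin (Uplus M) (ρ d) (ρ' d) = 1 / (M : ℝ) ^ 2 *
      ∑ k', (chirpSum M k k' (ρ d)).re * (chirpSum M k k' (ρ' d)).re := by
    rw [sum_re_mul_re hM]; field_simp
  have hii : 1 / (M : ℝ) * bilin (Uminus M) (ρ d) (ρ' d) = 1 / (M : ℝ) ^ 2 *
      ∑ k', (chirpSum M k k' (ρ d)).im * (chirpSum M k k' (ρ' d)).im := by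
    rw [sum_im_mul_im hM]; field_simp
  have hri : (0 : ℝ) = 1 / (M : ℝ) ^ 2 *
      ∑ k', (chirpSum M k k' (ρ d)).re * (chirpSum M k k' (ρ' d)).im := by
    rw [sum_re_mul_im hM, mul_zero]
  -- The factor `±j` also exchanges the roles of the two pulses in the mixed product.
  have hir : (0 : ℝ) = -(1 / (M : ℝ) ^ 2 *
      ∑ k', (chirpSum M k k' (ρ' d)).re * (chirpSum M k k' (ρ d)).im) := by
    rw [sum_re_mul_im hM, mul_zero, neg_zero]
  by_cases hc : c.2 = o
  · simp only [unitFactor, hc, if_true, one_mul, re_ofReal_mul, im_ofReal_mul]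
    refine ⟨?_, ?_, ?_⟩
    · rw [hrr, Finset.mul_sum]
      refine Finset.sum_congr rfl fun k' _ => ?_
      rw [← cos_int_mul_pi_div_sq (((k' : ℕ) : ℤ) * d)]; ring
    · rw [hii, Finset.mul_sum]
      refine Finset.sum_congr rfl fun k' _ => ?_
      rw [← cos_int_mul_pi_div_sq (((k' : ℕ) : ℤ) * d)]; ring
    · rw [hri, Finset.mul_sum]
      refine Finset.sum_congr rfl fun k' _ => ?_
      rw [← cos_int_mul_pi_div_sq (((k' : ℕ) : ℤ) * d)]; ring
  · simp only [unitFactor, hc, if_false]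
    by_cases ho : o = 0
    · simp only [ho, if_true, I_mul_re, I_mul_im, re_ofReal_mul, im_ofReal_mul]
      refine ⟨?_, ?_, ?_⟩
      · rw [hii, Finset.mul_sum]
        refine Finset.sum_congr rfl fun k' _ => ?_
        rw [← cos_int_mul_pi_div_sq (((k' : ℕ) : ℤ) * d)]; ring
      · rw [hrr, Finset.mul_sum]
        refine Finset.sum_congr rfl fun k' _ => ?_
        rw [← cos_int_mul_pi_div_sq (((k' : ℕ) : ℤ) * d)]; ring
      · rw [hir, Finset.mul_sum, ← Finset.sum_neg_distrib]
        refine Finset.sum_congr rfl fun k' _ => ?_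
        rw [← cos_int_mul_pi_div_sq (((k' : ℕ) : ℤ) * d)]; ring
    · simp only [ho, if_false, neg_mul, neg_re, neg_im, I_mul_re, I_mul_im, re_ofReal_mul,
        im_ofReal_mul]
      refine ⟨?_, ?_, ?_⟩
      · rw [hii, Finset.mul_sum]
        refine Finset.sum_congr rfl fun k' _ => ?_
        rw [← cos_int_mul_pi_div_sq (((k' : ℕ) : ℤ) * d)]; ring
      · rw [hrr, Finset.mul_sum]
        refine Finset.sum_congr rfl fun k' _ => ?_
        rw [← cos_int_mul_pi_div_sq (((k' : ℕ) : ℤ) * d)]; ring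
      · rw [hir, Finset.mul_sum, ← Finset.sum_neg_distrib]
        refine Finset.sum_congr rfl fun k' _ => ?_
        rw [← cos_int_mul_pi_div_sq (((k' : ℕ) : ℤ) * d)]; ring

/-- Columns of the output's own type sit at even lags and produce `ℛ`; those of the other type sit
at odd lags and produce `𝒮`. -/
lemma sum_columns_bilin (h : IsFolding κ M ρ Rm Sm) (h' : IsFolding κ M ρ' Rm' Sm')
    {U V : Matrix (Fin (2 * M)) (Fin (2 * M)) ℝ} (hU : ∀ i i', U i i' = U i' i)
    (hV : ∀ i i', V i i' = V i' i) (hblock : ∀ i i', V i i' ≠ 0 → ((i : ℕ) < M ↔ (i' : ℕ) < M))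
    {s : ℤ} (h1 : 2 * (κ : ℤ) ≤ s) (h2 : s + 1 ≤ N) (o : Fin 2) :
    ∑ c : Fin N × Fin 2, bilin (if c.2 = o then U else V)
        (ρ (2 * s + ((o : ℕ) : ℤ) - (2 * ((c.1 : ℕ) : ℤ) + ((c.2 : ℕ) : ℤ))))
        (ρ' (2 * s + ((o : ℕ) : ℤ) - (2 * ((c.1 : ℕ) : ℤ) + ((c.2 : ℕ) : ℤ)))) =
      Matrix.trace (Rm * Rm'ᵀ * U + Sm * Sm'ᵀ * V) := by
  rw [Fintype.sum_prod_type, Matrix.trace_add]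
  simp only [Fin.sum_univ_two, Finset.sum_add_distrib]
  have he := h.sum_bilin_even h' hU (N := N) (s := s - 1) (by omega) (by omega)
  fin_cases o
  -- For the real output the odd lags are `2s - 2c - 1 = 2(s - 2 - c) + 3`; for the imaginary output
  -- they are `2s + 1 - 2c = 2(s - 1 - c) + 3`.
  · have ho := h.sum_bilin_odd h' hV hblock (N := N) (s := s - 2) (by omega) (by omega)
    rw [← he, ← ho]
    congr 1
    · refine Finset.sum_congr rfl fun c _ => ?_
      rw [if_pos (by rfl)]
      congr 2 <;> (simp; ring)
    · refine Finset.sum_congr rfl fun c _ => ?_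
      rw [if_neg (by decide)]
      congr 2 <;> (simp; ring)
  · have ho := h.sum_bilin_odd h' hV hblock (N := N) (s := s - 1) (by omega) (by omega)
    rw [← he, ← ho, add_comm]
    congr 1
    · refine Finset.sum_congr rfl fun c _ => ?_
      rw [if_pos (by rfl)]
      congr 2 <;> (simp; ring)
    · refine Finset.sum_congr rfl fun c _ => ?_
      rw [if_neg (by decide)]
      congr 2 <;> (simp; ring)

/-- Second-order statistics of the outputs for two folded pulses. -/
lemma sum_foldCoeff (hM : 1 ≤ M) (h : IsFolding κ M ρ Rm Sm) (h' : IsFolding κ M ρ' Rm' Sm')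
    (k : Fin (2 * M)) {s : ℤ} (h1 : 2 * (κ : ℤ) ≤ s) (h2 : s + 1 ≤ N) (o : Fin 2) :
    (∑ x : Fin (2 * M) × Fin N × Fin 2, (foldCoeff k ρ s o x).re * (foldCoeff k ρ' s o x).re =
      1 / M * Matrix.trace (Rm * Rm'ᵀ * Uplus M + Sm * Sm'ᵀ * Uminus M)) ∧
    (∑ x : Fin (2 * M) × Fin N × Fin 2, (foldCoeff k ρ s o x).im * (foldCoeff k ρ' s o x).im =
      1 / M * Matrix.trace (Rm * Rm'ᵀ * Uminus M + Sm * Sm'ᵀ * Uplus M)) ∧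
    (∑ x : Fin (2 * M) × Fin N × Fin 2,
      (foldCoeff k ρ s o x).re * (foldCoeff k ρ' s o x).im = 0) := by
  have hc := fun c : Fin N × Fin 2 => sum_subcarriers_foldCoeff hM k ρ ρ' s o c _ rfl
  refine ⟨?_, ?_, ?_⟩
  · rw [Fintype.sum_prod_type, Finset.sum_comm, Finset.sum_congr rfl fun c _ => (hc c).1,
      ← Finset.mul_sum, sum_columns_bilin h h' Uplus_symm Uminus_symm Uminus_block h1 h2 o]
  · rw [Fintype.sum_prod_type, Finset.sum_comm, Finset.sum_congr rfl fun c _ => (hc c).2.1,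
      ← Finset.mul_sum, sum_columns_bilin h h' Uminus_symm Uplus_symm Uplus_block h1 h2 o]
  · rw [Fintype.sum_prod_type, Finset.sum_comm, Finset.sum_congr rfl fun c _ => (hc c).2.2,
      Finset.sum_const_zero]

end

/-! ### Power of linear forms of the symbols -/

/-- Independence and zero mean remove all products of distinct variables. -/
lemma integral_sq_linear_form {ι Ω : Type*} [Fintype ι] [DecidableEq ι] [MeasurableSpace Ω]
    {μ : Measure Ω} [IsProbabilityMeasure μ] {X : ι → Ω → ℝ} {σ : ℝ} (hX : iIndepFun X μ)
    (hL : ∀ i, MemLp (X i) 2 μ) (hmean : ∀ i, ∫ x, X i x ∂μ = 0)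
    (hpow : ∀ i, ∫ x, X i x ^ 2 ∂μ = σ) (g : ι → ℝ) :
    Integrable (fun x => (∑ i, g i * X i x) ^ 2) μ ∧
      ∫ x, (∑ i, g i * X i x) ^ 2 ∂μ = σ * ∑ i, g i ^ 2 := by
  have h_integrable : ∀ i j, Integrable (fun x => g i * g j * (X i x * X j x)) μ :=
    fun i j => ((hL i).integrable_mul (hL j)).const_mul _
  have hexp : ∀ x, (∑ i, g i * X i x) ^ 2 = ∑ i, ∑ j, g i * g j * (X i x * X j x) := by
    intro x
    rw [sq, Finset.sum_mul_sum]
    exact Finset.sum_congr rfl fun i _ => Finset.sum_congr rfl fun j _ => by ring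
  simp only [hexp]
  refine ⟨integrable_finsetSum _ fun i _ => integrable_finsetSum _ fun j _ => h_integrable i j, ?_⟩
  rw [integral_finsetSum _ fun i _ => integrable_finsetSum _ fun j _ => h_integrable i j, Finset.mul_sum]
  refine Finset.sum_congr rfl fun i _ => ?_
  rw [integral_finsetSum _ fun j _ => h_integrable i j, Finset.sum_eq_single i]
  · rw [integral_const_mul, ← hpow i, mul_comm, sq]
    congr 1
    exact integral_congr_ae (Filter.Eventually.of_forall fun x => by simp only; ring)
  · intro j _ hj
    have h := (hX.indepFun hj.symm).integral_mul_eq_mul_integral (hL i).1 (hL j).1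
    simp only [Pi.mul_apply] at h
    rw [integral_const_mul, h, hmean i, zero_mul, mul_zero]
  · simp

lemma memLp_symbolPart {NS M N : ℕ} {Ω : Type*} [MeasurableSpace Ω] {μ : Measure Ω}
    [IsProbabilityMeasure μ] {s : Ω → Fin NS → Matrix (Fin (2 * M)) (Fin N) ℂ} {C : Set ℂ}
    (hC : Bornology.IsBounded C) (hs : ∀ n k ℓ, ∀ᵐ x ∂μ, s x n k ℓ ∈ C)
    (i : Fin NS × Fin (2 * M) × Fin N × Fin 2) (hm : AEMeasurable (symbolPart s i) μ) :
    MemLp (symbolPart s i) 2 μ := by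
  obtain ⟨r, hr⟩ := hC.exists_norm_le
  refine MemLp.of_bound hm.aestronglyMeasurable r ?_
  filter_upwards [hs i.1 i.2.1 i.2.2.1] with x hx
  rw [symbolPart]
  split_ifs
  · exact (abs_re_le_norm _).trans (hr _ hx)
  · exact (abs_im_le_norm _).trans (hr _ hx)

namespace Transceiver

variable {NT NR NS : ℕ} (T : Transceiver NT NR NS)

/-- The coefficient of a symbol part in the real (`o = 0`) or imaginary (`o = 1`) part of the
estimation error. -/
def errorCoeff {M N : ℕ} (n : Fin NS) (k : Fin (2 * M)) (ℓ : Fin N) (o : Fin 2)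
    (y : Fin NS × Fin (2 * M) × Fin N × Fin 2) : ℝ :=
  (unitFactor o y.2.2.2 * T.symbolCoeff M n y.1 k y.2.1
    (lagTime M (2 * (((ℓ : ℕ) : ℤ) + T.κ) + ((o : ℕ) : ℤ)) y.2.2)).re -
    if y = (n, k, ℓ, o) then 1 else 0

lemma stagger_eq {M N : ℕ} {Ω : Type*} (s : Ω → Fin NS → Matrix (Fin (2 * M)) (Fin N) ℂ) (x : Ω)
    (nS : Fin NS) (k : Fin (2 * M)) (c : Fin N × Fin 2) :
    stagger (s x nS) k c = (symbolPart s (nS, k, c) x : ℂ) * (if c.2 = 0 then 1 else I) := by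
  rw [stagger, Matrix.of_apply, symbolPart]
  simp only
  split_ifs
  · rw [mul_one]
  · rw [mul_comm]

/-- The receiver keeps only the real part of one column and the imaginary part of the next. Written
as the real part after multiplication by `-j`, the second has the same shape as the first, and
`unitFactor` collects the powers of `j`. -/
lemma norm_estimate_sub_sq {M N : ℕ} (hM : 1 ≤ M) {Ω : Type*}
    (s : Ω → Fin NS → Matrix (Fin (2 * M)) (Fin N) ℂ) (x : Ω) (n : Fin NS) (k : Fin (2 * M))
    (ℓ : Fin N) :
    ‖T.estimate (s x) n k ℓ - s x n k ℓ‖ ^ 2 =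
      (∑ y, T.errorCoeff n k ℓ 0 y * symbolPart s y x) ^ 2 +
        (∑ y, T.errorCoeff n k ℓ 1 y * symbolPart s y x) ^ 2 := by
  have hind : ∀ o : Fin 2, ∑ y : Fin NS × Fin (2 * M) × Fin N × Fin 2,
      (if y = (n, k, ℓ, o) then (1 : ℝ) else 0) * symbolPart s y x =
        symbolPart s (n, k, ℓ, o) x := by
    intro o
    rw [Finset.sum_eq_single (n, k, ℓ, o)]
    · simp
    · intro y _ hy
      rw [if_neg hy, zero_mul]
    · simp
  have hre : ∀ j, (T.received (fun m => stagger (s x m)) n k j).re =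
      ∑ y : Fin NS × Fin (2 * M) × Fin N × Fin 2, (unitFactor 0 y.2.2.2 *
        T.symbolCoeff M n y.1 k y.2.1 (lagTime M j y.2.2)).re * symbolPart s y x := by
    intro j
    rw [T.received_eq_sum hM]
    simp only [Fintype.sum_prod_type, re_sum, stagger_eq]
    refine Finset.sum_congr rfl fun nS _ => Finset.sum_congr rfl fun k' _ =>
      Finset.sum_congr rfl fun c1 _ => Finset.sum_congr rfl fun c2 _ => ?_
    rw [mul_assoc, re_ofReal_mul, mul_comm, unitFactor, if_pos rfl]
  have him : ∀ j, (T.received (fun m => stagger (s x m)) n k j).im =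
      ∑ y : Fin NS × Fin (2 * M) × Fin N × Fin 2, (unitFactor 1 y.2.2.2 *
        T.symbolCoeff M n y.1 k y.2.1 (lagTime M j y.2.2)).re * symbolPart s y x := by
    intro j
    rw [T.received_eq_sum hM]
    simp only [Fintype.sum_prod_type, im_sum, stagger_eq]
    refine Finset.sum_congr rfl fun nS _ => Finset.sum_congr rfl fun k' _ =>
      Finset.sum_congr rfl fun c1 _ => Finset.sum_congr rfl fun c2 _ => ?_
    rw [mul_assoc, im_ofReal_mul, mul_comm, unitFactor]
    fin_cases c2 <;> simp
  -- With `ℓ' = ℓ + 1`, both output columns take the form `2 (ℓ + κ) + o`.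
  have hj0 : 2 * ((((ℓ : ℕ) : ℤ) + 1) + T.κ - 1) =
      2 * (((ℓ : ℕ) : ℤ) + T.κ) + (((0 : Fin 2) : ℕ) : ℤ) := by
    rw [Fin.val_zero]; push_cast; ring
  have hj1 : 2 * ((((ℓ : ℕ) : ℤ) + 1) + T.κ) - 1 =
      2 * (((ℓ : ℕ) : ℤ) + T.κ) + (((1 : Fin 2) : ℕ) : ℤ) := by
    rw [Fin.val_one]; push_cast; ring
  have h0 : (T.estimate (s x) n k ℓ - s x n k ℓ).re =
      ∑ y, T.errorCoeff n k ℓ 0 y * symbolPart s y x := by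
    simp only [errorCoeff, sub_mul, Finset.sum_sub_distrib, hind]
    rw [estimate, sub_re, add_re, ofReal_re, I_mul_re, ofReal_im, receivedOdd, hj0, hre, symbolPart,
      if_pos rfl, neg_zero, add_zero]
  have h1 : (T.estimate (s x) n k ℓ - s x n k ℓ).im =
      ∑ y, T.errorCoeff n k ℓ 1 y * symbolPart s y x := by
    simp only [errorCoeff, sub_mul, Finset.sum_sub_distrib, hind]
    rw [estimate, sub_im, add_im, ofReal_im, I_mul_im, ofReal_re, receivedEven, hj1, him, symbolPart,
      if_neg one_ne_zero, zero_add]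
  rw [← normSq_eq_norm_sq, normSq_apply, h0, h1]
  ring

lemma integral_norm_estimate_sub_sq {M N : ℕ} (hM : 1 ≤ M) {Ω : Type*} [MeasurableSpace Ω]
    {μ : Measure Ω} [IsProbabilityMeasure μ] {Ps : ℝ}
    {s : (M : ℕ) → Ω → Fin NS → Matrix (Fin (2 * M)) (Fin N) ℂ}
    (h3 : BoundedConstellation μ s) (h4 : IIDSymbols μ Ps s) (n : Fin NS) (k : Fin (2 * M))
    (ℓ : Fin N) :
    ∫ x, ‖T.estimate (s M x) n k ℓ - s M x n k ℓ‖ ^ 2 ∂μ =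
      Ps / 2 * ∑ y, T.errorCoeff n k ℓ 0 y ^ 2 + Ps / 2 * ∑ y, T.errorCoeff n k ℓ 1 y ^ 2 := by
  obtain ⟨C, hC, hs⟩ := h3
  have hL : ∀ i, MemLp (symbolPart (s M) i) 2 μ := fun i =>
    memLp_symbolPart hC (hs M) i (h4.ident M i i).aemeasurable_fst
  have key := fun o => integral_sq_linear_form (h4.indep M) hL (h4.mean M) (h4.power M)
    (T.errorCoeff n k ℓ o)
  simp only [T.norm_estimate_sub_sq hM (s M)]
  rw [integral_add (key 0).1 (key 1).1, (key 0).2, (key 1).2]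

end Transceiver

/-! ### Derivatives of matrix products -/

lemma iteratedDeriv_comp_iteratedDeriv (F : ℝ → ℂ) (r s : ℕ) :
    iteratedDeriv r (iteratedDeriv s F) = iteratedDeriv (s + r) F := by
  rw [iteratedDeriv_eq_iterate, iteratedDeriv_eq_iterate, iteratedDeriv_eq_iterate, add_comm,
    Function.iterate_add_apply]

lemma matDeriv_matDeriv {a b : ℕ} (X : ℝ → Matrix (Fin a) (Fin b) ℂ) (r s : ℕ) (ω : ℝ) :
    matDeriv r (matDeriv s X) ω = matDeriv (s + r) X ω := by
  ext i j
  simp only [matDeriv, Matrix.of_apply]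
  rw [← iteratedDeriv_comp_iteratedDeriv]

lemma matDeriv_mul {a b c r : ℕ} {X : ℝ → Matrix (Fin a) (Fin b) ℂ}
    {Y : ℝ → Matrix (Fin b) (Fin c) ℂ}
    (hX : ∀ i j, ContDiff ℝ ((r : ℕ) : WithTop ℕ∞) fun ω => X ω i j)
    (hY : ∀ i j, ContDiff ℝ ((r : ℕ) : WithTop ℕ∞) fun ω => Y ω i j) (ω : ℝ) (i : Fin a)
    (j : Fin c) :
    matDeriv r (fun w => X w * Y w) ω i j = ∑ s ∈ Finset.range (r + 1),
      (r.choose s : ℂ) * (matDeriv s X ω * matDeriv (r - s) Y ω) i j := by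
  simp only [matDeriv, Matrix.of_apply, Matrix.mul_apply]
  rw [iteratedDeriv_fun_sum fun x _ => ((hX i x).mul (hY x j)).contDiffAt]
  simp only [Finset.mul_sum]
  rw [Finset.sum_comm]
  refine Finset.sum_congr rfl fun x _ => ?_
  rw [iteratedDeriv_fun_mul (hX i x).contDiffAt (hY x j).contDiffAt]
  exact Finset.sum_congr rfl fun s _ => by ring

lemma matDeriv_mul' {a b c r : ℕ} {X : ℝ → Matrix (Fin a) (Fin b) ℂ}
    {Y : ℝ → Matrix (Fin b) (Fin c) ℂ}
    (hX : ∀ i j, ContDiff ℝ ((r : ℕ) : WithTop ℕ∞) fun ω => X ω i j)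
    (hY : ∀ i j, ContDiff ℝ ((r : ℕ) : WithTop ℕ∞) fun ω => Y ω i j) (ω : ℝ) (i : Fin a)
    (j : Fin c) :
    matDeriv r (fun w => X w * Y w) ω i j = ∑ s ∈ Finset.range (r + 1),
      (r.choose s : ℂ) * (matDeriv (r - s) X ω * matDeriv s Y ω) i j := by
  rw [matDeriv_mul hX hY, ← Finset.sum_range_reflect]
  refine Finset.sum_congr rfl fun s hs => ?_
  have hs' := Finset.mem_range.1 hs
  rw [show r + 1 - 1 - s = r - s by omega, Nat.choose_symm (by omega),
    show r - (r - s) = s by omega]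

lemma matDeriv_conjTranspose {a b : ℕ} (X : ℝ → Matrix (Fin a) (Fin b) ℂ) (r : ℕ) (ω : ℝ) :
    matDeriv r (fun w => (X w)ᴴ) ω = (matDeriv r X ω)ᴴ := by
  ext i j
  simp only [matDeriv, Matrix.of_apply, Matrix.conjTranspose_apply]
  exact iteratedDeriv_fun_star _ _ _

lemma contDiff_matrix_mul {a b c r : ℕ} {X : ℝ → Matrix (Fin a) (Fin b) ℂ}
    {Y : ℝ → Matrix (Fin b) (Fin c) ℂ}
    (hX : ∀ i j, ContDiff ℝ ((r : ℕ) : WithTop ℕ∞) fun ω => X ω i j)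
    (hY : ∀ i j, ContDiff ℝ ((r : ℕ) : WithTop ℕ∞) fun ω => Y ω i j) (i : Fin a) (j : Fin c) :
    ContDiff ℝ ((r : ℕ) : WithTop ℕ∞) fun ω => (X ω * Y ω) i j := by
  simp only [Matrix.mul_apply]
  exact ContDiff.sum fun x _ => (hX i x).mul (hY x j)

lemma contDiff_star {F : ℝ → ℂ} {r : ℕ} (hF : ContDiff ℝ ((r : ℕ) : WithTop ℕ∞) F) :
    ContDiff ℝ ((r : ℕ) : WithTop ℕ∞) fun ω => star (F ω) :=
  (conjCLE.contDiff).comp hF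

/-- Trades the stages that are present for the full Leibniz sum minus the stages that are missing.
-/
lemma sum_range_eq_sub_sum_Icc {f : ℕ → ℂ} {b : ℕ} (hf : ∀ ℓ, b < ℓ → f ℓ = 0) (K : ℕ) :
    ∑ ℓ ∈ Finset.range K, f ℓ = ∑ ℓ ∈ Finset.range (b + 1), f ℓ - ∑ ℓ ∈ Finset.Icc K b, f ℓ := by
  rcases le_or_gt K (b + 1) with h | h
  · rw [← Finset.sum_range_add_sum_Ico f h]
    have : Finset.Ico K (b + 1) = Finset.Icc K b := by ext x; simp
    rw [this]; ring
  · rw [← Finset.sum_range_add_sum_Ico f h.le, Finset.Icc_eq_empty (by omega), Finset.sum_empty,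
      sub_zero, Finset.sum_eq_zero (s := Finset.Ico (b + 1) K), add_zero]
    intro ℓ hℓ
    rw [Finset.mem_Ico] at hℓ
    exact hf ℓ (by omega)

/-! ### Expansion coefficients in terms of `α`, `β` and `γ` -/

namespace Transceiver

variable {NT NR NS : ℕ} (T : Transceiver NT NR NS)

/-- Coefficient of the pulse pair `(p^(a), q^(b))` in the expansion of the multi-stage
transceiver. -/
def expCoeff (a b : ℕ) (n nS : Fin NS) (ω : ℝ) : ℂ :=
  ∑ nR : Fin NR, ∑ nT : Fin NT, scalarCoeff T.KT T.KR (fun ω => star (T.B ω nR n))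
    (fun ω => T.H ω nR nT) (fun ω => T.A ω nT nS) a b ω

/-- The entries of the precoder, the receiver and the channel are `r` times continuously
differentiable. -/
structure IsSmooth (r : ℕ) : Prop where
  A : ∀ i j, ContDiff ℝ ((r : ℕ) : WithTop ℕ∞) fun ω => T.A ω i j
  B : ∀ i j, ContDiff ℝ ((r : ℕ) : WithTop ℕ∞) fun ω => T.B ω i j
  H : ∀ i j, ContDiff ℝ ((r : ℕ) : WithTop ℕ∞) fun ω => T.H ω i j

variable {T}

lemma IsSmooth.of_le {r s : ℕ} (h : T.IsSmooth r) (hs : s ≤ r) : T.IsSmooth s :=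
  have hle : ((s : ℕ) : WithTop ℕ∞) ≤ ((r : ℕ) : WithTop ℕ∞) := by exact_mod_cast hs
  ⟨fun i j => (h.A i j).of_le hle, fun i j => (h.B i j).of_le hle, fun i j => (h.H i j).of_le hle⟩

lemma IsSmooth.matDeriv_A {r a b : ℕ} (h : T.IsSmooth r) (hab : b + a ≤ r) (i : Fin NT)
    (j : Fin NS) : ContDiff ℝ ((b : ℕ) : WithTop ℕ∞) fun ω => matDeriv a T.A ω i j :=
  contDiff_iteratedDeriv (h.A i j) hab

/-- Summed over the transmit antennas, the inner sum is Leibniz' rule for the derivatives of `H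
A^(a)`. -/
lemma expCoeff_eq {a b : ℕ} (h : T.IsSmooth (a + b)) (n nS : Fin NS) (ω : ℝ) :
    T.expCoeff a b n nS ω = (altSum T.KT a : ℂ) * (-I) ^ (a + b) /
      ((a.factorial : ℂ) * (b.factorial : ℂ)) * ∑ ℓ ∈ Finset.range T.KR, (b.choose ℓ : ℂ) *
        ((matDeriv ℓ T.B ω)ᴴ * matDeriv (b - ℓ) (fun w => T.H w * matDeriv a T.A w) ω) n nS := by
  simp only [expCoeff, scalarCoeff, ← Finset.mul_sum]
  congr 1
  have hinner : ∀ ℓ, ∀ nR, matDeriv (b - ℓ) (fun w => T.H w * matDeriv a T.A w) ω nR nS =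
      ∑ s ∈ Finset.range (b - ℓ + 1), ((b - ℓ).choose s : ℂ) *
        ∑ nT, (iteratedDeriv (b - ℓ - s) (fun ω => T.H ω nR nT) ω *
          iteratedDeriv (a + s) (fun ω => T.A ω nT nS) ω) := by
    intro ℓ nR
    rw [matDeriv_mul' (h.of_le (by omega : b - ℓ ≤ a + b)).H
      (fun i j => h.matDeriv_A (by omega) i j)]
    refine Finset.sum_congr rfl fun s _ => ?_
    rw [Matrix.mul_apply]
    congr 1
    refine Finset.sum_congr rfl fun nT _ => ?_
    rw [matDeriv_matDeriv]
    rfl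
  rw [sum_sum_sum_comm]
  refine Finset.sum_congr rfl fun ℓ _ => ?_
  rw [Matrix.mul_apply, Finset.mul_sum]
  refine Finset.sum_congr rfl fun nR _ => ?_
  rw [Matrix.conjTranspose_apply, hinner, iteratedDeriv_fun_star]
  simp only [matDeriv, Matrix.of_apply, Finset.mul_sum]
  exact Finset.sum_comm

variable (T) in
/-- The part of the coefficient of `(p^(a), q^(b))` due to the receive stages of order at least
`K_R`. -/
def expTail (a b : ℕ) (n nS : Fin NS) (ω : ℝ) : ℂ :=
  (altSum T.KT a : ℂ) * (-I) ^ (a + b) / ((a.factorial : ℂ) * (b.factorial : ℂ)) *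
    ∑ ℓ ∈ Finset.Icc T.KR b, (b.choose ℓ : ℂ) *
      ((matDeriv ℓ T.B ω)ᴴ * matDeriv (b - ℓ) (fun w => T.H w * matDeriv a T.A w) ω) n nS

/-- With all receive stages the sum over `ℓ` would be Leibniz' rule for `Bᴴ (H A^(a))`; the stages
from `KR` on are subtracted. -/
lemma expCoeff_eq_sub {a b : ℕ} (h : T.IsSmooth (a + b)) (n nS : Fin NS) (ω : ℝ) :
    T.expCoeff a b n nS ω = (altSum T.KT a : ℂ) * (-I) ^ (a + b) /
      ((a.factorial : ℂ) * (b.factorial : ℂ)) *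
        matDeriv b (fun w => (T.B w)ᴴ * T.H w * matDeriv a T.A w) ω n nS -
      T.expTail a b n nS ω := by
  rw [expCoeff_eq h, expTail, ← mul_sub]
  congr 1
  rw [sum_range_eq_sub_sum_Icc (b := b) (fun ℓ hℓ => by
    rw [Nat.choose_eq_zero_of_lt hℓ]; simp)]
  congr 1
  have hb := h.of_le (by omega : b ≤ a + b)
  simp only [Matrix.mul_assoc]
  rw [matDeriv_mul (X := fun w => (T.B w)ᴴ) (Y := fun w => T.H w * matDeriv a T.A w)
    (fun i j => by
      simp only [Matrix.conjTranspose_apply]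
      exact contDiff_star (hb.B j i))
    (contDiff_matrix_mul hb.H (fun i j => h.matDeriv_A (by omega) i j))]
  simp only [matDeriv_conjTranspose]

lemma matDeriv_zero {a b : ℕ} (X : ℝ → Matrix (Fin a) (Fin b) ℂ) (ω : ℝ) :
    matDeriv 0 X ω = X ω := by
  ext i j
  simp [matDeriv]

lemma matDeriv_const_one {a : ℕ} (b : ℕ) (ω : ℝ) :
    matDeriv b (fun _ => (1 : Matrix (Fin a) (Fin a) ℂ)) ω = if b = 0 then 1 else 0 := by
  ext i j
  simp only [matDeriv, Matrix.of_apply, iteratedDeriv_const]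
  split_ifs <;> rfl

lemma sqrt_two_inv_mul (z : ℂ) : (1 / (Real.sqrt 2 : ℂ)) * ((Real.sqrt 2 : ℂ) * z) = z := by
  have : (Real.sqrt 2 : ℂ) ≠ 0 := by
    exact_mod_cast (Real.sqrt_pos.2 (by norm_num : (0 : ℝ) < 2)).ne'
  field_simp

/-- Without transmit derivatives the full product is `Bᴴ H A = 1`, whose derivatives vanish. Only
the missing receive stages remain. -/
lemma expCoeff_zero {b : ℕ} (hKT : 1 ≤ T.KT) (h : T.IsSmooth b)
    (hinv : ∀ ω, (T.B ω)ᴴ * T.H ω * T.A ω = 1) (n nS : Fin NS) (ω : ℝ) :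
    T.expCoeff 0 b n nS ω = (if b = 0 then (1 : Matrix (Fin NS) (Fin NS) ℂ) n nS else 0) -
      (1 / (Real.sqrt 2 : ℂ)) * ∑ ℓ ∈ Finset.Icc T.KR b, T.beta b ℓ n nS ω := by
  rw [expCoeff_eq_sub (by simpa using h)]
  congr 1
  · simp only [matDeriv_zero, hinv, matDeriv_const_one]
    by_cases hb : b = 0
    · subst hb
      simp [altSum_zero hKT]
    · simp [hb]
  · rw [expTail, altSum_zero hKT, Finset.mul_sum, Finset.mul_sum]
    refine Finset.sum_congr rfl fun ℓ _ => ?_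
    have h0 : (fun w => T.H w * matDeriv 0 T.A w) = fun w => T.H w * T.A w := by
      ext1 w; rw [matDeriv_zero]
    rw [h0, beta, ← sqrt_two_inv_mul (((1 : ℝ) : ℂ) * (-I) ^ (0 + b) /
      (((Nat.factorial 0 : ℕ) : ℂ) * (b.factorial : ℂ)) * _)]
    congr 1
    simp only [ofReal_one, one_mul, zero_add, Nat.factorial_zero, Nat.cast_one]
    ring

/-- Leibniz' rule for `(Bᴴ H) A^(a)` produces `(Bᴴ H)^(b-s) A^(a+s)`, which is `α` with `ℓ = a + s`;
the factor `ℓ.choose a` removes the indices `ℓ < a`. -/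
lemma expCoeff_pos {a b : ℕ} (hKT : 1 ≤ T.KT) (ha : 1 ≤ a) (h : T.IsSmooth (a + b))
    (n nS : Fin NS) (ω : ℝ) :
    T.expCoeff a b n nS ω = -((1 / (Real.sqrt 2 : ℂ)) * ∑ ℓ ∈ Finset.range (a + b + 1),
        (((-1 : ℝ) ^ (a + T.KT) * (ℓ.choose a : ℝ) * ((a - 1).choose (T.KT - 1) : ℝ) : ℝ) : ℂ) *
          T.alpha (a + b) ℓ n nS ω) - T.expTail a b n nS ω := by
  rw [expCoeff_eq_sub h]
  congr 1
  have hb := h.of_le (by omega : b ≤ a + b)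
  rw [matDeriv_mul' (X := fun w => (T.B w)ᴴ * T.H w) (Y := matDeriv a T.A)
    (contDiff_matrix_mul (fun i j => by
      simp only [Matrix.conjTranspose_apply]
      exact contDiff_star (hb.B j i)) hb.H) (fun i j => h.matDeriv_A (by omega) i j),
    add_assoc a b 1, Finset.sum_range_add _ a (b + 1), Finset.sum_eq_zero (s := Finset.range a), zero_add,
    Finset.mul_sum, Finset.mul_sum, ← Finset.sum_neg_distrib]
  · refine Finset.sum_congr rfl fun s hs => ?_
    have hs' := Finset.mem_range.1 hs
    rw [alpha, altSum_succ hKT ha, matDeriv_matDeriv, show a + b - (a + s) = b - s by omega]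
    -- Choosing `a + s` of `a + b` elements and then `a` of these is choosing `a` first and then `s`
    -- of the remaining `b`.
    have hch : ((a + b).choose (a + s) : ℂ) * ((a + s).choose a : ℂ) *
        ((a.factorial : ℂ) * (b.factorial : ℂ)) = ((a + b).factorial : ℂ) * (b.choose s : ℂ) := by
      have h1 := Nat.choose_mul (n := a + b) (k := a + s) (s := a) (by omega)
      rw [show a + b - a = b by omega, show a + s - a = s by omega] at h1
      have h2 := Nat.add_choose_mul_factorial_mul_factorial a b
      rw [← Nat.choose_symm_add] at h2
      have h3 : (a + b).choose (a + s) * (a + s).choose a * (a.factorial * b.factorial) =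
          (a + b).factorial * b.choose s := by
        rw [h1, ← h2]; ring
      exact_mod_cast h3
    have hs2 : (Real.sqrt 2 : ℂ) ≠ 0 := by
      exact_mod_cast (Real.sqrt_pos.2 (by norm_num : (0 : ℝ) < 2)).ne'
    have hf1 : (a.factorial : ℂ) ≠ 0 := by exact_mod_cast Nat.factorial_ne_zero a
    have hf2 : (b.factorial : ℂ) ≠ 0 := by exact_mod_cast Nat.factorial_ne_zero b
    have hf3 : ((a + b).factorial : ℂ) ≠ 0 := by exact_mod_cast Nat.factorial_ne_zero (a + b)
    have hch' : (b.choose s : ℂ) / ((a.factorial : ℂ) * (b.factorial : ℂ)) =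
        ((a + b).choose (a + s) : ℂ) * ((a + s).choose a : ℂ) / ((a + b).factorial : ℂ) := by
      rw [div_eq_div_iff (mul_ne_zero hf1 hf2) hf3]
      linear_combination -hch
    push_cast
    generalize (matDeriv (b - s) (fun w => (T.B w)ᴴ * T.H w) ω * matDeriv (a + s) T.A ω) n nS = Z
    have e1 : (1 / (Real.sqrt 2 : ℂ)) * (Real.sqrt 2 : ℂ) = 1 := by field_simp
    linear_combination (-((-1 : ℂ) ^ (a + T.KT) * ((a - 1).choose (T.KT - 1) : ℂ)) *
      (-I) ^ (a + b) * Z) * hch' - (-((-1 : ℂ) ^ (a + T.KT) * ((a + s).choose a : ℂ) *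
      ((a - 1).choose (T.KT - 1) : ℂ)) * ((-I) ^ (a + b) / ((a + b).factorial : ℂ) *
      ((a + b).choose (a + s) : ℂ) * Z)) * e1
  · intro ℓ hℓ
    rw [Nat.choose_eq_zero_of_lt (Finset.mem_range.1 hℓ)]
    simp

/-- The transmit stages cancel orders below `KT`, and no receive stage is missing below order `KR`.
-/
lemma expTail_eq_zero {a b : ℕ} (ha : 1 ≤ a) (h : a < T.KT ∨ b < T.KR) (n nS : Fin NS) (ω : ℝ) :
    T.expTail a b n nS ω = 0 := by
  rcases h with h | h
  · rw [expTail, altSum_eq_zero ha h]; simp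
  · rw [expTail, Finset.Icc_eq_empty (by omega)]; simp

lemma expTail_K_K (hKT : 1 ≤ T.KT) (hK : T.KR = T.KT) (n nS : Fin NS) (ω : ℝ) :
    T.expTail T.K T.K n nS ω = -((1 / (Real.sqrt 2 : ℂ)) * T.gamma n nS ω) := by
  have hK1 : T.K = T.KT := by rw [K, hK, min_self]
  rw [expTail, hK1, hK, altSum_succ hKT hKT, Finset.Icc_self, Finset.sum_singleton,
    Nat.choose_self, Nat.sub_self, matDeriv_zero, gamma, hK, ← Matrix.mul_assoc,
    mul_div_assoc (Real.sqrt 2 : ℂ), mul_assoc (Real.sqrt 2 : ℂ), sqrt_two_inv_mul,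
    Nat.choose_self, ← two_mul, pow_mul (-1 : ℝ)]
  push_cast
  ring

end Transceiver

/-! ### Approximation of the error coefficients by finite expansions -/

lemma norm_phase (M : ℕ) (k : Fin (2 * M)) : ‖phase M k‖ = 1 := by
  rw [phase, show -(I * Real.pi * ((M : ℂ) + 1) * ((k : ℕ) : ℂ) / (2 * (M : ℂ))) =
    I * ((-(Real.pi * (M + 1) * ((k : ℕ) : ℝ) / (2 * M)) : ℝ) : ℂ) by push_cast; ring]
  exact norm_exp_I_mul_ofReal _

lemma norm_unitFactor (o e : Fin 2) : ‖unitFactor o e‖ = 1 := by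
  rw [unitFactor]
  split_ifs <;> simp

/-- The folded pulse with the contribution of an ideal transceiver removed. -/
def centeredPulse (κ M : ℕ) (p q : ℤ → ℝ) (d : ℤ) (i : Fin (2 * M)) : ℝ :=
  foldedPulse κ M p q d i - if d = 2 * (κ : ℤ) then 1 / 2 else 0

/-- By `sum_chirp` the constant `1/2` at lag `2κ` contributes `(1/M) · (1/2) · 2M = 1` on the
receiving subcarrier and nothing elsewhere: exactly the wanted symbol. -/
lemma foldCoeff_centeredPulse {κ M N : ℕ} (hM : 1 ≤ M) (p q : ℤ → ℝ) (k : Fin (2 * M))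
    (ℓ : Fin N) (o : Fin 2) (x : Fin (2 * M) × Fin N × Fin 2) :
    foldCoeff k (centeredPulse κ M p q) (((ℓ : ℕ) : ℤ) + κ) o x =
      foldCoeff k (foldedPulse κ M p q) (((ℓ : ℕ) : ℤ) + κ) o x -
        if x = (k, ℓ, o) then 1 else 0 := by
  have hM0 : (M : ℂ) ≠ 0 := by exact_mod_cast (by omega : M ≠ 0)
  obtain ⟨k', c1, c2⟩ := x
  have hlin : ∀ d, chirpSum M k k' (centeredPulse κ M p q d) =
      chirpSum M k k' (foldedPulse κ M p q d) -
        (if d = 2 * (κ : ℤ) then 1 / 2 else 0) * ∑ i, chirp M k k' i := by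
    intro d
    simp only [chirpSum, centeredPulse, Finset.mul_sum, ← Finset.sum_sub_distrib]
    refine Finset.sum_congr rfl fun i _ => ?_
    split_ifs <;> push_cast <;> ring
  simp only [foldCoeff, hlin]
  rw [mul_sub, mul_sub]
  congr 1
  rw [sum_chirp hM]
  -- Lag `2κ` occurs only for the wanted column, because the types `o` and `c2` are bits.
  have hd : 2 * (((ℓ : ℕ) : ℤ) + κ) + ((o : ℕ) : ℤ) - (2 * ((c1 : ℕ) : ℤ) + ((c2 : ℕ) : ℤ)) =
      2 * (κ : ℤ) ↔ c1 = ℓ ∧ c2 = o := by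
    have h1 := o.2
    have h2 := c2.2
    rw [Fin.ext_iff, Fin.ext_iff]
    omega
  by_cases hc : c1 = ℓ ∧ c2 = o
  · rw [if_pos (hd.2 hc), hd.2 hc]
    have hcos : Real.cos ((((k' : ℕ) : ℤ) * (2 * (κ : ℤ)) : ℤ) * Real.pi) = 1 := by
      have := Real.cos_nat_mul_two_pi ((k' : ℕ) * κ)
      push_cast at this ⊢
      rw [← this]
      congr 1
      ring
    rw [hcos, unitFactor, if_pos hc.2]
    by_cases hk : k' = k
    · rw [if_pos hk, if_pos (by rw [hk, hc.1, hc.2])]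
      push_cast
      field_simp
    · rw [if_neg hk, if_neg (fun h => hk (congrArg Prod.fst h))]
      simp
  · rw [if_neg (fun h => hc (hd.1 h)),
      if_neg (show ¬ (k', c1, c2) = (k, ℓ, o) from fun h =>
        hc (Prod.mk.inj (Prod.mk.inj h).2))]
    simp

namespace Transceiver

variable {NT NR NS : ℕ} {T : Transceiver NT NR NS}

lemma K_bounds {R : ℕ} (h1 : T.PulseAssumption R) :
    2 * T.K ≤ R ∧ T.KT ≤ R ∧ T.KR ≤ R ∧ T.K ≤ T.KT ∧ T.K ≤ T.KR := by
  have := h1.stages_le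
  have h2 : T.K ≤ T.KT := min_le_left _ _
  have h3 : T.K ≤ T.KR := min_le_right _ _
  omega

lemma ChannelAssumption.isSmooth {R R' : ℕ} (h2 : T.ChannelAssumption R R') :
    T.IsSmooth (R' + 1) :=
  ⟨fun i j => (h2.A_smooth i j).1, fun i j => (h2.B_smooth i j).1, fun i j => (h2.H_smooth i j).1⟩

/-- The scalar expansion with `D = 2K + 1`, summed over the antenna pairs. The filterbank factor `1
/ M` compensates the `O(M)` samples in its error bound. -/
lemma exists_bound_symbolCoeff_sub (hKT : 1 ≤ T.KT) (hKR : 1 ≤ T.KR) {R R' : ℕ}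
    (h1 : T.PulseAssumption R) (h2 : T.ChannelAssumption R R') :
    ∃ C : ℝ, 0 ≤ C ∧ ∀ M : ℕ, 1 ≤ M → ∀ (n nS : Fin NS) (k k' : Fin (2 * M)) (d : ℤ),
      ‖T.symbolCoeff M n nS k k' ((M : ℤ) * d + 1) -
        ∑ a ∈ Finset.range (2 * T.K + 1), ∑ b ∈ Finset.range (2 * T.K + 1),
          (((2 * (M : ℝ))⁻¹ ^ (a + b) : ℝ) : ℂ) * T.expCoeff a b n nS (freq M k) *
            (((Real.cos ((((k' : ℕ) : ℤ) * d : ℤ) * Real.pi) / M : ℝ) : ℂ) *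
              chirpSum M k k' (foldedPulse T.κ M (T.pS M a) (T.qS M b) d))‖ ≤
        C * (2 * (M : ℝ))⁻¹ ^ (2 * T.K + 1) := by
  obtain ⟨hK, hKTR, hKRR, -, -⟩ := K_bounds h1
  have hst := h1.stages_le
  set D := 2 * T.K + 1 with hD
  obtain ⟨Cp, hCp0, hCp⟩ := exists_bound_pulseDeriv h1.Ts_pos h1.κ_pos h1.p_smooth
  obtain ⟨Cq, hCq0, hCq⟩ := exists_bound_pulseDeriv h1.Ts_pos h1.κ_pos h1.q_smooth
  -- From `KT + KR ≤ R` and `D ≤ R + 1`, the needed smoothness is at most `3R + 4`, below the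
  -- quadratic bound on `R'`.
  have hsmooth := h2.isSmooth.of_le (s := T.KT + T.KR + 2 * D + 2) (by
    have := h2.lt
    have : 2 ≤ R := by omega
    nlinarith)
  have hsc := fun (n nS : Fin NS) (nR : Fin NR) (nT : Fin NT) => exists_bound_transferCoeff_sub
    (KT := T.KT) (KR := T.KR) (κ := T.κ) (L := R + 1) (D := D)
    (P := pulseDeriv T.Ts T.κ T.p) (Q := pulseDeriv T.Ts T.κ T.q)
    (B := fun ω => star (T.B ω nR n)) (H := fun ω => T.H ω nR nT) (A := fun ω => T.A ω nT nS)
    (C := Cp + Cq)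
    (fun r hr y => hasDerivAt_pulseDeriv h1.Ts_pos h1.κ_pos h1.p_smooth h1.p_end hr y)
    (fun r hr y => (hCp r hr y).trans (by linarith))
    (fun r hr y => hasDerivAt_pulseDeriv h1.Ts_pos h1.κ_pos h1.q_smooth h1.q_end hr y)
    (fun r hr y => (hCq r hr y).trans (by linarith))
    (fun M hM r n hn => by
      rw [← pulseSample_eq_pulseDeriv h1.Ts_pos T.κ hM]; exact pulseSample_eq_zero hn)
    (fun M hM r n hn => by
      rw [← pulseSample_eq_pulseDeriv h1.Ts_pos T.κ hM]; exact pulseSample_eq_zero hn)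
    (by omega) (by omega) (by omega)
    (contDiff_star (hsmooth.B nR n)) (fun ω => congrArg star ((h2.B_smooth nR n).2 ω))
    (hsmooth.H nR nT) (h2.H_smooth nR nT).2 (hsmooth.A nT nS) (h2.A_smooth nT nS).2
  choose C hC0 hC using hsc
  have hC2 : ∀ n nS, 0 ≤ ∑ nR, ∑ nT, C n nS nR nT := fun n nS =>
    Finset.sum_nonneg fun nR _ => Finset.sum_nonneg fun nT _ => hC0 n nS nR nT
  have hC1 : ∀ n, 0 ≤ ∑ nS, ∑ nR, ∑ nT, C n nS nR nT := fun n =>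
    Finset.sum_nonneg fun nS _ => hC2 n nS
  refine ⟨∑ n, ∑ nS, ∑ nR, ∑ nT, C n nS nR nT, Finset.sum_nonneg fun n _ => hC1 n, ?_⟩
  intro M hM n nS k k' d
  have hM0 : (0 : ℝ) < M := by exact_mod_cast hM
  have hp : ∀ r, T.pS M r = fun n => pulseDeriv T.Ts T.κ T.p r (samplePoint T.κ M n) :=
    fun r => funext fun n => pulseSample_eq_pulseDeriv h1.Ts_pos T.κ hM T.p r n
  have hq : ∀ r, T.qS M r = fun n => pulseDeriv T.Ts T.κ T.q r (samplePoint T.κ M n) :=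
    fun r => funext fun n => pulseSample_eq_pulseDeriv h1.Ts_pos T.κ hM T.q r n
  have hC' := fun nR nT => hC n nS nR nT M hM (freq M k) (freq M k') ((M : ℤ) * d + 1)
  simp only [← hp, ← hq] at hC'
  have hp' : (fun (r : ℕ) (n : ℤ) => pulseDeriv T.Ts T.κ T.p r (samplePoint T.κ M n)) = T.pS M :=
    funext fun r => (hp r).symm
  have hq' : (fun (r : ℕ) (n : ℤ) => pulseDeriv T.Ts T.κ T.q r (samplePoint T.κ M n)) = T.qS M :=
    funext fun r => (hq r).symm
  simp only [hp', hq'] at hC'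
  have hmain : ∑ a ∈ Finset.range D, ∑ b ∈ Finset.range D,
          (((2 * (M : ℝ))⁻¹ ^ (a + b) : ℝ) : ℂ) * T.expCoeff a b n nS (freq M k) *
            (((Real.cos ((((k' : ℕ) : ℤ) * d : ℤ) * Real.pi) / M : ℝ) : ℂ) *
              chirpSum M k k' (foldedPulse T.κ M (T.pS M a) (T.qS M b) d)) =
      phase M k * star (phase M k') / (M : ℂ) * ∑ nR, ∑ nT, ∑ a ∈ Finset.range D,
        ∑ b ∈ Finset.range D, (((2 * (M : ℝ))⁻¹ ^ (a + b) : ℝ) : ℂ) *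
          scalarCoeff T.KT T.KR (fun ω => star (T.B ω nR n)) (fun ω => T.H ω nR nT)
            (fun ω => T.A ω nT nS) a b (freq M k) *
          flatCoeff T.κ M (T.pS M a) (T.qS M b) (freq M k) (freq M k') ((M : ℤ) * d + 1) := by
    rw [sum_sum_sum_comm, Finset.mul_sum]
    refine Finset.sum_congr rfl fun a _ => ?_
    rw [sum_sum_sum_comm, Finset.mul_sum]
    refine Finset.sum_congr rfl fun b _ => ?_
    rw [← phase_mul_flatCoeff hM, expCoeff]
    simp only [Finset.mul_sum, Finset.sum_mul]
    refine Finset.sum_congr rfl fun nR _ => Finset.sum_congr rfl fun nT _ => ?_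
    ring
  rw [hmain, symbolCoeff, ← mul_sub, ← Finset.sum_sub_distrib]
  simp only [← Finset.sum_sub_distrib]
  rw [norm_mul, norm_div, norm_mul, norm_star, norm_phase, norm_phase, one_mul,
    Complex.norm_natCast]
  have hsum : ∑ nR, ∑ nT, C n nS nR nT ≤ ∑ n, ∑ nS, ∑ nR, ∑ nT, C n nS nR nT := by
    refine le_trans ?_ (Finset.single_le_sum (f := fun n => ∑ nS, ∑ nR, ∑ nT, C n nS nR nT)
      (fun n _ => hC1 n) (Finset.mem_univ n))
    exact Finset.single_le_sum (f := fun nS => ∑ nR, ∑ nT, C n nS nR nT)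
      (fun nS _ => hC2 n nS) (Finset.mem_univ nS)
  calc 1 / (M : ℝ) * _ ≤ 1 / (M : ℝ) * ∑ nR, ∑ nT, C n nS nR nT * (M * (2 * (M : ℝ))⁻¹ ^ D) := by
        gcongr
        exact norm_sum_le_of_le _ fun nR _ => norm_sum_le_of_le _ fun nT _ => hC' nR nT
    _ = (∑ nR, ∑ nT, C n nS nR nT) * (2 * (M : ℝ))⁻¹ ^ D := by
        simp only [← Finset.sum_mul]
        field_simp
    _ ≤ _ := by gcongr

variable (T) in
/-- The coefficients of the expansion without the ideal part. -/
def residualCoeff (a b : ℕ) (n nS : Fin NS) (ω : ℝ) : ℂ :=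
  if a = 0 ∧ b = 0 then 0 else T.expCoeff a b n nS ω

variable (T) in
/-- The expansion of `errorCoeff` up to terms of order `M^(-2K-1)`. -/
def mainCoeff {M N : ℕ} (n : Fin NS) (k : Fin (2 * M)) (ℓ : Fin N) (o : Fin 2)
    (y : Fin NS × Fin (2 * M) × Fin N × Fin 2) : ℝ :=
  (if y.1 = n then (foldCoeff k (centeredPulse T.κ M (T.pS M 0) (T.qS M 0))
    (((ℓ : ℕ) : ℤ) + T.κ) o y.2).re else 0) +
    ∑ a ∈ Finset.range (2 * T.K + 1), ∑ b ∈ Finset.range (2 * T.K + 1),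
      ((((2 * (M : ℝ))⁻¹ ^ (a + b) : ℝ) : ℂ) * T.residualCoeff a b n y.1 (freq M k) *
        foldCoeff k (foldedPulse T.κ M (T.pS M a) (T.qS M b)) (((ℓ : ℕ) : ℤ) + T.κ) o y.2).re

/-- The pair `(0, 0)` has coefficient `1` on the wanted stream and `0` on the others. Combined with
the subtraction of the wanted symbol it becomes the centered pulse, which is why `residualCoeff`
omits it. -/
lemma exists_bound_errorCoeff_sub (hKT : 1 ≤ T.KT) (hKR : 1 ≤ T.KR) {R R' : ℕ}
    (h1 : T.PulseAssumption R) (h2 : T.ChannelAssumption R R') (N : ℕ) :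
    ∃ C : ℝ, 0 ≤ C ∧ ∀ M : ℕ, 1 ≤ M → ∀ (n : Fin NS) (k : Fin (2 * M)) (ℓ : Fin N) (o : Fin 2)
      (y : Fin NS × Fin (2 * M) × Fin N × Fin 2),
      |T.errorCoeff n k ℓ o y - T.mainCoeff n k ℓ o y| ≤ C * (2 * (M : ℝ))⁻¹ ^ (2 * T.K + 1) := by
  obtain ⟨C, hC0, hC⟩ := exists_bound_symbolCoeff_sub hKT hKR h1 h2
  refine ⟨C, hC0, ?_⟩
  intro M hM n k ℓ o y
  obtain ⟨nS, x⟩ := y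
  have hb := hC M hM n nS k x.1 (2 * (((ℓ : ℕ) : ℤ) + T.κ) + ((o : ℕ) : ℤ) -
    (2 * ((x.2.1 : ℕ) : ℤ) + ((x.2.2 : ℕ) : ℤ)))
  set f : ℕ → ℕ → ℂ := fun a b => (((2 * (M : ℝ))⁻¹ ^ (a + b) : ℝ) : ℂ) *
    T.expCoeff a b n nS (freq M k) *
    foldCoeff k (foldedPulse T.κ M (T.pS M a) (T.qS M b)) (((ℓ : ℕ) : ℤ) + T.κ) o x with hf
  have h00 : T.expCoeff 0 0 n nS (freq M k) = if nS = n then 1 else 0 := by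
    rw [expCoeff_zero hKT (h2.isSmooth.of_le (Nat.zero_le _)) h2.inverse,
      Finset.Icc_eq_empty (by omega), if_pos rfl, Matrix.one_apply]
    simp [eq_comm]
  have hmain : T.mainCoeff n k ℓ o (nS, x) =
      (∑ a ∈ Finset.range (2 * T.K + 1), ∑ b ∈ Finset.range (2 * T.K + 1), f a b).re -
        if (nS, x) = (n, k, ℓ, o) then 1 else 0 := by
    have hsplit : ∀ a b, ((((2 * (M : ℝ))⁻¹ ^ (a + b) : ℝ) : ℂ) *
        T.residualCoeff a b n nS (freq M k) *
        foldCoeff k (foldedPulse T.κ M (T.pS M a) (T.qS M b)) (((ℓ : ℕ) : ℤ) + T.κ) o x).re =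
        (f a b).re - if a = 0 then (if b = 0 then (f 0 0).re else 0) else 0 := by
      intro a b
      rw [residualCoeff]
      by_cases ha : a = 0
      · by_cases hb : b = 0
        · subst ha hb; simp
        · simp [ha, hb, hf]
      · simp [ha, hf]
    simp only [mainCoeff, hsplit, Finset.sum_sub_distrib, re_sum]
    have hmem : 0 ∈ Finset.range (2 * T.K + 1) := Finset.mem_range.2 (by omega)
    have hz : ∑ a ∈ Finset.range (2 * T.K + 1), ∑ b ∈ Finset.range (2 * T.K + 1),
        (if a = 0 then (if b = 0 then (f 0 0).re else 0) else 0) = (f 0 0).re := by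
      rw [Finset.sum_eq_single_of_mem 0 hmem (fun a _ ha => by simp [ha]),
        Finset.sum_eq_single_of_mem 0 hmem (fun b _ hb => by simp [hb])]
      simp
    rw [hz, foldCoeff_centeredPulse hM]
    simp only [hf, h00, Prod.mk.injEq]
    by_cases hn : nS = n
    · simp only [hn, if_true, true_and]
      by_cases hx : x = (k, ℓ, o)
      · simp [hx]
      · simp [hx]
    · simp [hn]
  rw [hmain, errorCoeff, sub_sub_sub_cancel_right, ← sub_re]
  refine (abs_re_le_norm _).trans (le_trans (le_of_eq ?_) hb)
  have hfac : ∑ a ∈ Finset.range (2 * T.K + 1), ∑ b ∈ Finset.range (2 * T.K + 1), f a b =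
      unitFactor o x.2.2 * ∑ a ∈ Finset.range (2 * T.K + 1), ∑ b ∈ Finset.range (2 * T.K + 1),
          (((2 * (M : ℝ))⁻¹ ^ (a + b) : ℝ) : ℂ) * T.expCoeff a b n nS (freq M k) *
            (((Real.cos ((((x.1 : ℕ) : ℤ) * (2 * (((ℓ : ℕ) : ℤ) + T.κ) + ((o : ℕ) : ℤ) -
    (2 * ((x.2.1 : ℕ) : ℤ) + ((x.2.2 : ℕ) : ℤ))) : ℤ) * Real.pi) / M : ℝ) : ℂ) *
              chirpSum M k x.1 (foldedPulse T.κ M (T.pS M a) (T.qS M b)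
                (2 * (((ℓ : ℕ) : ℤ) + T.κ) + ((o : ℕ) : ℤ) -
    (2 * ((x.2.1 : ℕ) : ℤ) + ((x.2.2 : ℕ) : ℤ))))) := by
    simp only [Finset.mul_sum]
    refine Finset.sum_congr rfl fun a _ => Finset.sum_congr rfl fun b _ => ?_
    rw [hf]
    simp only [foldCoeff]
    ring
  rw [hfac, ← mul_sub, norm_mul, norm_unitFactor, one_mul]
  rfl

end Transceiver

/-! ### The power of the main part of the error -/

/-- The square is expanded knowing that the real parts are orthogonal to the imaginary parts, so the
`u` and `v` contributions separate. -/
lemma sum_sq_add_sum {X S : Type*} [Fintype X] (s : Finset S) (t : ℝ) (e : X → ℝ) (u v : S → ℝ)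
    (r i : S → X → ℝ) (hei : ∀ P, ∑ x, e x * i P x = 0) (hri : ∀ P P', ∑ x, r P x * i P' x = 0) :
    ∑ x, (t * e x + ∑ P ∈ s, (u P * r P x - v P * i P x)) ^ 2 =
      t ^ 2 * ∑ x, e x * e x + 2 * t * ∑ P ∈ s, u P * ∑ x, e x * r P x +
      ∑ P ∈ s, ∑ P' ∈ s, (u P * u P' * ∑ x, r P x * r P' x + v P * v P' * ∑ x, i P x * i P' x) := by
  have h1 : ∀ x, (t * e x + ∑ P ∈ s, (u P * r P x - v P * i P x)) ^ 2 =
      t ^ 2 * (e x * e x) + ∑ P ∈ s, (2 * t * (u P * (e x * r P x)) -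
        2 * t * (v P * (e x * i P x))) +
      ∑ P ∈ s, ∑ P' ∈ s, (u P * u P' * (r P x * r P' x) + v P * v P' * (i P x * i P' x) -
        u P * v P' * (r P x * i P' x) - u P' * v P * (r P' x * i P x)) := by
    intro x
    have h2 : ∑ P ∈ s, (2 * t * (u P * (e x * r P x)) - 2 * t * (v P * (e x * i P x))) =
        2 * (t * e x) * ∑ P ∈ s, (u P * r P x - v P * i P x) := by
      rw [Finset.mul_sum]; exact Finset.sum_congr rfl fun P _ => by ring
    have h3 : ∑ P ∈ s, ∑ P' ∈ s, (u P * u P' * (r P x * r P' x) +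
        v P * v P' * (i P x * i P' x) - u P * v P' * (r P x * i P' x) -
        u P' * v P * (r P' x * i P x)) = (∑ P ∈ s, (u P * r P x - v P * i P x)) ^ 2 := by
      rw [sq, Finset.sum_mul_sum]
      exact Finset.sum_congr rfl fun P _ => Finset.sum_congr rfl fun P' _ => by ring
    rw [h2, h3]; ring
  rw [Finset.sum_congr rfl fun x _ => h1 x, Finset.sum_add_distrib, Finset.sum_add_distrib,
    ← Finset.mul_sum]
  congr 1
  · congr 1
    rw [Finset.sum_comm, Finset.mul_sum]
    refine Finset.sum_congr rfl fun P _ => ?_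
    rw [Finset.sum_sub_distrib]
    simp only [← Finset.mul_sum, hei]
    ring
  · rw [← sum_sum_sum_comm s s Finset.univ]
    refine Finset.sum_congr rfl fun P _ => Finset.sum_congr rfl fun P' _ => ?_
    rw [Finset.sum_sub_distrib, Finset.sum_sub_distrib, Finset.sum_add_distrib]
    simp only [← Finset.mul_sum, hri]
    ring

namespace Transceiver

variable {NT NR NS : ℕ} {T : Transceiver NT NR NS}

lemma isFolding_RR (T : Transceiver NT NR NS) (M a b : ℕ) :
    IsFolding T.κ M (foldedPulse T.κ M (T.pS M a) (T.qS M b)) (T.RR M a b) (T.SS M a b) :=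
  isFolding_foldedPulse _ fun _ hn => pulseSample_eq_zero hn

lemma isFolding_RR0 (T : Transceiver NT NR NS) (hκ : 1 ≤ T.κ) (M : ℕ) :
    IsFolding T.κ M (centeredPulse T.κ M (T.pS M 0) (T.qS M 0)) (T.RR0 M) (T.SS M 0 0) :=
  (T.isFolding_RR M 0 0).sub_centralOnes hκ (1 / 2)

variable (T) in
/-- The power of either part of the main error, with the second-order pulse quantities. -/
def mainPower (Ps : ℝ) (M : ℕ) (k : Fin (2 * M)) (n : Fin NS) : ℝ :=
  T.delta Ps M + 2 * ∑ P ∈ Finset.range (2 * T.K + 1) ×ˢ Finset.range (2 * T.K + 1),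
      (((2 * (M : ℝ))⁻¹ ^ (P.1 + P.2) : ℝ) * T.residualCoeff P.1 P.2 n n (freq M k)).re *
        T.mu Ps M P.1 P.2 +
    ∑ nS : Fin NS, ∑ P ∈ Finset.range (2 * T.K + 1) ×ˢ Finset.range (2 * T.K + 1),
      ∑ P' ∈ Finset.range (2 * T.K + 1) ×ˢ Finset.range (2 * T.K + 1),
        ((((2 * (M : ℝ))⁻¹ ^ (P.1 + P.2) : ℝ) * T.residualCoeff P.1 P.2 n nS (freq M k)).re *
          (((2 * (M : ℝ))⁻¹ ^ (P'.1 + P'.2) : ℝ) * T.residualCoeff P'.1 P'.2 n nS (freq M k)).re *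
          T.etaPM Ps M P.1 P.2 P'.1 P'.2 +
        (((2 * (M : ℝ))⁻¹ ^ (P.1 + P.2) : ℝ) * T.residualCoeff P.1 P.2 n nS (freq M k)).im *
          (((2 * (M : ℝ))⁻¹ ^ (P'.1 + P'.2) : ℝ) * T.residualCoeff P'.1 P'.2 n nS (freq M k)).im *
          T.etaMP Ps M P.1 P.2 P'.1 P'.2)

/-- The factors `Ps / 2` and `1 / M` merge into the normalization `Ps / (2M)` of `δ`, `μ`, `η`. The
value does not depend on `o`, so real and imaginary errors have equal power. -/
lemma sum_mainCoeff_sq {M N : ℕ} (hM : 1 ≤ M) (hκ : 1 ≤ T.κ) (Ps : ℝ) (n : Fin NS)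
    (k : Fin (2 * M)) (ℓ : Fin N) (hℓ : T.κ < (ℓ : ℕ) + 1) (hℓ' : (ℓ : ℕ) + 1 + T.κ ≤ N)
    (o : Fin 2) :
    Ps / 2 * ∑ y, T.mainCoeff n k ℓ o y ^ 2 = T.mainPower Ps M k n := by
  have hM0 : (M : ℝ) ≠ 0 := by exact_mod_cast (by omega : M ≠ 0)
  set S := Finset.range (2 * T.K + 1) ×ˢ Finset.range (2 * T.K + 1) with hS
  set c : Fin NS → ℕ × ℕ → ℂ := fun nS P =>
    ((2 * (M : ℝ))⁻¹ ^ (P.1 + P.2) : ℝ) * T.residualCoeff P.1 P.2 n nS (freq M k) with hc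
  set e : Fin (2 * M) × Fin N × Fin 2 → ℂ := fun x => foldCoeff k
    (centeredPulse T.κ M (T.pS M 0) (T.qS M 0)) (((ℓ : ℕ) : ℤ) + T.κ) o x with he
  set f : ℕ × ℕ → Fin (2 * M) × Fin N × Fin 2 → ℂ := fun P x => foldCoeff k
    (foldedPulse T.κ M (T.pS M P.1) (T.qS M P.2)) (((ℓ : ℕ) : ℤ) + T.κ) o x with hf
  have hs1 : 2 * (T.κ : ℤ) ≤ ((ℓ : ℕ) : ℤ) + T.κ := by omega
  have hs2 : ((ℓ : ℕ) : ℤ) + T.κ + 1 ≤ N := by omega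
  have hee := sum_foldCoeff hM (T.isFolding_RR0 hκ M) (T.isFolding_RR0 hκ M) k hs1 hs2 o
  have hef := fun P : ℕ × ℕ =>
    sum_foldCoeff hM (T.isFolding_RR0 hκ M) (T.isFolding_RR M P.1 P.2) k hs1 hs2 o
  have hff := fun P P' : ℕ × ℕ =>
    sum_foldCoeff hM (T.isFolding_RR M P.1 P.2) (T.isFolding_RR M P'.1 P'.2) k hs1 hs2 o
  have hmain : ∀ nS x, T.mainCoeff n k ℓ o (nS, x) = (if nS = n then 1 else 0) * (e x).re +
      ∑ P ∈ S, ((c nS P).re * (f P x).re - (c nS P).im * (f P x).im) := by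
    intro nS x
    simp only [mainCoeff]
    congr 1
    · split_ifs <;> simp [he]
    · rw [hS, Finset.sum_product]
      refine Finset.sum_congr rfl fun a _ => Finset.sum_congr rfl fun b _ => ?_
      rw [mul_re]
  rw [Fintype.sum_prod_type]
  simp only [hmain]
  have hsq := fun nS => sum_sq_add_sum S (if nS = n then (1 : ℝ) else 0) (fun x => (e x).re)
    (fun P => (c nS P).re) (fun P => (c nS P).im) (fun P x => (f P x).re) (fun P x => (f P x).im)
    (fun P => (hef P).2.2) (fun P P' => (hff P P').2.2)
  simp only [hsq]
  have hd : T.delta Ps M = Ps / 2 * ∑ x, (e x).re * (e x).re := by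
    rw [he, hee.1, delta]; field_simp
  have hmu : ∀ P : ℕ × ℕ, T.mu Ps M P.1 P.2 = Ps / 2 * ∑ x, (e x).re * (f P x).re := by
    intro P
    rw [he, hf, (hef P).1, mu]; field_simp
  have hpm : ∀ P P' : ℕ × ℕ, T.etaPM Ps M P.1 P.2 P'.1 P'.2 =
      Ps / 2 * ∑ x, (f P x).re * (f P' x).re := by
    intro P P'
    rw [hf, (hff P P').1, etaPM, eta]; field_simp
  have hmp : ∀ P P' : ℕ × ℕ, T.etaMP Ps M P.1 P.2 P'.1 P'.2 =
      Ps / 2 * ∑ x, (f P x).im * (f P' x).im := by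
    intro P P'
    rw [hf, (hff P P').2.1, etaMP, eta]; field_simp
  rw [mainPower, Finset.sum_add_distrib, Finset.sum_add_distrib, mul_add, mul_add]
  congr 1
  · congr 1
    · rw [hd]; simp
    · simp only [hmu]
      rw [Finset.sum_eq_single n (fun nS _ h => by simp [h]) (by simp), if_pos rfl, mul_one,
        Finset.mul_sum, Finset.mul_sum, Finset.mul_sum]
      exact Finset.sum_congr rfl fun P _ => by simp only [hc]; ring
  · rw [Finset.mul_sum]
    refine Finset.sum_congr rfl fun nS _ => ?_
    rw [Finset.mul_sum]
    refine Finset.sum_congr rfl fun P _ => ?_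
    rw [Finset.mul_sum]
    refine Finset.sum_congr rfl fun P' _ => ?_
    rw [hpm, hmp]
    simp only [hc]
    ring

end Transceiver

/-! ### Bounds on the pulse and channel quantities -/

/-- Two nonzero entries in a row would have columns congruent modulo `2M`. -/
lemma sum_abs_reflMat_le {M : ℕ} (i : Fin (2 * M)) : ∑ i', |reflMat M i i'| ≤ 1 := by
  have h : ∀ i', |reflMat M i i'| =
      if (2 * (M : ℤ)) ∣ ((i : ℕ) : ℤ) + ((i' : ℕ) : ℤ) + M + 1 then 1 else 0 := by
    intro i'
    rw [reflMat_apply]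
    split_ifs <;> simp
  simp only [h]
  rw [Finset.sum_boole]
  have hcard : (Finset.univ.filter fun i' : Fin (2 * M) =>
      (2 * (M : ℤ)) ∣ ((i : ℕ) : ℤ) + ((i' : ℕ) : ℤ) + M + 1).card ≤ 1 := by
    rw [Finset.card_le_one]
    intro x hx y hy
    rw [Finset.mem_filter] at hx hy
    have hd := dvd_sub hx.2 hy.2
    rw [show ((i : ℕ) : ℤ) + ((x : ℕ) : ℤ) + M + 1 - (((i : ℕ) : ℤ) + ((y : ℕ) : ℤ) + M + 1) =
      ((x : ℕ) : ℤ) - ((y : ℕ) : ℤ) by ring] at hd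
    have h1 := x.2
    have h2 := y.2
    have := Int.eq_zero_of_abs_lt_dvd hd (by rw [abs_lt]; constructor <;> omega)
    exact Fin.ext (by omega)
  exact_mod_cast hcard

lemma sum_abs_Uplus_le {M : ℕ} (i : Fin (2 * M)) : ∑ i', |Uplus M i i'| ≤ 2 := by
  have h1 : ∑ i', |(1 : Matrix (Fin (2 * M)) (Fin (2 * M)) ℝ) i i'| = 1 := by
    simp [Matrix.one_apply, apply_ite abs]
  calc ∑ i', |Uplus M i i'| ≤ ∑ i', (|(1 : Matrix (Fin (2 * M)) (Fin (2 * M)) ℝ) i i'| +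
        |reflMat M i i'|) := Finset.sum_le_sum fun i' _ => by
          rw [Uplus_eq, Matrix.add_apply]; exact abs_add_le _ _
    _ ≤ 2 := by rw [Finset.sum_add_distrib, h1]; linarith [sum_abs_reflMat_le i]

lemma sum_abs_Uminus_le {M : ℕ} (i : Fin (2 * M)) : ∑ i', |Uminus M i i'| ≤ 2 := by
  have h1 : ∑ i', |(1 : Matrix (Fin (2 * M)) (Fin (2 * M)) ℝ) i i'| = 1 := by
    simp [Matrix.one_apply, apply_ite abs]
  calc ∑ i', |Uminus M i i'| ≤ ∑ i', (|(1 : Matrix (Fin (2 * M)) (Fin (2 * M)) ℝ) i i'| +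
        |reflMat M i i'|) := Finset.sum_le_sum fun i' _ => by
          rw [Uminus_eq, Matrix.sub_apply]; exact abs_sub _ _
    _ ≤ 2 := by rw [Finset.sum_add_distrib, h1]; linarith [sum_abs_reflMat_le i]

/-- Bounded absolute row sums of `U` keep the trace at `O(M)`, which the normalization `Ps / (2M)`
then cancels. -/
lemma abs_trace_le {M κ : ℕ} {X Y : Matrix (Fin (2 * M)) (Fin (2 * κ - 1)) ℝ}
    {U : Matrix (Fin (2 * M)) (Fin (2 * M)) ℝ} {c : ℝ} (hc : 0 ≤ c) (hX : ∀ i w, |X i w| ≤ c)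
    (hY : ∀ i w, |Y i w| ≤ c) (hU : ∀ i i', U i i' = U i' i) (hU2 : ∀ i, ∑ i', |U i i'| ≤ 2) :
    |Matrix.trace (X * Yᵀ * U)| ≤ 2 * M * ((2 * κ - 1 : ℕ) * c ^ 2 * 2) := by
  rw [trace_mul_transpose_mul _ _ _ hU]
  refine (Finset.abs_sum_le_sum_abs _ _).trans ?_
  have h : ∀ i ∈ Finset.univ, |∑ i', (∑ w, X i w * Y i' w) * U i i'| ≤
      (2 * κ - 1 : ℕ) * c ^ 2 * 2 := by
    intro i _
    refine (Finset.abs_sum_le_sum_abs _ _).trans ?_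
    have h2 : ∀ i' ∈ Finset.univ, |(∑ w, X i w * Y i' w) * U i i'| ≤
        (2 * κ - 1 : ℕ) * c ^ 2 * |U i i'| := by
      intro i' _
      rw [abs_mul]
      gcongr
      refine (Finset.abs_sum_le_sum_abs _ _).trans ?_
      refine (Finset.sum_le_sum fun w _ => (?_ : _ ≤ c ^ 2)).trans (le_of_eq (by simp))
      rw [abs_mul, sq]
      exact mul_le_mul (hX i w) (hY i' w) (abs_nonneg _) hc
    refine (Finset.sum_le_sum h2).trans ?_
    rw [← Finset.mul_sum]
    gcongr
    exact hU2 i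
  refine (Finset.sum_le_sum h).trans (le_of_eq ?_)
  simp

lemma abs_rowConv_le {a κ : ℕ} {X Y : Matrix (Fin a) (Fin κ) ℝ} {c : ℝ} (hc : 0 ≤ c)
    (hX : ∀ i w, |X i w| ≤ c) (hY : ∀ i w, |Y i w| ≤ c) (i : Fin a) (w : Fin (2 * κ - 1)) :
    |rowConv X Y i w| ≤ κ * (κ * c ^ 2) := by
  rw [rowConv, Matrix.of_apply]
  refine (Finset.abs_sum_le_sum_abs _ _).trans ?_
  refine (Finset.sum_le_sum fun u _ => (?_ : _ ≤ κ * c ^ 2)).trans (le_of_eq (by simp))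
  refine (Finset.abs_sum_le_sum_abs _ _).trans ?_
  refine (Finset.sum_le_sum fun v _ => (?_ : _ ≤ c ^ 2)).trans (le_of_eq (by simp))
  split_ifs
  · rw [abs_mul, sq]
    exact mul_le_mul (hX i u) (hY i v) (abs_nonneg _) hc
  · rw [abs_zero]; positivity

lemma abs_Rmat_le {M κ : ℕ} {p q : ℤ → ℝ} {c : ℝ} (hc : 0 ≤ c) (hp : ∀ n, |p n| ≤ c)
    (hq : ∀ n, |q n| ≤ c) (i : Fin (2 * M)) (w : Fin (2 * κ - 1)) :
    |Rmat M κ p q i w| ≤ κ * (κ * c ^ 2) :=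
  abs_rowConv_le hc (fun _ _ => hp _) (fun i v => by rw [antiId_mul_polyphase]; exact hq _) i w

lemma abs_Smat_le {M κ : ℕ} {p q : ℤ → ℝ} {c : ℝ} (hc : 0 ≤ c) (hp : ∀ n, |p n| ≤ c)
    (hq : ∀ n, |q n| ≤ c) (i : Fin (2 * M)) (w : Fin (2 * κ - 1)) :
    |Smat M κ p q i w| ≤ κ * (κ * c ^ 2) := by
  refine abs_rowConv_le hc (fun i u => ?_)
    (fun i v => by rw [antiId_mul_polyphase]; exact hq _) i w
  have hi := i.2
  rcases lt_or_ge (i : ℕ) M with h | h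
  · rw [kron_antiId_mul_apply _ i ⟨(i : ℕ) + M, by omega⟩ (Or.inl rfl)]
    exact hp _
  · rw [kron_antiId_mul_apply _ i ⟨(i : ℕ) - M, by omega⟩ (Or.inr (by simp only; omega))]
    exact hp _

namespace Transceiver

variable {NT NR NS : ℕ} {T : Transceiver NT NR NS}

lemma exists_bound_folding {R : ℕ} (h1 : T.PulseAssumption R) :
    ∃ c : ℝ, 0 ≤ c ∧ ∀ M : ℕ, 1 ≤ M → (∀ i w, |T.RR0 M i w| ≤ c) ∧
      ∀ a ≤ R + 1, ∀ b ≤ R + 1, (∀ i w, |T.RR M a b i w| ≤ c) ∧ ∀ i w, |T.SS M a b i w| ≤ c := by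
  obtain ⟨Cp, hCp0, hCp⟩ := exists_bound_pulseDeriv h1.Ts_pos h1.κ_pos h1.p_smooth
  obtain ⟨Cq, hCq0, hCq⟩ := exists_bound_pulseDeriv h1.Ts_pos h1.κ_pos h1.q_smooth
  have hc : 0 ≤ Cp + Cq := by positivity
  refine ⟨T.κ * (T.κ * (Cp + Cq) ^ 2) + 1, by positivity, fun M hM => ?_⟩
  have hp : ∀ r ≤ R + 1, ∀ n, |T.pS M r n| ≤ Cp + Cq := by
    intro r hr n
    rw [pS, pulseSample_eq_pulseDeriv h1.Ts_pos T.κ hM]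
    linarith [hCp r hr (samplePoint T.κ M n)]
  have hq : ∀ r ≤ R + 1, ∀ n, |T.qS M r n| ≤ Cp + Cq := by
    intro r hr n
    rw [qS, pulseSample_eq_pulseDeriv h1.Ts_pos T.κ hM]
    linarith [hCq r hr (samplePoint T.κ M n)]
  have hRR : ∀ a ≤ R + 1, ∀ b ≤ R + 1, ∀ i w, |T.RR M a b i w| ≤ T.κ * (T.κ * (Cp + Cq) ^ 2) :=
    fun a ha b hb i w => abs_Rmat_le hc (hp a ha) (hq b hb) i w
  refine ⟨fun i w => ?_, fun a ha b hb => ⟨fun i w => ?_, fun i w => ?_⟩⟩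
  · rw [RR0, Matrix.sub_apply, Matrix.smul_apply, centralOnes, Matrix.of_apply]
    refine (abs_sub _ _).trans (add_le_add (hRR 0 (by omega) 0 (by omega) i w) ?_)
    split_ifs <;> norm_num
  · linarith [hRR a ha b hb i w]
  · have := abs_Smat_le (M := M) hc (hp a ha) (hq b hb) i w
    rw [SS]; linarith

lemma exists_bound_pulse_forms {R : ℕ} (h1 : T.PulseAssumption R) (Ps : ℝ) :
    ∃ C : ℝ, 0 ≤ C ∧ ∀ M : ℕ, 1 ≤ M → |T.delta Ps M| ≤ C ∧
      ∀ a ≤ R + 1, ∀ b ≤ R + 1, |T.mu Ps M a b| ≤ C ∧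
      ∀ a' ≤ R + 1, ∀ b' ≤ R + 1, |T.etaPM Ps M a b a' b'| ≤ C ∧ |T.etaMP Ps M a b a' b'| ≤ C := by
  obtain ⟨c, hc0, hc⟩ := exists_bound_folding h1
  set B : ℝ := (2 * T.κ - 1 : ℕ) * c ^ 2 * 2 with hB
  refine ⟨|Ps| * (B + B), by positivity, fun M hM => ?_⟩
  have hM0 : (0 : ℝ) < M := by exact_mod_cast hM
  obtain ⟨h0, hab⟩ := hc M hM
  have hsc : ∀ x y : ℝ, |x| ≤ 2 * M * B → |y| ≤ 2 * M * B →
      |Ps / (2 * (M : ℝ)) * (x + y)| ≤ |Ps| * (B + B) := by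
    intro x y hx hy
    rw [abs_mul, abs_div, abs_of_pos (by positivity : (0 : ℝ) < 2 * M)]
    calc |Ps| / (2 * M) * |x + y| ≤ |Ps| / (2 * M) * (2 * M * B + 2 * M * B) := by
          gcongr; exact (abs_add_le _ _).trans (add_le_add hx hy)
      _ = |Ps| * (B + B) := by field_simp
  refine ⟨?_, fun a ha b hb => ⟨?_, fun a' ha' b' hb' => ⟨?_, ?_⟩⟩⟩
  · rw [delta, Matrix.trace_add]
    exact hsc _ _ (abs_trace_le hc0 h0 h0 Uplus_symm sum_abs_Uplus_le)
      (abs_trace_le hc0 (hab 0 (by omega) 0 (by omega)).2 (hab 0 (by omega) 0 (by omega)).2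
        Uminus_symm sum_abs_Uminus_le)
  · rw [mu, Matrix.trace_add]
    exact hsc _ _ (abs_trace_le hc0 h0 (hab a ha b hb).1 Uplus_symm sum_abs_Uplus_le)
      (abs_trace_le hc0 (hab 0 (by omega) 0 (by omega)).2 (hab a ha b hb).2
        Uminus_symm sum_abs_Uminus_le)
  · rw [etaPM, eta, Matrix.trace_add]
    exact hsc _ _
      (abs_trace_le hc0 (hab a ha b hb).1 (hab a' ha' b' hb').1 Uplus_symm sum_abs_Uplus_le)
      (abs_trace_le hc0 (hab a ha b hb).2 (hab a' ha' b' hb').2 Uminus_symm sum_abs_Uminus_le)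
  · rw [etaMP, eta, Matrix.trace_add]
    exact hsc _ _
      (abs_trace_le hc0 (hab a ha b hb).1 (hab a' ha' b' hb').1 Uminus_symm sum_abs_Uminus_le)
      (abs_trace_le hc0 (hab a ha b hb).2 (hab a' ha' b' hb').2 Uplus_symm sum_abs_Uplus_le)

lemma freq_mem_Icc {M : ℕ} (k : Fin (2 * M)) : freq M k ∈ Set.Icc 0 (2 * Real.pi) := by
  have hk := k.2
  have hM : (0 : ℝ) < 2 * M := by
    have : 0 < 2 * M := by omega
    exact_mod_cast this
  have hk' : ((k : ℕ) : ℝ) ≤ 2 * M := by exact_mod_cast hk.le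
  have hpi := Real.pi_pos
  rw [freq]
  constructor
  · positivity
  · rw [div_le_iff₀ hM]
    gcongr

lemma continuous_expCoeff {a b : ℕ} (h : T.IsSmooth (a + b)) (n nS : Fin NS) :
    Continuous (T.expCoeff a b n nS) := by
  have hder : ∀ {F : ℝ → ℂ}, ContDiff ℝ ((a + b : ℕ) : WithTop ℕ∞) F → ∀ r ≤ a + b,
      Continuous (iteratedDeriv r F) := by
    intro F hF r hr
    exact (contDiff_iteratedDeriv (m := 0) hF (by omega)).continuous
  unfold expCoeff scalarCoeff
  refine continuous_finsetSum _ fun nR _ => continuous_finsetSum _ fun nT _ => ?_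
  refine continuous_const.mul (continuous_finsetSum _ fun ℓ _ => ?_)
  rcases lt_or_ge b ℓ with hℓ | hℓ
  · rw [Nat.choose_eq_zero_of_lt hℓ]
    simp only [CharP.cast_eq_zero, zero_mul]
    exact continuous_const
  · refine continuous_const.mul ((hder (contDiff_star (h.B nR n)) ℓ (by omega)).mul
      (continuous_finsetSum _ fun s hs => continuous_const.mul ?_))
    have hs' := Finset.mem_range.1 hs
    exact (hder (h.H nR nT) _ (by omega)).mul (hder (h.A nT nS) _ (by omega))

/-- The coefficients are continuous and all subcarrier frequencies lie in `[0, 2π]`, so compactness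
gives a bound independent of `M` and `k`. -/
lemma exists_bound_residualCoeff {D : ℕ} (h : T.IsSmooth (2 * D)) :
    ∃ C : ℝ, 0 ≤ C ∧ ∀ a < D, ∀ b < D, ∀ (n nS : Fin NS) (M : ℕ) (k : Fin (2 * M)),
      ‖T.residualCoeff a b n nS (freq M k)‖ ≤ C := by
  have h1 : ∀ a b : ℕ, ∀ n nS : Fin NS, ∃ C : ℝ, 0 ≤ C ∧ (a < D → b < D →
      ∀ ω ∈ Set.Icc 0 (2 * Real.pi), ‖T.residualCoeff a b n nS ω‖ ≤ C) := by
    intro a b n nS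
    by_cases hab : a < D ∧ b < D
    · obtain ⟨C, hC⟩ := (isCompact_Icc (a := (0 : ℝ)) (b := 2 * Real.pi)).exists_bound_of_continuousOn
        (continuous_expCoeff (h.of_le (by omega : a + b ≤ 2 * D)) n nS).continuousOn
      refine ⟨|C|, abs_nonneg _, fun _ _ ω hω => ?_⟩
      rw [residualCoeff]
      split_ifs
      · simp
      · exact (hC ω hω).trans (le_abs_self C)
    · exact ⟨0, le_rfl, fun ha hb => absurd ⟨ha, hb⟩ hab⟩
  choose C hC0 hC using h1
  refine ⟨∑ a ∈ Finset.range D, ∑ b ∈ Finset.range D, ∑ n, ∑ nS, C a b n nS,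
    Finset.sum_nonneg fun a _ => Finset.sum_nonneg fun b _ => Finset.sum_nonneg fun n _ =>
      Finset.sum_nonneg fun nS _ => hC0 a b n nS, ?_⟩
  intro a ha b hb n nS M k
  refine (hC a b n nS ha hb _ (freq_mem_Icc k)).trans ?_
  calc C a b n nS ≤ ∑ nS, C a b n nS :=
        Finset.single_le_sum (f := fun nS => C a b n nS) (fun nS _ => hC0 a b n nS)
          (Finset.mem_univ nS)
    _ ≤ ∑ n, ∑ nS, C a b n nS :=
        Finset.single_le_sum (f := fun n => ∑ nS, C a b n nS)
          (fun n _ => Finset.sum_nonneg fun nS _ => hC0 a b n nS) (Finset.mem_univ n)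
    _ ≤ ∑ b ∈ Finset.range D, ∑ n, ∑ nS, C a b n nS :=
        Finset.single_le_sum (f := fun b => ∑ n, ∑ nS, C a b n nS)
          (fun b _ => Finset.sum_nonneg fun n _ => Finset.sum_nonneg fun nS _ => hC0 a b n nS)
          (Finset.mem_range.2 hb)
    _ ≤ _ :=
        Finset.single_le_sum (f := fun a => ∑ b ∈ Finset.range D, ∑ n, ∑ nS, C a b n nS)
          (fun a _ => Finset.sum_nonneg fun b _ => Finset.sum_nonneg fun n _ =>
            Finset.sum_nonneg fun nS _ => hC0 a b n nS) (Finset.mem_range.2 ha)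

end Transceiver

/-! ### Comparison of the main error power with the asymptotic distortion power -/

/-- The terms of the square `a, b < D` outside the triangle `a + b < D` are of order at least `D`
and are discarded. -/
lemma abs_sum_sum_sub_diag_le {x : ℕ → ℕ → ℝ} {D : ℕ} {X ε : ℝ} (hX : 0 ≤ X) (hε : 0 ≤ ε)
    (hε1 : ε ≤ 1) (hx : ∀ a < D, ∀ b < D, |x a b| ≤ X) :
    |∑ a ∈ Finset.range D, ∑ b ∈ Finset.range D, ε ^ (a + b) * x a b -
      ∑ m ∈ Finset.range D, ε ^ m * ∑ a ∈ Finset.range (m + 1), x a (m - a)| ≤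
        D * (D * X) * ε ^ D := by
  have h1 : ∑ m ∈ Finset.range D, ε ^ m * ∑ a ∈ Finset.range (m + 1), x a (m - a) =
      ∑ a ∈ Finset.range D, ∑ b ∈ Finset.range D,
        if a + b < D then ε ^ (a + b) * x a b else 0 := by
    have h2 : ∀ m ∈ Finset.range D, ε ^ m * ∑ a ∈ Finset.range (m + 1), x a (m - a) =
        ∑ a ∈ Finset.range (m + 1), (fun a b => ε ^ (a + b) * x a b) a (m - a) := by
      intro m _
      rw [Finset.mul_sum]
      refine Finset.sum_congr rfl fun a ha => ?_
      have := Finset.mem_range.1 ha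
      simp only
      rw [show a + (m - a) = m by omega]
    rw [Finset.sum_congr rfl h2, Finset.sum_range_diag_flip D fun a b => ε ^ (a + b) * x a b]
    refine Finset.sum_congr rfl fun a ha => ?_
    rw [← Finset.sum_filter]
    refine Finset.sum_congr ?_ fun _ _ => rfl
    ext b
    simp only [Finset.mem_range, Finset.mem_filter]
    omega
  rw [h1, ← Finset.sum_sub_distrib]
  simp only [← Finset.sum_sub_distrib]
  refine (Finset.abs_sum_le_sum_abs _ _).trans ?_
  refine (Finset.sum_le_sum fun a ha => (?_ : _ ≤ D * X * ε ^ D)).trans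
    (le_of_eq (by simp; ring))
  refine (Finset.abs_sum_le_sum_abs _ _).trans ?_
  refine (Finset.sum_le_sum fun b hb => (?_ : _ ≤ X * ε ^ D)).trans (le_of_eq (by simp; ring))
  have ha' := Finset.mem_range.1 ha
  have hb' := Finset.mem_range.1 hb
  split_ifs with h
  · rw [sub_self, abs_zero]; positivity
  · rw [sub_zero, abs_mul, abs_of_nonneg (by positivity), mul_comm]
    exact mul_le_mul (hx a ha' b hb') (pow_le_pow_of_le_one hε hε1 (by omega)) (by positivity) hX

lemma abs_quad_le {S : Type*} (s : Finset S) {u : S → ℝ} {η : S → S → ℝ} {E c : ℝ}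
    (hc : 0 ≤ c) (hη : ∀ P ∈ s, ∀ P' ∈ s, |η P P'| ≤ E) (hu : ∀ P ∈ s, |u P| ≤ c) :
    |∑ P ∈ s, ∑ P' ∈ s, u P * u P' * η P P'| ≤ s.card * (s.card * E) * (c * c) := by
  refine (Finset.abs_sum_le_sum_abs _ _).trans ?_
  refine (Finset.sum_le_sum fun P hP => (?_ : _ ≤ s.card * E * (c * c))).trans
    (le_of_eq (by simp; ring))
  refine (Finset.abs_sum_le_sum_abs _ _).trans ?_
  refine (Finset.sum_le_sum fun P' hP' => (?_ : _ ≤ E * (c * c))).trans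
    (le_of_eq (by simp; ring))
  rw [abs_mul, abs_mul, mul_comm E]
  have h1 := hu P hP
  have h2 := hu P' hP'
  have h3 := hη P hP P' hP'
  gcongr

lemma abs_quad_sub_quad_le {S : Type*} (s : Finset S) {u v : S → ℝ} {η : S → S → ℝ} {E c d : ℝ}
    (hc : 0 ≤ c) (hd : 0 ≤ d) (hη : ∀ P ∈ s, ∀ P' ∈ s, |η P P'| ≤ E)
    (hu : ∀ P ∈ s, |u P| ≤ c) (hv : ∀ P ∈ s, |v P| ≤ c) (huv : ∀ P ∈ s, |u P - v P| ≤ d) :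
    |∑ P ∈ s, ∑ P' ∈ s, u P * u P' * η P P' - ∑ P ∈ s, ∑ P' ∈ s, v P * v P' * η P P'| ≤
      s.card * (s.card * E) * (2 * (c * d)) := by
  rw [← Finset.sum_sub_distrib]
  simp only [← Finset.sum_sub_distrib]
  refine (Finset.abs_sum_le_sum_abs _ _).trans ?_
  refine (Finset.sum_le_sum fun P hP => (?_ : _ ≤ s.card * E * (2 * (c * d)))).trans
    (le_of_eq (by simp; ring))
  refine (Finset.abs_sum_le_sum_abs _ _).trans ?_
  refine (Finset.sum_le_sum fun P' hP' => (?_ : _ ≤ E * (2 * (c * d)))).trans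
    (le_of_eq (by simp; ring))
  rw [← sub_mul, abs_mul, mul_comm E]
  have h : |u P * u P' - v P * v P'| ≤ 2 * (c * d) := by
    rw [show u P * u P' - v P * v P' = (u P - v P) * u P' + v P * (u P' - v P') by ring]
    refine (abs_add_le _ _).trans ?_
    rw [abs_mul, abs_mul, two_mul]
    have h1 := huv P hP
    have h2 := hu P' hP'
    have h3 := hv P hP
    have h4 := huv P' hP'
    refine add_le_add ?_ ?_
    · rw [mul_comm c]; gcongr
    · gcongr
  exact mul_le_mul h (hη P hP P' hP') (abs_nonneg _) (by positivity)

namespace Transceiver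

variable {NT NR NS : ℕ} {T : Transceiver NT NR NS}

/-- Below `KT` only `a = 0` can survive, and there `Bᴴ H A = 1` removes everything below order `KR`.
Hence nothing is left at total order below `K`. -/
lemma residualCoeff_eq_zero (hKT : 1 ≤ T.KT) {a b : ℕ} (h : T.IsSmooth (a + b))
    (hinv : ∀ ω, (T.B ω)ᴴ * T.H ω * T.A ω = 1) (ha : a < T.KT) (hab : a ≠ 0 ∨ b < T.KR)
    (n nS : Fin NS) (ω : ℝ) : T.residualCoeff a b n nS ω = 0 := by
  rw [residualCoeff]
  split_ifs with h0
  · rfl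
  · by_cases ha0 : a = 0
    · subst ha0
      have hb : b ≠ 0 := fun hb => h0 ⟨rfl, hb⟩
      rw [expCoeff_zero hKT (by simpa using h) hinv, if_neg hb,
        Finset.Icc_eq_empty (by simpa using hab)]
      simp
    · rw [expCoeff_eq h, altSum_eq_zero (by omega) ha]
      simp

lemma one_le_K (hKT : 1 ≤ T.KT) (hKR : 1 ≤ T.KR) : 1 ≤ T.K := le_min hKT hKR

lemma residualCoeff_K_zero (hKT : 1 ≤ T.KT) (hKR : 1 ≤ T.KR) (h : T.IsSmooth T.K)
    (n nS : Fin NS) (ω : ℝ) : T.residualCoeff T.K 0 n nS ω =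
      if T.KT = T.K then ((-(1 / Real.sqrt 2) : ℝ) : ℂ) * T.alpha T.K T.K n nS ω else 0 := by
  have hK := one_le_K hKT hKR
  have hle : T.K ≤ T.KT := min_le_left _ _
  rw [residualCoeff, if_neg (by omega), expCoeff_pos hKT hK (by simpa using h),
    expTail_eq_zero hK (Or.inr hKR), add_zero, sub_zero,
    Finset.sum_eq_single_of_mem T.K (Finset.mem_range.2 (by omega))]
  · split_ifs with hT
    · rw [hT, Nat.choose_self, Nat.choose_self, ← two_mul, pow_mul]
      push_cast
      ring
    · rw [Nat.choose_eq_zero_of_lt (by omega : T.K - 1 < T.KT - 1)]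
      simp
  · intro ℓ hℓ hne
    have := Finset.mem_range.1 hℓ
    rw [Nat.choose_eq_zero_of_lt (by omega : ℓ < T.K)]
    simp

lemma residualCoeff_zero_K (hKT : 1 ≤ T.KT) (hKR : 1 ≤ T.KR) (h : T.IsSmooth T.K)
    (hinv : ∀ ω, (T.B ω)ᴴ * T.H ω * T.A ω = 1) (n nS : Fin NS) (ω : ℝ) :
    T.residualCoeff 0 T.K n nS ω =
      if T.KR = T.K then ((-(1 / Real.sqrt 2) : ℝ) : ℂ) * T.beta T.K T.K n nS ω else 0 := by
  have hK := one_le_K hKT hKR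
  have hle : T.K ≤ T.KR := min_le_right _ _
  rw [residualCoeff, if_neg (by omega), expCoeff_zero hKT h hinv, if_neg (by omega)]
  split_ifs with hR
  · rw [hR, Finset.Icc_self, Finset.sum_singleton]
    push_cast
    ring
  · rw [Finset.Icc_eq_empty (by omega)]
    simp

/-- The range `1, …, m` may replace `K', …, ℓ`: one of the two binomials vanishes on every
additional index. -/
lemma sum_muTilde (Ps : ℝ) (M : ℕ) {K' ℓ m : ℕ} (hK' : 1 ≤ K') (hℓ : ℓ ≤ m) :
    ∑ i ∈ Finset.range m, (-1 : ℝ) ^ (i + 1 + K') * (ℓ.choose (i + 1) : ℝ) *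
      ((i + 1 - 1).choose (K' - 1) : ℝ) * T.mu Ps M (i + 1) (m - (i + 1)) =
      T.muTilde Ps M K' ℓ m := by
  rw [Finset.range_eq_Ico, Finset.sum_Ico_add' (fun j => (-1 : ℝ) ^ (j + K') * (ℓ.choose j : ℝ) *
    ((j - 1).choose (K' - 1) : ℝ) * T.mu Ps M j (m - j)) 0 m 1, muTilde]
  symm
  refine Finset.sum_subset (fun j hj => ?_) fun j hj hj' => ?_
  · rw [Finset.mem_Icc] at hj
    rw [Finset.mem_Ico]
    omega
  · rw [Finset.mem_Ico] at hj
    rw [Finset.mem_Icc] at hj'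
    rcases lt_or_ge j K' with h | h
    · rw [Nat.choose_eq_zero_of_lt (by omega : j - 1 < K' - 1)]
      simp
    · rw [Nat.choose_eq_zero_of_lt (by omega : ℓ < j)]
      simp

/-- A nonzero tail needs `a ≥ KT` and `b ≥ KR`, so `a + b ≤ 2K` forces `a = b = K = KT = KR`. -/
lemma sum_expTail (hKT : 1 ≤ T.KT) (hKR : 1 ≤ T.KR) (Ps : ℝ) (M : ℕ) {m : ℕ} (hm : m ≤ 2 * T.K)
    (n : Fin NS) (ω : ℝ) :
    ∑ i ∈ Finset.range m, (T.expTail (i + 1) (m - (i + 1)) n n ω).re *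
      T.mu Ps M (i + 1) (m - (i + 1)) =
      if m = 2 * T.K ∧ T.KR = T.KT then
        -(1 / Real.sqrt 2 * (T.gamma n n ω).re * T.mu Ps M T.K T.K) else 0 := by
  have hK := one_le_K hKT hKR
  have hle : T.K ≤ T.KT := min_le_left _ _
  have hle' : T.K ≤ T.KR := min_le_right _ _
  have hz : ∀ i ∈ Finset.range m, i + 1 ≠ T.K → (T.expTail (i + 1) (m - (i + 1)) n n ω).re *
      T.mu Ps M (i + 1) (m - (i + 1)) = 0 := by
    intro i hi hne
    have := Finset.mem_range.1 hi
    rw [expTail_eq_zero (by omega) (by omega)]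
    simp
  split_ifs with h
  · rw [Finset.sum_eq_single_of_mem (T.K - 1) (Finset.mem_range.2 (by omega))
      (fun i hi hne => hz i hi (by omega)), show T.K - 1 + 1 = T.K by omega,
      show m - T.K = T.K by omega, expTail_K_K hKT h.2, neg_re,
      show (1 / (Real.sqrt 2 : ℂ)) = ((1 / Real.sqrt 2 : ℝ) : ℂ) by push_cast; rfl, re_ofReal_mul]
    ring
  · refine Finset.sum_eq_zero fun i hi => ?_
    by_cases hi' : i + 1 = T.K
    · have := Finset.mem_range.1 hi
      rw [hi', expTail_eq_zero hK]
      · simp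
      · have : T.K = T.KT ∨ T.K = T.KR := by rw [K]; omega
        omega
    · exact hz i hi hi'

/-- The terms of `Pe1` of order `m`. The index `a = 0` gives `β`; for `a ≥ 1`, exchanging the sums
over `a` and `ℓ` gathers the `μ` into `muTilde`. The constant is `4 / √2 = 2√2`. -/
lemma sum_residualCoeff_level (hKT : 1 ≤ T.KT) (hKR : 1 ≤ T.KR) (Ps : ℝ) (M : ℕ) {m : ℕ}
    (hm : m ≤ 2 * T.K) (h : T.IsSmooth m) (hinv : ∀ ω, (T.B ω)ᴴ * T.H ω * T.A ω = 1)
    (n : Fin NS) (ω : ℝ) :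
    4 * ∑ a ∈ Finset.range (m + 1), (T.residualCoeff a (m - a) n n ω).re * T.mu Ps M a (m - a) =
      -(2 * Real.sqrt 2 * ∑ ℓ ∈ Finset.Icc T.KR m, T.mu Ps M 0 m * (T.beta m ℓ n n ω).re) -
      2 * Real.sqrt 2 * ∑ ℓ ∈ Finset.Icc T.KT m,
        T.muTilde Ps M T.KT ℓ m * (T.alpha m ℓ n n ω).re +
      if m = 2 * T.K ∧ T.KR = T.KT then
        2 * Real.sqrt 2 * (T.gamma n n ω).re * T.mu Ps M T.K T.K else 0 := by
  have hK := one_le_K hKT hKR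
  rcases Nat.eq_zero_or_pos m with hm0 | hm0
  · subst hm0
    rw [Finset.Icc_eq_empty (by omega), Finset.Icc_eq_empty (by omega), if_neg (by omega)]
    simp [residualCoeff]
  have hs : 4 * (1 / Real.sqrt 2) = 2 * Real.sqrt 2 := by
    have h2 := Real.mul_self_sqrt (by norm_num : (0 : ℝ) ≤ 2)
    have h3 : Real.sqrt 2 ≠ 0 := (Real.sqrt_pos.2 (by norm_num)).ne'
    field_simp
    linarith
  have hcast : (1 / (Real.sqrt 2 : ℂ)) = ((1 / Real.sqrt 2 : ℝ) : ℂ) := by push_cast; rfl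
  have h0 : (T.residualCoeff 0 (m - 0) n n ω).re * T.mu Ps M 0 (m - 0) = -(1 / Real.sqrt 2 *
      ∑ ℓ ∈ Finset.Icc T.KR m, T.mu Ps M 0 m * (T.beta m ℓ n n ω).re) := by
    rw [Nat.sub_zero, residualCoeff, if_neg (by omega), expCoeff_zero hKT h hinv,
      if_neg (by omega), zero_sub, neg_re, hcast, re_ofReal_mul, re_sum, ← Finset.mul_sum]
    ring
  have hpos : ∀ i ∈ Finset.range m, (T.residualCoeff (i + 1) (m - (i + 1)) n n ω).re *
      T.mu Ps M (i + 1) (m - (i + 1)) = -(1 / Real.sqrt 2 * ∑ ℓ ∈ Finset.range (m + 1),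
        (T.alpha m ℓ n n ω).re * ((-1 : ℝ) ^ (i + 1 + T.KT) * (ℓ.choose (i + 1) : ℝ) *
          ((i + 1 - 1).choose (T.KT - 1) : ℝ) * T.mu Ps M (i + 1) (m - (i + 1)))) -
      (T.expTail (i + 1) (m - (i + 1)) n n ω).re * T.mu Ps M (i + 1) (m - (i + 1)) := by
    intro i hi
    have hi' := Finset.mem_range.1 hi
    have hsum : i + 1 + (m - (i + 1)) = m := by omega
    rw [residualCoeff, if_neg (by omega), expCoeff_pos hKT (by omega) (by rwa [hsum]), hsum,
      sub_re, neg_re, hcast, re_ofReal_mul, re_sum, sub_mul, neg_mul, mul_assoc, Finset.sum_mul]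
    congr 3
    refine Finset.sum_congr rfl fun ℓ _ => ?_
    rw [re_ofReal_mul]
    ring
  rw [Finset.sum_range_succ', h0, Finset.sum_congr rfl hpos, Finset.sum_sub_distrib,
    sum_expTail hKT hKR Ps M hm, Finset.sum_neg_distrib, ← Finset.mul_sum, Finset.sum_comm]
  have hα : ∑ ℓ ∈ Finset.range (m + 1), ∑ i ∈ Finset.range m, (T.alpha m ℓ n n ω).re *
      ((-1 : ℝ) ^ (i + 1 + T.KT) * (ℓ.choose (i + 1) : ℝ) *
          ((i + 1 - 1).choose (T.KT - 1) : ℝ) * T.mu Ps M (i + 1) (m - (i + 1))) =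
      ∑ ℓ ∈ Finset.Icc T.KT m, T.muTilde Ps M T.KT ℓ m * (T.alpha m ℓ n n ω).re := by
    symm
    rw [Finset.sum_subset (s₂ := Finset.range (m + 1))]
    · refine Finset.sum_congr rfl fun ℓ hℓ => ?_
      have := Finset.mem_range.1 hℓ
      rw [← Finset.mul_sum, sum_muTilde Ps M hKT (by omega), mul_comm]
    · intro ℓ hℓ
      rw [Finset.mem_Icc] at hℓ
      exact Finset.mem_range.2 (by omega)
    · intro ℓ hℓ hℓ'
      rw [Finset.mem_Icc] at hℓ'
      have := Finset.mem_range.1 hℓ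
      rw [muTilde, Finset.Icc_eq_empty (by omega), Finset.sum_empty, zero_mul]
  rw [hα]
  generalize ∑ ℓ ∈ Finset.Icc T.KT m, T.muTilde Ps M T.KT ℓ m * (T.alpha m ℓ n n ω).re = X
  generalize ∑ ℓ ∈ Finset.Icc T.KR m, T.mu Ps M 0 m * (T.beta m ℓ n n ω).re = Y
  split_ifs with hc
  · linear_combination (-X - Y + (T.gamma n n ω).re * T.mu Ps M T.K T.K) * hs
  · linear_combination (-X - Y) * hs

lemma Pe1_eq (hKT : 1 ≤ T.KT) (hKR : 1 ≤ T.KR) (Ps : ℝ) (M : ℕ) (h : T.IsSmooth (2 * T.K))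
    (hinv : ∀ ω, (T.B ω)ᴴ * T.H ω * T.A ω = 1) (k : Fin (2 * M)) (n : Fin NS) :
    T.Pe1 Ps M k n = 2 * T.delta Ps M + 4 * ∑ m ∈ Finset.range (2 * T.K + 1),
      (2 * (M : ℝ))⁻¹ ^ m * ∑ a ∈ Finset.range (m + 1),
        (T.residualCoeff a (m - a) n n (freq M k)).re * T.mu Ps M a (m - a) := by
  set ω := freq M k with hω
  have hlev : ∀ m ∈ Finset.range (2 * T.K + 1), 4 * ((2 * (M : ℝ))⁻¹ ^ m *
      ∑ a ∈ Finset.range (m + 1), (T.residualCoeff a (m - a) n n ω).re * T.mu Ps M a (m - a)) =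
      -(2 * Real.sqrt 2 / (2 * (M : ℝ)) ^ m *
        ∑ ℓ ∈ Finset.Icc T.KR m, T.mu Ps M 0 m * (T.beta m ℓ n n ω).re) -
      2 * Real.sqrt 2 / (2 * (M : ℝ)) ^ m * ∑ ℓ ∈ Finset.Icc T.KT m,
        T.muTilde Ps M T.KT ℓ m * (T.alpha m ℓ n n ω).re +
      if m = 2 * T.K then 2 * Real.sqrt 2 / (2 * (M : ℝ)) ^ (2 * T.K) * (T.gamma n n ω).re *
        T.mu Ps M T.K T.K * (if T.KR = T.KT then 1 else 0) else 0 := by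
    intro m hm
    have hm' := Finset.mem_range.1 hm
    rw [mul_left_comm, sum_residualCoeff_level hKT hKR Ps M (by omega) (h.of_le (by omega)) hinv]
    by_cases hm2 : m = 2 * T.K
    · by_cases hc : T.KR = T.KT
      · rw [if_pos ⟨hm2, hc⟩, if_pos hm2, if_pos hc, ← hm2, inv_pow]
        ring
      · rw [if_neg (fun h => hc h.2), if_pos hm2, if_neg hc, inv_pow]
        ring
    · rw [if_neg (fun h => hm2 h.1), if_neg hm2, inv_pow]
      ring
  have hIcc : ∀ (K' : ℕ) (f : ℕ → ℕ → ℝ),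
      ∑ m ∈ Finset.range (2 * T.K + 1), 2 * Real.sqrt 2 / (2 * (M : ℝ)) ^ m *
        ∑ ℓ ∈ Finset.Icc K' m, f m ℓ =
      ∑ m ∈ Finset.Icc K' (2 * T.K), 2 * Real.sqrt 2 / (2 * (M : ℝ)) ^ m *
        ∑ ℓ ∈ Finset.Icc K' m, f m ℓ := by
    intro K' f
    symm
    refine Finset.sum_subset (fun m hm => ?_) fun m hm hm' => ?_
    · rw [Finset.mem_Icc] at hm
      exact Finset.mem_range.2 (by omega)
    · rw [Finset.mem_Icc] at hm'
      have := Finset.mem_range.1 hm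
      rw [Finset.Icc_eq_empty (by omega), Finset.sum_empty, mul_zero]
  rw [Finset.mul_sum, Finset.sum_congr rfl hlev, Finset.sum_add_distrib, Finset.sum_sub_distrib,
    Finset.sum_neg_distrib, hIcc, hIcc, Finset.sum_ite_eq', if_pos (Finset.mem_range.2 (by omega)),
    Pe1]
  ring

lemma eta_symm (T : Transceiver NT NR NS) (Ps : ℝ) (M : ℕ)
    {U V : Matrix (Fin (2 * M)) (Fin (2 * M)) ℝ} (hU : ∀ i i', U i i' = U i' i)
    (hV : ∀ i i', V i i' = V i' i) (a b a' b' : ℕ) :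
    T.eta Ps M U V a b a' b' = T.eta Ps M U V a' b' a b := by
  have key : ∀ (X Y : Matrix (Fin (2 * M)) (Fin (2 * T.κ - 1)) ℝ)
      (W : Matrix (Fin (2 * M)) (Fin (2 * M)) ℝ), (∀ i i', W i i' = W i' i) →
      Matrix.trace (X * Yᵀ * W) = Matrix.trace (Y * Xᵀ * W) := by
    intro X Y W hW
    have hWt : Wᵀ = W := by ext i j; exact hW j i
    rw [← Matrix.trace_transpose, Matrix.transpose_mul, Matrix.transpose_mul,
      Matrix.transpose_transpose, hWt, Matrix.trace_mul_comm]
  rw [eta, eta, Matrix.trace_add, Matrix.trace_add, key _ _ U hU, key _ _ V hV]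

end Transceiver

namespace Transceiver

variable {NT NR NS : ℕ} {T : Transceiver NT NR NS}

lemma sum_quad_pair {K : ℕ} (hK : 1 ≤ K) (v : ℕ × ℕ → ℝ) (η : ℕ × ℕ → ℕ × ℕ → ℝ)
    (hv : ∀ P, P ≠ (K, 0) → P ≠ (0, K) → v P = 0) :
    ∑ P ∈ Finset.range (2 * K + 1) ×ˢ Finset.range (2 * K + 1),
      ∑ P' ∈ Finset.range (2 * K + 1) ×ˢ Finset.range (2 * K + 1), v P * v P' * η P P' =
      v (K, 0) * v (K, 0) * η (K, 0) (K, 0) + v (K, 0) * v (0, K) * η (K, 0) (0, K) +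
      (v (0, K) * v (K, 0) * η (0, K) (K, 0) + v (0, K) * v (0, K) * η (0, K) (0, K)) := by
  have hsum : ∀ f : ℕ × ℕ → ℝ, (∀ P, P ≠ (K, 0) → P ≠ (0, K) → f P = 0) →
      ∑ P ∈ Finset.range (2 * K + 1) ×ˢ Finset.range (2 * K + 1), f P = f (K, 0) + f (0, K) := by
    intro f hf
    rw [← Finset.sum_pair (show ((K, 0) : ℕ × ℕ) ≠ (0, K) by simp; omega)]
    symm
    refine Finset.sum_subset (fun P hP => ?_) fun P _ hP => ?_
    · rw [Finset.mem_insert, Finset.mem_singleton] at hP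
      rcases hP with rfl | rfl <;> simp <;> omega
    · rw [Finset.mem_insert, Finset.mem_singleton] at hP
      exact hf P (fun h => hP (Or.inl h)) fun h => hP (Or.inr h)
  rw [hsum _ fun P h h' => by simp [hv P h h'], hsum _ fun P h h' => by simp [hv P h h'],
    hsum _ fun P h h' => by simp [hv P h h']]

variable (T) in
/-- The terms of lowest order among the terms `(2M)^(-a-b) residualCoeff a b`. -/
def leadCoeff {M : ℕ} (k : Fin (2 * M)) (n nS : Fin NS) (P : ℕ × ℕ) : ℂ :=
  if P.1 + P.2 = T.K then
    ((2 * (M : ℝ))⁻¹ ^ T.K : ℝ) * T.residualCoeff P.1 P.2 n nS (freq M k) else 0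

/-- An order-`K` pair with `a, b ≥ 1` has `1 ≤ a < K ≤ KT` and is cancelled by the transmit stages.
-/
lemma leadCoeff_eq_zero (hKT : 1 ≤ T.KT) (h : T.IsSmooth T.K)
    (hinv : ∀ ω, (T.B ω)ᴴ * T.H ω * T.A ω = 1) {M : ℕ} (k : Fin (2 * M)) (n nS : Fin NS)
    {P : ℕ × ℕ} (hP : P ≠ (T.K, 0)) (hP' : P ≠ (0, T.K)) : T.leadCoeff k n nS P = 0 := by
  have hle : T.K ≤ T.KT := min_le_left _ _
  obtain ⟨a, b⟩ := P
  rw [leadCoeff]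
  split_ifs with hab
  · simp only at hab
    have ha : a ≠ 0 := fun h0 => hP' (by rw [h0, show b = T.K by omega])
    have hb : b ≠ 0 := fun h0 => hP (by rw [h0, show a = T.K by omega])
    rw [residualCoeff_eq_zero hKT (by rwa [hab]) hinv (by omega) (Or.inl ha), mul_zero]
  · rfl

/-- Only the pairs `(K, 0)` and `(0, K)` remain, with coefficients `-α/√2` if `KT = K` and `-β/√2`
if `KR = K`. The factor `2` for the two output parts cancels `(1/√2)²`, and the indicators form the
pattern of `psi`. -/
lemma two_mul_sum_quad_leadCoeff (hKT : 1 ≤ T.KT) (hKR : 1 ≤ T.KR) (h : T.IsSmooth T.K)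
    (hinv : ∀ ω, (T.B ω)ᴴ * T.H ω * T.A ω = 1) (Ps : ℝ) {M : ℕ} (k : Fin (2 * M)) (n : Fin NS) :
    2 * ∑ nS : Fin NS,
      (∑ P ∈ Finset.range (2 * T.K + 1) ×ˢ Finset.range (2 * T.K + 1),
        ∑ P' ∈ Finset.range (2 * T.K + 1) ×ˢ Finset.range (2 * T.K + 1),
          (T.leadCoeff k n nS P).re * (T.leadCoeff k n nS P').re *
            T.etaPM Ps M P.1 P.2 P'.1 P'.2 +
      ∑ P ∈ Finset.range (2 * T.K + 1) ×ˢ Finset.range (2 * T.K + 1),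
        ∑ P' ∈ Finset.range (2 * T.K + 1) ×ˢ Finset.range (2 * T.K + 1),
          (T.leadCoeff k n nS P).im * (T.leadCoeff k n nS P').im *
            T.etaMP Ps M P.1 P.2 P'.1 P'.2) = T.Pe2 Ps M k n := by
  have hK := one_le_K hKT hKR
  have hmin : T.K = T.KT ∨ T.K = T.KR := by rw [K]; omega
  set ε := (2 * (M : ℝ))⁻¹ with hε
  have hs : (1 / Real.sqrt 2) * (1 / Real.sqrt 2) = 1 / 2 := by
    rw [div_mul_div_comm, Real.mul_self_sqrt (by norm_num), one_mul]
  have hα : ∀ nS, T.leadCoeff k n nS (T.K, 0) = ((ε ^ T.K * -(1 / Real.sqrt 2) *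
      (if T.KT = T.K then 1 else 0) : ℝ) : ℂ) * T.alpha T.K T.K n nS (freq M k) := by
    intro nS
    rw [leadCoeff, if_pos (by simp), ← hε, residualCoeff_K_zero hKT hKR h]
    split_ifs <;> push_cast <;> ring
  have hβ : ∀ nS, T.leadCoeff k n nS (0, T.K) = ((ε ^ T.K * -(1 / Real.sqrt 2) *
      (if T.KR = T.K then 1 else 0) : ℝ) : ℂ) * T.beta T.K T.K n nS (freq M k) := by
    intro nS
    rw [leadCoeff, if_pos (by simp), ← hε, residualCoeff_zero_K hKT hKR h hinv]
    split_ifs <;> push_cast <;> ring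
  have hε2 : 1 / (2 * (M : ℝ)) ^ (2 * T.K) = ε ^ T.K * ε ^ T.K := by
    rw [← pow_add, ← two_mul, hε, inv_pow, one_div]
  have hform : ∀ (η : ℕ → ℕ → ℕ → ℕ → ℝ) (x y : ℝ), η 0 T.K T.K 0 = η T.K 0 0 T.K →
      2 * ((ε ^ T.K * -(1 / Real.sqrt 2) * (if T.KT = T.K then 1 else 0) * x) *
          (ε ^ T.K * -(1 / Real.sqrt 2) * (if T.KT = T.K then 1 else 0) * x) * η T.K 0 T.K 0 +
        (ε ^ T.K * -(1 / Real.sqrt 2) * (if T.KT = T.K then 1 else 0) * x) *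
          (ε ^ T.K * -(1 / Real.sqrt 2) * (if T.KR = T.K then 1 else 0) * y) * η T.K 0 0 T.K +
        ((ε ^ T.K * -(1 / Real.sqrt 2) * (if T.KR = T.K then 1 else 0) * y) *
          (ε ^ T.K * -(1 / Real.sqrt 2) * (if T.KT = T.K then 1 else 0) * x) * η 0 T.K T.K 0 +
        (ε ^ T.K * -(1 / Real.sqrt 2) * (if T.KR = T.K then 1 else 0) * y) *
          (ε ^ T.K * -(1 / Real.sqrt 2) * (if T.KR = T.K then 1 else 0) * y) *
            η 0 T.K 0 T.K)) =
      ε ^ T.K * ε ^ T.K * (![x, y] ⬝ᵥ (T.psi η *ᵥ ![x, y])) := by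
    intro η x y hη
    have hind : (if T.KR = T.KT then η T.K 0 0 T.K else 0) =
        (if T.KT = T.K then 1 else 0) * (if T.KR = T.K then 1 else 0) * η T.K 0 0 T.K := by
      split_ifs <;> first | omega | simp
    have ht : (if T.KT = T.K then η T.K 0 T.K 0 else 0) =
        (if T.KT = T.K then 1 else 0) * (if T.KT = T.K then 1 else 0) * η T.K 0 T.K 0 := by
      split_ifs <;> simp
    have hr : (if T.KR = T.K then η 0 T.K 0 T.K else 0) =
        (if T.KR = T.K then 1 else 0) * (if T.KR = T.K then 1 else 0) * η 0 T.K 0 T.K := by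
      split_ifs <;> simp
    rw [psi, hind, ht, hr, hη]
    simp only [dotProduct, Matrix.mulVec, Fin.sum_univ_two, Matrix.cons_val_zero,
      Matrix.cons_val_one, Matrix.of_apply]
    generalize (if T.KT = T.K then (1 : ℝ) else 0) = t
    generalize (if T.KR = T.K then (1 : ℝ) else 0) = r
    linear_combination (2 * (ε ^ T.K * ε ^ T.K) * (t * t * x * x * η T.K 0 T.K 0 +
      2 * (t * r * x * y * η T.K 0 0 T.K) + r * r * y * y * η 0 T.K 0 T.K)) * hs
  have hxr : ∀ nS, (fun i => (T.xi T.K T.K n nS (freq M k) i).re) =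
      ![(T.alpha T.K T.K n nS (freq M k)).re, (T.beta T.K T.K n nS (freq M k)).re] := by
    intro nS
    ext i
    fin_cases i <;> rfl
  have hxi : ∀ nS, (fun i => (T.xi T.K T.K n nS (freq M k) i).im) =
      ![(T.alpha T.K T.K n nS (freq M k)).im, (T.beta T.K T.K n nS (freq M k)).im] := by
    intro nS
    ext i
    fin_cases i <;> rfl
  rw [Pe2, hε2, Finset.mul_sum, Finset.mul_sum, Finset.mul_sum, ← Finset.sum_add_distrib]
  refine Finset.sum_congr rfl fun nS _ => ?_
  rw [hxr, hxi, psiPM, psiMP, ← hform (T.etaPM Ps M) _ _ (T.eta_symm Ps M Uplus_symm Uminus_symm _ _ _ _),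
    ← hform (T.etaMP Ps M) _ _ (T.eta_symm Ps M Uminus_symm Uplus_symm _ _ _ _), mul_add,
    sum_quad_pair hK (fun P => (T.leadCoeff k n nS P).re)
      (fun P P' => T.etaPM Ps M P.1 P.2 P'.1 P'.2)
      (fun P h1 h2 => by rw [leadCoeff_eq_zero hKT h hinv k n nS h1 h2, zero_re]),
    sum_quad_pair hK (fun P => (T.leadCoeff k n nS P).im)
      (fun P P' => T.etaMP Ps M P.1 P.2 P'.1 P'.2)
      (fun P h1 h2 => by rw [leadCoeff_eq_zero hKT h hinv k n nS h1 h2, zero_im])]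
  simp only [hα, hβ, re_ofReal_mul, im_ofReal_mul]

-- Linear terms beyond order `2K` are discarded. In the quadratic terms every coefficient is `O(ε ^
-- K)` and differs from its leading part by `O(ε ^ (K + 1))`, so replacing it costs `O(ε ^ (2K +
-- 1))`. The factor `2` counts the real and imaginary errors.
set_option maxHeartbeats 800000 in
lemma exists_bound_mainPower_sub (hKT : 1 ≤ T.KT) (hKR : 1 ≤ T.KR) {R R' : ℕ}
    (h1 : T.PulseAssumption R) (h2 : T.ChannelAssumption R R') (Ps : ℝ) :
    ∃ C : ℝ, 0 ≤ C ∧ ∀ M : ℕ, 1 ≤ M → ∀ (n : Fin NS) (k : Fin (2 * M)),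
      |T.mainPower Ps M k n| ≤ C ∧
      |2 * T.mainPower Ps M k n - T.Pe Ps M k n| ≤ C * (2 * (M : ℝ))⁻¹ ^ (2 * T.K + 1) ∧
      |T.Pe2 Ps M k n| ≤ C * (2 * (M : ℝ))⁻¹ ^ (2 * T.K) := by
  obtain ⟨hK2R, -, -, hKle, hKle'⟩ := K_bounds h1
  have hst := h1.stages_le
  have hK := one_le_K hKT hKR
  have hsmooth : T.IsSmooth (2 * (2 * T.K + 1)) := h2.isSmooth.of_le (by
    have := h2.lt
    have : 2 ≤ R := by omega
    nlinarith)
  obtain ⟨E, hE0, hE⟩ := exists_bound_pulse_forms h1 Ps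
  obtain ⟨c, hc0, hc⟩ := exists_bound_residualCoeff hsmooth
  set D := 2 * T.K + 1 with hD
  set S := Finset.range D ×ˢ Finset.range D with hS
  set Q : ℝ := S.card * (S.card * E) with hQ
  set L : ℝ := D * (D * (c * E)) with hL
  set G : ℝ := NS * (2 * (Q * (c * c))) with hG
  refine ⟨E + 4 * L + 4 * G, by positivity, fun M hM n k => ?_⟩
  obtain ⟨hEd, hE⟩ := hE M hM
  have hM0 : (1 : ℝ) ≤ M := by exact_mod_cast hM
  set ε := (2 * (M : ℝ))⁻¹ with hε
  have hε0 : 0 ≤ ε := by positivity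
  have hε1 : ε ≤ 1 := inv_le_one_of_one_le₀ (by linarith)
  have hEη : ∀ P ∈ S, ∀ P' ∈ S, |T.etaPM Ps M P.1 P.2 P'.1 P'.2| ≤ E ∧
      |T.etaMP Ps M P.1 P.2 P'.1 P'.2| ≤ E := by
    intro P hP P' hP'
    rw [hS, Finset.mem_product, Finset.mem_range, Finset.mem_range] at hP hP'
    exact (hE P.1 (by omega) P.2 (by omega)).2 P'.1 (by omega) P'.2 (by omega)
  set u : Fin NS → ℕ × ℕ → ℂ := fun nS P =>
    ((ε ^ (P.1 + P.2) : ℝ) : ℂ) * T.residualCoeff P.1 P.2 n nS (freq M k) with hu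
  have hnorm : ∀ (j : ℕ) (z : ℂ), ‖((ε ^ j : ℝ) : ℂ) * z‖ = ε ^ j * ‖z‖ := by
    intro j z
    rw [norm_mul, norm_real, Real.norm_of_nonneg (by positivity)]
  have hres : ∀ nS, ∀ P ∈ S, ‖T.residualCoeff P.1 P.2 n nS (freq M k)‖ ≤ c := by
    intro nS P hP
    rw [hS, Finset.mem_product, Finset.mem_range, Finset.mem_range] at hP
    exact hc _ hP.1 _ hP.2 n nS M k
  have hub : ∀ nS, ∀ P ∈ S, ∀ j ≤ P.1 + P.2, ‖u nS P‖ ≤ c * ε ^ j := by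
    intro nS P hP j hj
    rw [hu]
    simp only
    rw [hnorm, mul_comm]
    exact mul_le_mul (hres nS P hP) (pow_le_pow_of_le_one hε0 hε1 hj) (by positivity) hc0
  have hzero : ∀ nS, ∀ P ∈ S, P.1 + P.2 < T.K → u nS P = 0 := by
    intro nS P hP hlt
    rw [hu]
    simp only
    rw [residualCoeff_eq_zero hKT (hsmooth.of_le (by omega)) h2.inverse (by omega)
      (Or.inr (by omega)), mul_zero]
  have hu1 : ∀ nS, ∀ P ∈ S, ‖u nS P‖ ≤ c * ε ^ T.K := by
    intro nS P hP
    rcases lt_or_ge (P.1 + P.2) T.K with hlt | hge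
    · rw [hzero nS P hP hlt, norm_zero]; positivity
    · exact hub nS P hP _ hge
  have hv : ∀ nS, ∀ P ∈ S, T.leadCoeff k n nS P = if P.1 + P.2 = T.K then u nS P else 0 := by
    intro nS P hP
    rw [leadCoeff]
    split_ifs with h
    · rw [hu]; simp only; rw [h]
    · rfl
  have hv1 : ∀ nS, ∀ P ∈ S, ‖T.leadCoeff k n nS P‖ ≤ c * ε ^ T.K := by
    intro nS P hP
    rw [hv nS P hP]
    split_ifs
    · exact hu1 nS P hP
    · rw [norm_zero]; positivity
  have huv : ∀ nS, ∀ P ∈ S, ‖u nS P - T.leadCoeff k n nS P‖ ≤ c * ε ^ (T.K + 1) := by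
    intro nS P hP
    rw [hv nS P hP]
    split_ifs with h
    · rw [sub_self, norm_zero]; positivity
    · rw [sub_zero]
      rcases lt_or_ge (P.1 + P.2) T.K with hlt | hge
      · rw [hzero nS P hP hlt, norm_zero]; positivity
      · exact hub nS P hP _ (by omega)
  set W : (Fin NS → ℕ × ℕ → ℂ) → ℝ := fun w => ∑ nS,
    (∑ P ∈ S, ∑ P' ∈ S, (w nS P).re * (w nS P').re * T.etaPM Ps M P.1 P.2 P'.1 P'.2 +
      ∑ P ∈ S, ∑ P' ∈ S, (w nS P).im * (w nS P').im * T.etaMP Ps M P.1 P.2 P'.1 P'.2) with hW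
  have hcε : 0 ≤ c * ε ^ T.K := by positivity
  have hWb : ∀ w : Fin NS → ℕ × ℕ → ℂ, (∀ nS, ∀ P ∈ S, ‖w nS P‖ ≤ c * ε ^ T.K) →
      |W w| ≤ G * ε ^ (2 * T.K) := by
    intro w hw
    refine (Finset.abs_sum_le_sum_abs _ _).trans ?_
    refine (Finset.sum_le_sum fun nS _ =>
      (?_ : _ ≤ 2 * (Q * (c * ε ^ T.K * (c * ε ^ T.K))))).trans (le_of_eq ?_)
    · rw [two_mul]
      exact (abs_add_le _ _).trans (add_le_add
        (abs_quad_le S hcε (fun P hP P' hP' => (hEη P hP P' hP').1)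
          fun P hP => (abs_re_le_norm _).trans (hw nS P hP))
        (abs_quad_le S hcε (fun P hP P' hP' => (hEη P hP P' hP').2)
          fun P hP => (abs_im_le_norm _).trans (hw nS P hP)))
    · rw [Finset.sum_const, Finset.card_univ, Fintype.card_fin, nsmul_eq_mul, hG]
      ring
  have hWd : |W u - W fun nS => T.leadCoeff k n nS| ≤ 2 * G * ε ^ D := by
    rw [hW]
    simp only
    rw [← Finset.sum_sub_distrib]
    refine (Finset.abs_sum_le_sum_abs _ _).trans ?_
    refine (Finset.sum_le_sum fun nS _ =>
      (?_ : _ ≤ 2 * (Q * (2 * (c * ε ^ T.K * (c * ε ^ (T.K + 1))))))).trans (le_of_eq ?_)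
    · rw [two_mul, add_sub_add_comm]
      exact (abs_add_le _ _).trans (add_le_add
        (abs_quad_sub_quad_le S hcε (by positivity) (fun P hP P' hP' => (hEη P hP P' hP').1)
          (fun P hP => (abs_re_le_norm _).trans (hu1 nS P hP))
          (fun P hP => (abs_re_le_norm _).trans (hv1 nS P hP))
          (fun P hP => by rw [← sub_re]; exact (abs_re_le_norm _).trans (huv nS P hP)))
        (abs_quad_sub_quad_le S hcε (by positivity) (fun P hP P' hP' => (hEη P hP P' hP').2)
          (fun P hP => (abs_im_le_norm _).trans (hu1 nS P hP))
          (fun P hP => (abs_im_le_norm _).trans (hv1 nS P hP))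
          (fun P hP => by rw [← sub_im]; exact (abs_im_le_norm _).trans (huv nS P hP))))
    · rw [Finset.sum_const, Finset.card_univ, Fintype.card_fin, nsmul_eq_mul, hG, hD]
      ring
  set x : ℕ → ℕ → ℝ := fun a b =>
    (T.residualCoeff a b n n (freq M k)).re * T.mu Ps M a b with hx
  have hxb : ∀ a < D, ∀ b < D, |x a b| ≤ c * E := by
    intro a ha b hb
    rw [hx]
    simp only
    rw [abs_mul]
    exact mul_le_mul ((abs_re_le_norm _).trans (hc a ha b hb n n M k))
      (hE a (by omega) b (by omega)).1 (abs_nonneg _) hc0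
  set lin : ℝ := ∑ a ∈ Finset.range D, ∑ b ∈ Finset.range D, ε ^ (a + b) * x a b with hlin
  have hlinb : |lin| ≤ L := by
    refine (Finset.abs_sum_le_sum_abs _ _).trans ?_
    refine (Finset.sum_le_sum fun a ha => (?_ : _ ≤ D * (c * E))).trans (le_of_eq (by simp [hL]))
    refine (Finset.abs_sum_le_sum_abs _ _).trans ?_
    refine (Finset.sum_le_sum fun b hb => (?_ : _ ≤ c * E)).trans (le_of_eq (by simp))
    rw [abs_mul, abs_of_nonneg (by positivity), ← one_mul (c * E)]
    exact mul_le_mul (pow_le_one₀ hε0 hε1) (hxb a (Finset.mem_range.1 ha) b (Finset.mem_range.1 hb))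
      (abs_nonneg _) zero_le_one
  set diag : ℝ := ∑ m ∈ Finset.range D, ε ^ m * ∑ a ∈ Finset.range (m + 1), x a (m - a)
  have hdiag : |lin - diag| ≤ L * ε ^ D := abs_sum_sum_sub_diag_le (mul_nonneg hc0 hE0) hε0 hε1 hxb
  have hmain : T.mainPower Ps M k n = T.delta Ps M + 2 * lin + W u := by
    rw [mainPower, ← hD, ← hS, ← hε]
    congr 1
    · rw [hlin, hS, Finset.sum_product]
      simp only [re_ofReal_mul, hx, mul_assoc]
    · simp only [hW, hu, Finset.sum_add_distrib]
  have hPe1 : T.Pe1 Ps M k n = 2 * T.delta Ps M + 4 * diag :=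
    Pe1_eq hKT hKR Ps M (hsmooth.of_le (by omega)) h2.inverse k n
  have hPe2 : 2 * W (fun nS => T.leadCoeff k n nS) = T.Pe2 Ps M k n :=
    two_mul_sum_quad_leadCoeff hKT hKR (hsmooth.of_le (by omega)) h2.inverse Ps k n
  have hWu := hWb u hu1
  have hWv := hWb _ hv1
  have hG0 : 0 ≤ G := by positivity
  have hL0 : 0 ≤ L := by positivity
  clear_value W lin diag G L
  refine ⟨?_, ?_, ?_⟩
  · have hp : G * ε ^ (2 * T.K) ≤ G * 1 := by
      gcongr
      exact pow_le_one₀ hε0 hε1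
    have htri := abs_add_three (T.delta Ps M) (2 * lin) (W u)
    rw [abs_mul, abs_two] at htri
    rw [hmain]
    linarith only [htri, hEd, hlinb, hWu, hp, hG0, hL0]
  · have hdiff : 2 * T.mainPower Ps M k n - T.Pe Ps M k n =
        4 * (lin - diag) + 2 * (W u - W fun nS => T.leadCoeff k n nS) := by
      rw [hmain, Pe, hPe1, ← hPe2]
      ring
    have hεD : 0 ≤ E * ε ^ D := by positivity
    rw [hdiff]
    refine (abs_add_le _ _).trans ?_
    rw [abs_mul, abs_mul, abs_two, abs_of_nonneg (by norm_num : (0 : ℝ) ≤ 4)]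
    linarith only [hdiag, hWd, hεD]
  · rw [← hPe2, abs_mul, abs_two]
    have : 0 ≤ (E + 4 * L + 2 * G) * ε ^ (2 * T.K) := by positivity
    linarith only [this, hWv]

end Transceiver

/-! ### The mean square error -/

/-- Cauchy–Schwarz in weighted form: `2 |g r| ≤ η g² + η⁻¹ r²` with `r = f - g`, and `η` left free.
-/
lemma abs_sum_sq_sub_sum_sq_le {Y : Type*} [Fintype Y] (f g : Y → ℝ) {η : ℝ} (hη : 0 < η) :
    |∑ y, f y ^ 2 - ∑ y, g y ^ 2| ≤ η * ∑ y, g y ^ 2 + (1 + η⁻¹) * ∑ y, (f y - g y) ^ 2 := by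
  rw [← Finset.sum_sub_distrib, Finset.mul_sum, Finset.mul_sum, ← Finset.sum_add_distrib]
  refine (Finset.abs_sum_le_sum_abs _ _).trans (Finset.sum_le_sum fun y _ => ?_)
  set r := f y - g y with hr
  have hf : f y = g y + r := by rw [hr]; ring
  have h1 : 0 ≤ η⁻¹ * (η * g y - r) ^ 2 := by positivity
  have h2 : 0 ≤ η⁻¹ * (η * g y + r) ^ 2 := by positivity
  have e1 : η⁻¹ * (η * g y - r) ^ 2 = η * g y ^ 2 - 2 * g y * r + η⁻¹ * r ^ 2 := by
    field_simp; ring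
  have e2 : η⁻¹ * (η * g y + r) ^ 2 = η * g y ^ 2 + 2 * g y * r + η⁻¹ * r ^ 2 := by
    field_simp; ring
  have h3 := sq_nonneg r
  rw [hf, abs_le]
  constructor <;> nlinarith

namespace Transceiver

variable {NT NR NS : ℕ} {T : Transceiver NT NR NS}

/-- The main part has bounded, not small, power, so the cross term with the remainder decides. The
free `θ` records that this term is `o(ε ^ (2K))`. -/
lemma exists_bound_sum_errorCoeff_sq (hKT : 1 ≤ T.KT) (hKR : 1 ≤ T.KR) {R R' : ℕ}
    (h1 : T.PulseAssumption R) (h2 : T.ChannelAssumption R R') (N : ℕ) (Ps : ℝ) :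
    ∃ C : ℝ, 0 ≤ C ∧ ∀ θ : ℝ, 0 < θ → ∀ M : ℕ, 1 ≤ M → ∀ (n : Fin NS) (k : Fin (2 * M))
      (ℓ : Fin N), T.κ < (ℓ : ℕ) + 1 → (ℓ : ℕ) + 1 + T.κ ≤ N → ∀ o : Fin 2,
      |Ps / 2 * ∑ y, T.errorCoeff n k ℓ o y ^ 2 - T.mainPower Ps M k n| ≤
        (θ * |T.mainPower Ps M k n| + (1 + θ⁻¹) * C * (2 * (M : ℝ))⁻¹) *
          (2 * (M : ℝ))⁻¹ ^ (2 * T.K) := by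
  obtain ⟨C, hC0, hC⟩ := exists_bound_errorCoeff_sub hKT hKR h1 h2 N
  refine ⟨|Ps / 2| * (NS * (N * 2) * C ^ 2), by positivity, ?_⟩
  intro θ hθ M hM n k ℓ hℓ hℓ' o
  have hM0 : (1 : ℝ) ≤ M := by exact_mod_cast hM
  set ε := (2 * (M : ℝ))⁻¹ with hε
  have hε0 : 0 < ε := by positivity
  have hε1 : ε ≤ 1 := inv_le_one_of_one_le₀ (by linarith)
  have hMε : 2 * (M : ℝ) * ε = 1 := mul_inv_cancel₀ (by positivity)
  have hmain := sum_mainCoeff_sq hM h1.κ_pos Ps n k ℓ hℓ hℓ' o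
  -- With this weight the main part contributes `θ ε ^ (2K)` and the remainder at most `(1 + θ⁻¹) ε
  -- ^ (2K + 1)`, up to constants.
  have hη : 0 < θ * ε ^ (2 * T.K) := by positivity
  have hsq := abs_sum_sq_sub_sum_sq_le (T.errorCoeff n k ℓ o) (T.mainCoeff n k ℓ o) hη
  have hr : ∑ y, (T.errorCoeff n k ℓ o y - T.mainCoeff n k ℓ o y) ^ 2 ≤
      NS * (N * 2) * C ^ 2 * ε ^ (4 * T.K + 1) := by
    have hy : ∀ y ∈ Finset.univ, (T.errorCoeff n k ℓ o y - T.mainCoeff n k ℓ o y) ^ 2 ≤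
        (C * ε ^ (2 * T.K + 1)) ^ 2 := fun y _ => by
      rw [← sq_abs]
      exact pow_le_pow_left₀ (abs_nonneg _) (hC M hM n k ℓ o y) 2
    refine (Finset.sum_le_sum hy).trans (le_of_eq ?_)
    rw [Finset.sum_const, Finset.card_univ, nsmul_eq_mul]
    simp only [Fintype.card_prod, Fintype.card_fin]
    push_cast
    -- There are `NS · 2M · N · 2` coefficients; the factor `2M` uses up one of the `4K + 2` powers
    -- of `ε`.
    linear_combination (NS * (N * 2) * C ^ 2 * ε ^ (4 * T.K + 1)) * hMε
  have hm : |Ps / 2| * ∑ y, T.mainCoeff n k ℓ o y ^ 2 = |T.mainPower Ps M k n| := by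
    rw [← hmain, abs_mul, abs_of_nonneg (a := ∑ y, T.mainCoeff n k ℓ o y ^ 2)
      (Finset.sum_nonneg fun y _ => sq_nonneg _)]
  have hpow : (1 + (θ * ε ^ (2 * T.K))⁻¹) * ε ^ (4 * T.K + 1) ≤
      (1 + θ⁻¹) * ε * ε ^ (2 * T.K) := by
    have e1 : (1 + (θ * ε ^ (2 * T.K))⁻¹) * ε ^ (4 * T.K + 1) =
        ε ^ (4 * T.K + 1) + θ⁻¹ * ε * ε ^ (2 * T.K) := by
      rw [show 4 * T.K + 1 = 2 * T.K + 2 * T.K + 1 by ring, pow_add, pow_add, pow_one]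
      field_simp
    have e2 : ε ^ (4 * T.K + 1) ≤ ε ^ (2 * T.K + 1) :=
      pow_le_pow_of_le_one hε0.le hε1 (by omega)
    rw [e1]
    rw [pow_succ ε (2 * T.K)] at e2
    linarith
  rw [← hmain, ← mul_sub, abs_mul, hmain]
  calc |Ps / 2| * |∑ y, T.errorCoeff n k ℓ o y ^ 2 - ∑ y, T.mainCoeff n k ℓ o y ^ 2|
      ≤ |Ps / 2| * (θ * ε ^ (2 * T.K) * ∑ y, T.mainCoeff n k ℓ o y ^ 2 +
          (1 + (θ * ε ^ (2 * T.K))⁻¹) * (NS * (N * 2) * C ^ 2 * ε ^ (4 * T.K + 1))) := by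
        refine mul_le_mul_of_nonneg_left (hsq.trans ?_) (abs_nonneg _)
        gcongr
    _ = θ * |T.mainPower Ps M k n| * ε ^ (2 * T.K) + |Ps / 2| * (NS * (N * 2) * C ^ 2) *
          ((1 + (θ * ε ^ (2 * T.K))⁻¹) * ε ^ (4 * T.K + 1)) := by
        rw [← hm]; ring
    _ ≤ θ * |T.mainPower Ps M k n| * ε ^ (2 * T.K) + |Ps / 2| * (NS * (N * 2) * C ^ 2) *
          ((1 + θ⁻¹) * ε * ε ^ (2 * T.K)) := by gcongr
    _ = _ := by ring

end Transceiver

end FBMC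

end

/-! ### The asymptotic mean square error -/

theorem theorem1 {NT NR NS N : ℕ} {Ω : Type*} [MeasurableSpace Ω]
    (μ : MeasureTheory.Measure Ω) [MeasureTheory.IsProbabilityMeasure μ]
    (T : FBMC.Transceiver NT NR NS) (hKT : 1 ≤ T.KT) (hKR : 1 ≤ T.KR)
    (R R' : ℕ) (h1 : T.PulseAssumption R) (h2 : T.ChannelAssumption R R')
    (Ps : ℝ) (s : (M : ℕ) → Ω → Fin NS → Matrix (Fin (2 * M)) (Fin N) ℂ)
    (h3 : FBMC.BoundedConstellation μ s) (h4 : FBMC.IIDSymbols μ Ps s)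
    (n : Fin NS) (ℓ : Fin N) (hℓ : T.κ < (ℓ : ℕ) + 1) (hℓ' : (ℓ : ℕ) + 1 + T.κ ≤ N) :
    (∀ ε : ℝ, 0 < ε → ∀ᶠ M : ℕ in Filter.atTop, ∀ k : Fin (2 * M),
      |(∫ x, ‖T.estimate (s M x) n k ℓ - s M x n k ℓ‖ ^ 2 ∂μ) - T.Pe Ps M k n|
        ≤ ε * ((M : ℝ) ^ (2 * T.K))⁻¹) ∧
    (∃ C : ℝ, ∀ᶠ M : ℕ in Filter.atTop, ∀ k : Fin (2 * M),
      |T.Pe2 Ps M k n| ≤ C * ((M : ℝ) ^ (2 * T.K))⁻¹) := by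
  obtain ⟨C, hC0, hC⟩ := FBMC.Transceiver.exists_bound_mainPower_sub hKT hKR h1 h2 Ps
  obtain ⟨G, hG0, hG⟩ := FBMC.Transceiver.exists_bound_sum_errorCoeff_sq hKT hKR h1 h2 N Ps
  have hpow : ∀ M : ℕ, 1 ≤ M → (2 * (M : ℝ))⁻¹ ^ (2 * T.K) ≤ ((M : ℝ) ^ (2 * T.K))⁻¹ := by
    intro M hM
    have hM0 : (0 : ℝ) < M := by exact_mod_cast hM
    rw [← inv_pow]
    refine pow_le_pow_left₀ (by positivity) (inv_anti₀ hM0 (by linarith)) _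
  constructor
  · intro e he
    -- The two output parts contribute `2θC` from the main power, which this choice keeps below `e /
    -- 2`; the other half of `e` absorbs the terms that vanish with `M`.
    set θ : ℝ := e / (4 * (C + 1)) with hθ
    have hθ0 : 0 < θ := by positivity
    have hθC : 2 * (θ * C) ≤ e / 2 := by
      have h5 : θ * (4 * (C + 1)) = e := div_mul_cancel₀ _ (by positivity)
      linarith
    -- Collects what carries an additional factor `1/(2M)`: the remainders of both output parts and
    -- the distance from twice the main power to `Pe`.
    set B : ℝ := 2 * ((1 + θ⁻¹) * G) + C with hB
    have hB0 : 0 ≤ B := by positivity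
    have hlim : Filter.Tendsto (fun M : ℕ => B * (2 * (M : ℝ))⁻¹) Filter.atTop (nhds 0) := by
      have h6 : Filter.Tendsto (fun M : ℕ => (2 * (M : ℝ))⁻¹) Filter.atTop (nhds 0) :=
        (tendsto_natCast_atTop_atTop.const_mul_atTop (by norm_num : (0 : ℝ) < 2)).inv_tendsto_atTop
      simpa using h6.const_mul B
    filter_upwards [hlim.eventually (gt_mem_nhds (by positivity : (0 : ℝ) < e / 2)),
      Filter.eventually_ge_atTop 1] with M hMlim hM k
    obtain ⟨hm1, hm2, -⟩ := hC M hM n k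
    have hg0 := hG θ hθ0 M hM n k ℓ hℓ hℓ' 0
    have hg1 := hG θ hθ0 M hM n k ℓ hℓ hℓ' 1
    rw [T.integral_norm_estimate_sub_sq hM h3 h4 n k ℓ]
    have hM0 : (0 : ℝ) < M := by exact_mod_cast hM
    set δ : ℝ := (2 * (M : ℝ))⁻¹ with hδ
    have hδ0 : 0 < δ := by positivity
    set X := T.mainPower Ps M k n
    set E0 := Ps / 2 * ∑ y, T.errorCoeff n k ℓ 0 y ^ 2
    set E1 := Ps / 2 * ∑ y, T.errorCoeff n k ℓ 1 y ^ 2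
    have hθX : (θ * |X| + (1 + θ⁻¹) * G * δ) * δ ^ (2 * T.K) ≤
        (θ * C + (1 + θ⁻¹) * G * δ) * δ ^ (2 * T.K) := by gcongr
    have htri : |E0 + E1 - T.Pe Ps M k n| ≤ |E0 - X| + |E1 - X| + |2 * X - T.Pe Ps M k n| := by
      rw [show E0 + E1 - T.Pe Ps M k n = (E0 - X) + (E1 - X) + (2 * X - T.Pe Ps M k n) by ring]
      exact abs_add_three _ _ _
    calc |E0 + E1 - T.Pe Ps M k n|
        ≤ (2 * (θ * C) + B * δ) * δ ^ (2 * T.K) := by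
          rw [pow_succ] at hm2
          rw [hB]
          linarith
      _ ≤ e * δ ^ (2 * T.K) := by
          gcongr
          linarith
      _ ≤ e * ((M : ℝ) ^ (2 * T.K))⁻¹ := by
          gcongr
          exact hpow M hM
  · refine ⟨C, ?_⟩
    filter_upwards [Filter.eventually_ge_atTop 1] with M hM k
    exact (hC M hM n k).2.2.trans (by gcongr; exact hpow M hM)
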